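/- Let $\kappa$ be an algebraically closed field and $X_0$ a proper connected nodal curve over $\kappa$ with smooth irreducible components $Z_v$, whose dual graph $G$ (vertices $v$ = components, edges = nodes; $P_{e'}^v\in Z_v$ the branch on $Z_v$ of the node $e'$) is a multitree: the graph $\overline G$ obtained by merging parallel edges is a tree. Let $\bm n\colon E(G)\to\mathbb Z_{>0}$, let $\widetilde X_0$ be obtained from $X_0$ by inserting a chain of $\bm n(e')-1$ projective lines at each node $e'$, and let $\widetilde G$ be its dual graph. *Multidegrees.* Direct $G$; put $\sigma(e',v)=1$ if $v$ is the tail of $e'$ and $-1$ if it is the head. An admissible multidegree $w=(w_G,\mu)$ consists of $w_G\colon V(G)\to\mathbb Z$ and $\mu(e')\in\mathbb Z/\bm n(e')$; it is the divisor on $\widetilde G$ with coefficient $w_G(v)$ at $v$ and, if $\mu(e')\neq0$, one chip at distance $\mu(e')$ from the tail inside $e'$. Twisting $w$ at $v$ moves, for every edge $e'\ni v$, one chip by distance $1$ away from $v$ (the chip inside $e'$, or a chip taken from $v$ if $\mu(e')=0$); for an edge $e$ of $\overline G$ at $v$, twisting at $(e,v)$ does this only for the edges $e'$ over $e$. Let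 $w_0$ be an admissible multidegree of total degree $d$, and $(w_v)_{v\in V(G)}$ a tight tuple of admissible multidegrees obtained from $w_0$ by twists at vertices. Tight means: (i) $w_v$ is concentrated on $v$, i.e. for some ordering of $V(G)$ starting at $v$, $w_v$ becomes negative at each later vertex after the inverse twists at all previous ones; (ii) for every edge $e=\{v,v'\}$ of $\overline G$, $w_v$ is obtained from $w_{v'}$ by twisting $b=b_{v,v'}\ge0$ times at $(e,v')$. Define divisors on $Z_v$ by $D_0^{e,v}=0$ and $D_{i+1}^{e,v}-D_i^{e,v}=\sum P_{e'}^v$ over the $e'$ over $e$ with $\sigma(e',v)\mu_v(e')\equiv-i \pmod{\bm n(e')}$; $i$ is critical if $D_{i+1}^{e,v}\ne D_i^{e,v}$. For a space $V$ of sections of a line bundle, $V(-D)$ is the subspace of sections vanishing along $D$. *Pre-limit linear series.* A pre-limit linear series of rank $r\geq 0$ with respect to $(w_v)_v$ is a tuple $(\mathscr L_v,V_v)_v$ of line bundles $\mathscr L_v$ on $Z_v$ of degree $(w_v)_G(v)$ and $(r+1)$-dimensional spaces $V_v\subset H^0(Z_v,\mathscr L_v)$ such that for every edge $e=\{v,v'\}$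 of $\overline G$: (I) if $a^{e,v}_l=\deg D^{e,v}_j$ with $j\le b_{v,v'}$ critical, then $a^{e,v'}_{r-l}\ge\deg D^{e,v'}_{b_{v,v'}-j}$. Here $a_0^{e,v}\le\dots\le a_r^{e,v}$ is the multivanishing sequence, in which $\deg D_i^{e,v}$ ($i$ critical) occurs $\dim V_v(-D_i^{e,v})/V_v(-D_{i+1}^{e,v})$ times. Let $g_j$ be the number of $l$ with $a^{e,v}_l=\deg D^{e,v}_j$ and $a^{e,v'}_{r-l}=\deg D^{e,v'}_{b_{v,v'}-j}$. *Weak glueing condition.* For every edge $e=\{v,v'\}$ of $\overline G$ and every critical $0\le j\le b_{v,v'}$, let $I_j$ be the set of $e'$ over $e$ with $P_{e'}^v\le D_{j+1}^{e,v}-D_j^{e,v}$. Taking values at the points $P_{e'}^v$, resp. $P_{e'}^{v'}$, $e'\in I_j$, embeds $V_v(-D_j^{e,v})/V_v(-D_{j+1}^{e,v})$ and $V_{v'}(-D_{b-j}^{e,v'})/V_{v'}(-D_{b-j+1}^{e,v'})$ in $\kappa^{I_j}$, up to scaling of coordinates. The condition is that these spaces contain $g_j$-dimensional subspaces $W_v$,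 $W_{v'}$, respectively, with $\dim(T\cap W_v)=\dim(T\cap W_{v'})$ for every orbit $T$ of the torus $(\kappa^\times)^{I_j}$ on $\kappa^{I_j}$. *Lifting.* An enriched structure on $\widetilde X_0$ consists of line bundles $\mathscr O_u$, $u\in V(\widetilde G)$, with $\mathscr O_u|_{Z_u}\cong\mathscr O(-(Z_u\cap Z_u^c))$, $\mathscr O_u|_{Z_u^c}\cong\mathscr O(Z_u\cap Z_u^c)$ ($Z_u^c$ the closure of the complement of $Z_u$) and $\bigotimes_u\mathscr O_u\cong\mathscr O_{\widetilde X_0}$. Given one and a line bundle $\mathscr L$ on $\widetilde X_0$ of multidegree $w_0$, for $w$ obtained from $w_0$ by firing each $u\in V(\widetilde G)$ $F(u)$ times put $\mathscr L_w=\mathscr L\otimes\bigotimes_u\mathscr O_u^{F(u)}$, and put $\mathscr L^v=\mathscr L_{w_v}|_{Z_v}$. For $e=\{v,v'\}$ and $0\le j\le b$, let $w$ be obtained from $w_v$ by twisting $j$ times at $(e,v)$; then $\mathscr L_w|_{Z_v}\cong\mathscr L^v(-D_j^{e,v})$ and $\mathscr L_w|_{Z_{v'}}\cong\mathscr L^{v'}(-D_{b-j}^{e,v'})$,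 and $\mathscr L_w$ is trivial along the chains inserted at the nodes in $I_j$, which gives isomorphisms (up to a scalar) $\varphi_j\colon\mathscr L^v(-D_j^{e,v})/\mathscr L^v(-D_{j+1}^{e,v})\to\mathscr L^{v'}(-D_{b-j}^{e,v'})/\mathscr L^{v'}(-D_{b-j+1}^{e,v'})$. The pre-limit linear series lifts to a limit linear series if there is $\mathscr L$ of multidegree $w_0$ with $\mathscr L^v\cong\mathscr L_v$ for all $v$ such that, besides (I), for every edge $e=\{v,v'\}$ of $\overline G$: (II) there are bases $(s_l)$ of $V_v$ and $(s'_l)$ of $V_{v'}$, with $s_l$ of order $a^{e,v}_l$ along $D^{e,v}_\bullet$ and $s'_l$ of order $a^{e,v'}_l$ along $D^{e,v'}_\bullet$ (the order of $s$ is $\deg D_i$ for the largest $i$ such that $s$ vanishes along $D_i$), such that $\varphi_j(s_l)=s'_{r-l}$ whenever $j\le b_{v,v'}$ is critical, $a^{e,v}_l=\deg D^{e,v}_j$ and $a^{e,v'}_{r-l}=\deg D^{e,v'}_{b_{v,v'}-j}$. **Lemma.** Suppose that at most three edges of $G$ join any two vertices, and that $d'$ is an integer such that for any adjacent vertices of $G$,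 joined by the edges $(e_i)_i$, and any integers $(x_i)_i$ with $\sum_ix_i\bm n(e_i)=0$ for which there is a unique $j$ with $x_j>0$, we have $\sum_i\lfloor x_j\bm n(e_j)/\bm n(e_i)\rfloor>d'$. Suppose $d\le d'$. Then, for any enriched structure on $\widetilde X_0$, a pre-limit linear series $(\mathscr L_v,V_v)_v$ with respect to $(w_v)_v$ lifts to a limit linear series if and only if it satisfies the weak glueing condition. -/

import Mathlib

open scoped WithZero

universe u

namespace OssermanLLS

/-!
### Smooth proper curves and their line bundles

Over an algebraically closed field `κ` a smooth proper connected curve is given by its function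
field, an algebraic function field in one variable over `κ`.  Its closed points are the normalized
discrete valuations of the function field which are trivial on `κ`.  The invertible sheaf `𝒪(D)` is
the subsheaf of the constant sheaf of rational functions cut out by the divisor `D`; every
invertible sheaf is isomorphic to one of these.
-/

/-- A smooth proper connected curve over `κ`, given by its function field. -/
structure Curve (κ : Type u) [Field κ] where
  /-- the field of rational functions -/
  K : Type u
  [field : Field K]
  [algebra : Algebra κ K]
  exists_finite : ∃ x : K, Transcendental κ x ∧
    FiniteDimensional (IntermediateField.adjoin κ ({x} : Set K)) K

attribute [instance] Curve.field Curve.algebra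

/-- A `κ`-point of a curve: a normalized discrete valuation of the function field, trivial on the
constants and with residue field `κ`.  (For `κ` algebraically closed the residue field condition
is automatic, so these are all the closed points.)  The order of vanishing of `f` at the point is
`- log (val f)`. -/
structure Point {κ : Type u} [Field κ] (C : Curve κ) where
  /-- the multiplicatively written valuation -/
  val : Valuation C.K ℤᵐ⁰
  surjective : Function.Surjective val
  trivialOn : val.IsTrivialOn κ
  rational : ∀ f : C.K, val f ≤ 1 → ∃ c : κ, val (f - algebraMap κ C.K c) < 1

/-- A chosen uniformizer at a point. -/
noncomputable def Point.unif {κ : Type u} [Field κ] {C : Curve κ} (P : Point C) : C.K :=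
  (P.surjective (WithZero.exp (-1))).choose

open Classical in
/-- For a section `f` of `𝒪(m P)` near `P` (that is `ord_P f ≥ -m`), the coordinate of the value of
`f` in the fibre of `𝒪(m P)` at `P` with respect to the basis vector `t ^ (-m)`, where `t` is the
chosen uniformizer.  It is the residue of `f * t ^ m`.  (Junk value `0` if `f` is not a section.) -/
noncomputable def Point.coeff {κ : Type u} [Field κ] {C : Curve κ} (P : Point C) (m : ℤ)
    (f : C.K) : κ :=
  if h : ∃ c : κ, P.val (f * P.unif ^ m - algebraMap κ C.K c) < 1 then h.choose else 0

/-- Divisors on a curve. -/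
abbrev Divisor {κ : Type u} [Field κ] (C : Curve κ) : Type u := Point C →₀ ℤ

/-- The degree of a divisor. -/
noncomputable def Divisor.degree {κ : Type u} [Field κ] {C : Curve κ} (D : Divisor C) : ℤ :=
  D.sum fun _ m => m

/-- The space of global sections of `𝒪(D)`: rational functions `f` with `ord_P f ≥ - D P` for all
points `P` (together with `f = 0`). -/
def H0 {κ : Type u} [Field κ] {C : Curve κ} (D : Divisor C) : Submodule κ C.K where
  carrier := {f | ∀ P : Point C, P.val f ≤ WithZero.exp (D P)}
  zero_mem' := by
    intro P
    simp
  add_mem' := by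
    intro f g hf hg P
    exact (P.val.map_add f g).trans (max_le (hf P) (hg P))
  smul_mem' := by
    intro c f hf P
    have := P.trivialOn
    rw [Algebra.smul_def, map_mul]
    by_cases hc : c = 0
    · simp [hc]
    · rw [Valuation.IsTrivialOn.eq_one c hc, one_mul]
      exact hf P

/-- Multiplication by `h` is an isomorphism `𝒪(A) ≅ 𝒪(B)`, that is, `div h = A - B`. -/
def IsBundleIso {κ : Type u} [Field κ] {C : Curve κ} (h : C.K) (A B : Divisor C) : Prop :=
  h ≠ 0 ∧ ∀ P : Point C, P.val h = WithZero.exp (B P - A P)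

/-! ### Multivanishing sequences -/

/-- The subspace `U(-D)` of `U ⊆ H⁰(𝒪(A))`. -/
noncomputable def vanishing {κ : Type u} [Field κ] {C : Curve κ} (U : Submodule κ C.K) (A D : Divisor C) :
    Submodule κ C.K :=
  U ⊓ H0 (A - D)

/-- `j` is critical for the sequence `D`. -/
def IsCritical {κ : Type u} [Field κ] {C : Curve κ} (D : ℕ → Divisor C) (j : ℕ) : Prop :=
  D (j + 1) ≠ D j

/-- `a 0 ≤ ... ≤ a r` is the multivanishing sequence of `U ⊆ H⁰(𝒪(A))` along `D`: its entries are
degrees `deg (D i)` with `i` critical, and `deg (D i)` is repeated `dim U(-D i)/U(-D (i+1))`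
times. -/
def IsMultivanishing {κ : Type u} [Field κ] {C : Curve κ} {r : ℕ} (U : Submodule κ C.K)
    (A : Divisor C) (D : ℕ → Divisor C) (a : Fin (r + 1) → ℤ) : Prop :=
  Monotone a ∧ (∀ l, ∃ i, IsCritical D i ∧ a l = (D i).degree) ∧
    ∀ i, IsCritical D i →
      ((Finset.univ.filter fun l => a l = (D i).degree).card : ℤ) =
        (Module.finrank κ (vanishing U A (D i)) : ℤ) -
          Module.finrank κ (vanishing U A (D (i + 1)))

open Classical in
/-- The multivanishing sequence of an `(r + 1)`-dimensional space `U ⊆ H⁰(𝒪(A))` along `D`. -/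
noncomputable def multivanishing {κ : Type u} [Field κ] {C : Curve κ} (r : ℕ)
    (U : Submodule κ C.K) (A : Divisor C) (D : ℕ → Divisor C) : Fin (r + 1) → ℤ :=
  if h : ∃ a : Fin (r + 1) → ℤ, IsMultivanishing U A D a then h.choose else 0

/-- The order of vanishing of the section `s` of `𝒪(A)` along `D` is `c`: it is `deg (D i)` for the
largest `i` such that `s` is a section of `𝒪(A - D i)`. -/
def HasOrder {κ : Type u} [Field κ] {C : Curve κ} (A : Divisor C) (D : ℕ → Divisor C) (s : C.K)
    (c : ℤ) : Prop :=
  ∃ i, IsGreatest {i | s ∈ H0 (A - D i)} i ∧ c = (D i).degree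

/-! ### Nodal curves -/

/-- A proper nodal curve all of whose irreducible components are smooth, given by its normalization
together with the pairs of points which are glued.  The dual graph has the components as vertices
and the nodes as edges; it is directed: `node e false` is the branch of the node `e` on the
component which is the tail of `e`, and `node e true` the branch at the head.  Connectedness is not
part of this definition. -/
structure NodalCurve (κ : Type u) [Field κ] where
  /-- the components -/
  V : Type
  /-- the nodes -/
  E : Type
  [fintypeV : Fintype V]
  [decEqV : DecidableEq V]
  [fintypeE : Fintype E]
  [decEqE : DecidableEq E]
  comp : V → Curve κ
  node : E → Bool → Σ v, Point (comp v)
  loopless : ∀ e, (node e false).1 ≠ (node e true).1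
  injective : Function.Injective fun p : E × Bool => node p.1 p.2

attribute [instance] NodalCurve.fintypeV NodalCurve.decEqV NodalCurve.fintypeE NodalCurve.decEqE

namespace NodalCurve

section Basic

variable {κ : Type u} [Field κ] (X : NodalCurve κ)

/-- Points of the normalization. -/
abbrev Pt : Type u := Σ v, Point (X.comp v)

/-- Divisors on the normalization. -/
abbrev Div : Type u := ∀ v, Divisor (X.comp v)

/-- A point of the normalization as a divisor. -/
noncomputable def pointDiv (x : X.Pt) : X.Div :=
  Pi.single x.1 (Finsupp.single x.2 1)

def tail (e : X.E) : X.V := (X.node e false).1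

def head (e : X.E) : X.V := (X.node e true).1

/-- The nodes lying on both `Z_v` and `Z_{v'}`, i.e. the edges of the dual graph lying over the
edge `v v'` of the graph obtained by merging multiple edges. -/
def edges (v v' : X.V) : Finset X.E :=
  Finset.univ.filter fun e => (X.tail e = v ∧ X.head e = v') ∨ (X.tail e = v' ∧ X.head e = v)

/-- The nodes lying on `Z_v`. -/
def edgesAt (v : X.V) : Finset X.E :=
  Finset.univ.filter fun e => X.tail e = v ∨ X.head e = v

/-- The branch on `Z_v` of a node `e` lying on `Z_v`. -/
def branch (e : X.E) (v : X.V) : X.Pt :=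
  if X.tail e = v then X.node e false else X.node e true

/-- The simple graph obtained from the dual graph by merging multiple edges. -/
def mergedGraph : SimpleGraph X.V where
  Adj v v' := v ≠ v' ∧ (X.edges v v').Nonempty
  symm := ⟨by
    rintro v v' ⟨h, e, he⟩
    refine ⟨h.symm, e, ?_⟩
    simp only [edges, Finset.mem_filter, Finset.mem_univ, true_and] at he ⊢
    tauto⟩
  loopless := ⟨by
    rintro v ⟨h, -⟩
    exact h rfl⟩

/-- A (connected) curve of pseudocompact type: the dual graph is a multitree. -/
def IsPseudocompact : Prop := X.mergedGraph.IsTree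

/-- The coordinate at `x` of the value of the (rational) section `t` of the bundles `𝒪(A v)`. -/
noncomputable def valueAt (A : X.Div) (t : ∀ v, (X.comp v).K) (x : X.Pt) : κ :=
  x.2.coeff (A x.1 x.2) (t x.1)

/-! ### Line bundles on nodal curves and enriched structures -/

/-- A line bundle on a nodal curve: line bundles `𝒪(D v)` on the components and, at every node,
an isomorphism of the fibre at the tail branch with the fibre at the head branch.  In terms of the
bases `t ^ (-D)` of the fibres given by the chosen uniformizers `t`, that isomorphism is
multiplication by the scalar `glue e`. -/
structure LineBundle where
  D : X.Div
  glue : X.E → κˣ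

variable {X}

/-- The line bundle `𝒪(D)` for a divisor `D` not passing through the nodes under consideration. -/
def LineBundle.ofDiv (D : X.Div) : X.LineBundle := ⟨D, 1⟩

/-- `L ⊗ ⨂_u (O u) ^ (F u)`. -/
noncomputable def LineBundle.twistBy (L : X.LineBundle) (O : X.V → X.LineBundle) (F : X.V → ℤ) :
    X.LineBundle where
  D := L.D + ∑ u, F u • (O u).D
  glue e := L.glue e * ∏ u, (O u).glue e ^ F u

/-- The values of the section `t` of `L` on the two branches of the node `e` are identified by
the glueing isomorphism of `L`. -/
def LineBundle.MatchesAt (L : X.LineBundle) (e : X.E) (t : ∀ v, (X.comp v).K) : Prop :=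
  (L.glue e : κ) * X.valueAt L.D t (X.node e false) = X.valueAt L.D t (X.node e true)

/-- `L` and `M` become isomorphic on the subcurve which is the union of the components in `S`.  An
isomorphism is given on the component `v` by multiplication with a rational function `h v`; it acts
on the fibre at `x`, in terms of the chosen bases, as the residue of `h * t ^ (M.D - L.D)`; and
it has to commute with the glueing isomorphisms at the nodes of the subcurve. -/
def LineBundle.IsoOn (S : Set X.V) (L M : X.LineBundle) : Prop :=
  ∃ h : ∀ v, (X.comp v).K, (∀ v ∈ S, IsBundleIso (h v) (L.D v) (M.D v)) ∧
    ∀ e, X.tail e ∈ S → X.head e ∈ S →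
      (M.glue e : κ) * X.valueAt (M.D - L.D) h (X.node e false) =
        X.valueAt (M.D - L.D) h (X.node e true) * L.glue e

variable (X)

/-- The divisor which is `-(Z_v ∩ Z_v^c)` on `Z_v` and `Z_v ∩ Z_v^c` on the closure `Z_v^c` of the
complement of `Z_v`. -/
noncomputable def boundary (v : X.V) : X.Div :=
  ∑ e : X.E, ((if X.tail e = v then X.pointDiv (X.node e true) - X.pointDiv (X.node e false) else 0)
    + (if X.head e = v then X.pointDiv (X.node e false) - X.pointDiv (X.node e true) else 0))

/-- An enriched structure. -/
structure EnrichedStructure where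
  O : X.V → X.LineBundle
  iso_component : ∀ v, (O v).IsoOn {v} (LineBundle.ofDiv (X.boundary v))
  iso_complement : ∀ v, (O v).IsoOn {v}ᶜ (LineBundle.ofDiv (X.boundary v))
  iso_tensor : ((LineBundle.ofDiv (0 : X.Div)).twistBy O fun _ => 1).IsoOn Set.univ
    (LineBundle.ofDiv 0)

/-! ### Admissible multidegrees and twists -/

/-- An admissible multidegree for the chain structure `n`: `deg` is the degree on the vertices of
the dual graph, and `chip e ≠ 0` is the distance from the tail of `e` of the chip inside `e`. -/
structure Multidegree (n : X.E → ℕ+) where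
  deg : X.V → ℤ
  chip : ∀ e, ZMod (n e)

/-- `1` if `v` is the tail of `e`, and `-1` otherwise. -/
def sgn (e : X.E) (v : X.V) : ℤ := if X.tail e = v then 1 else -1

variable {X} {n : X.E → ℕ+}

namespace Multidegree

/-- The total degree. -/
def total (w : X.Multidegree n) : ℤ :=
  ((Finset.univ.filter fun e => w.chip e ≠ 0).card : ℤ) + ∑ v, w.deg v

/-- The twist at the vertex `v`. -/
def twist (w : X.Multidegree n) (v : X.V) : X.Multidegree n where
  deg u := w.deg u
    - (if u = v then (((X.edgesAt v).filter fun e => w.chip e = 0).card : ℤ) else 0)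
    + (((X.edges v u).filter fun e => w.chip e + (X.sgn e v : ZMod (n e)) = 0).card : ℤ)
  chip e := if e ∈ X.edgesAt v then w.chip e + (X.sgn e v : ZMod (n e)) else w.chip e

/-- The partial twist at `(e, v)`, where `e` is the edge `v v'` of the merged graph. -/
def partialTwist (v v' : X.V) (w : X.Multidegree n) : X.Multidegree n where
  deg u := w.deg u
    - (if u = v then (((X.edges v v').filter fun e => w.chip e = 0).card : ℤ) else 0)
    + (if u = v' then
        (((X.edges v v').filter fun e => w.chip e + (X.sgn e v : ZMod (n e)) = 0).card : ℤ) else 0)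
  chip e := if e ∈ X.edges v v' then w.chip e + (X.sgn e v : ZMod (n e)) else w.chip e

/-- `w` is obtained from `w₀` by a sequence of twists at vertices. -/
def Reachable (w₀ w : X.Multidegree n) : Prop :=
  ∃ l : List X.V, l.foldl twist w₀ = w

/-- `w` is concentrated on `v`: for an ordering of the vertices starting at `v`, the multidegree
becomes negative at each subsequent vertex after the negative twists (the inverses of the twists)
at all previous vertices. -/
def IsConcentrated (w : X.Multidegree n) (v : X.V) : Prop :=
  ∃ l : List X.V, (v :: l).Nodup ∧ (∀ u, u ∈ v :: l) ∧
    ∀ l₁ u l₂, l = l₁ ++ u :: l₂ →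
      ∃ w' : X.Multidegree n, (v :: l₁).foldl twist w' = w ∧ w'.deg u < 0

end Multidegree

/-- The tuple `w` is tight, with twisting numbers `b`. -/
def IsTight (w : X.V → X.Multidegree n) (b : X.V → X.V → ℕ) : Prop :=
  (∀ v, (w v).IsConcentrated v) ∧
    ∀ v v', X.mergedGraph.Adj v v' → w v = (Multidegree.partialTwist v' v)^[b v v'] (w v')

/-- The edges `e` over `v v'` at which `D_{i+1} - D_i` has the point `P_e^v`, where `D` is the
sequence of twisting divisors at `v` for the edge `v v'` of the merged graph. -/
def twistEdges (w : X.V → X.Multidegree n) (v v' : X.V) (i : ℕ) : Finset X.E :=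
  (X.edges v v').filter fun e => (X.sgn e v : ZMod (n e)) * (w v).chip e = -(i : ZMod (n e))

/-- The twisting divisors at `v` for the edge `v v'` of the merged graph, as divisors on the
normalization (supported on `Z_v`). -/
noncomputable def twistDiv (w : X.V → X.Multidegree n) (v v' : X.V) (i : ℕ) : X.Div :=
  ∑ k ∈ Finset.range i, ∑ e ∈ twistEdges w v v' k, X.pointDiv (X.branch e v)

/-- The twisting divisors at `v` for the edge `v v'` of the merged graph, as divisors on `Z_v`. -/
noncomputable def twistSeq (w : X.V → X.Multidegree n) (v v' : X.V) (i : ℕ) :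
    Divisor (X.comp v) :=
  twistDiv w v v' i v

/-! ### Pre-limit linear series and the weak glueing condition

In the following a tuple of line bundles on the components is a tuple `A` of divisors, and `U v`
is a space of sections of `𝒪(A v)`. -/

/-- The multivanishing sequence of `U v` along the twisting divisors for the edge `v v'`. -/
noncomputable def vanSeq (w : X.V → X.Multidegree n) (r : ℕ) (A : X.Div)
    (U : ∀ v, Submodule κ (X.comp v).K) (v v' : X.V) : Fin (r + 1) → ℤ :=
  multivanishing r (U v) (A v) (twistSeq w v v')

/-- The first condition in the definition of limit linear series, for the pair `v, v'` of adjacent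
vertices. -/
def VanishingCondition (w : X.V → X.Multidegree n) (b : X.V → X.V → ℕ) (r : ℕ) (A : X.Div)
    (U : ∀ v, Submodule κ (X.comp v).K) (v v' : X.V) : Prop :=
  ∀ (l : Fin (r + 1)) (j : ℕ), j ≤ b v v' → IsCritical (twistSeq w v v') j →
    vanSeq w r A U v v' l = (twistSeq w v v' j).degree →
    (twistSeq w v' v (b v v' - j)).degree ≤ vanSeq w r A U v' v (Fin.rev l)

/-- `(𝒪(A v), U v)_v` is a pre-limit linear series of rank `r` with respect to `(w v)_v`. -/
def IsPreLimit (w : X.V → X.Multidegree n) (b : X.V → X.V → ℕ) (r : ℕ) (A : X.Div)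
    (U : ∀ v, Submodule κ (X.comp v).K) : Prop :=
  (∀ v, (A v).degree = (w v).deg v ∧ U v ≤ H0 (A v) ∧ Module.finrank κ (U v) = r + 1) ∧
    ∀ v v', X.mergedGraph.Adj v v' → VanishingCondition w b r A U v v'

/-- The number `g_j` of indices `l` with `a_l = deg D_j` at which equality holds in the first
condition in the definition of limit linear series. -/
noncomputable def extremalCount (w : X.V → X.Multidegree n) (b : X.V → X.V → ℕ) (r : ℕ)
    (A : X.Div) (U : ∀ v, Submodule κ (X.comp v).K) (v v' : X.V) (j : ℕ) : ℕ :=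
  (Finset.univ.filter fun l : Fin (r + 1) =>
    vanSeq w r A U v v' l = (twistSeq w v v' j).degree ∧
      vanSeq w r A U v' v (Fin.rev l) = (twistSeq w v' v (b v v' - j)).degree).card

/-- The image of `U_v(-D)/U_v(-D')` in the direct sum of the fibres of `𝒪(A v - D)` at the points
`P_e^v`, `e ∈ I`, in coordinates; here `D' = D + ∑_{e ∈ I} P_e^v`, so that `U_v(-D)/U_v(-D')`
embeds. -/
def leadingTerms (A D : X.Div) (U : ∀ v, Submodule κ (X.comp v).K) (v : X.V) (I : Finset X.E) :
    Set (I → κ) :=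
  {x | ∃ s ∈ vanishing (U v) (A v) (D v),
    ∀ e : I, x e = X.valueAt (A - D) (Pi.single v s) (X.branch e v)}

/-- The orbit of the torus `(κˣ)^I` on `κ^I` consisting of the vectors with support `T`. -/
def torusOrbit {κ : Type u} [Field κ] {I : Type} (T : Set I) : Set (I → κ) :=
  {x | ∀ e, x e ≠ 0 ↔ e ∈ T}

/-- The weak glueing condition.  The dimension of the intersection of a torus orbit with a linear
space is the dimension of the linear span of the intersection, in which it is open. -/
def WeakGlueing (w : X.V → X.Multidegree n) (b : X.V → X.V → ℕ) (r : ℕ) (A : X.Div)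
    (U : ∀ v, Submodule κ (X.comp v).K) : Prop :=
  ∀ v v', X.mergedGraph.Adj v v' → ∀ j ≤ b v v', IsCritical (twistSeq w v v') j →
    ∃ W W' : Submodule κ (twistEdges w v v' j → κ),
      (W : Set _) ⊆ leadingTerms A (twistDiv w v v' j) U v (twistEdges w v v' j) ∧
      (W' : Set _) ⊆
        leadingTerms A (twistDiv w v' v (b v v' - j)) U v' (twistEdges w v v' j) ∧
      Module.finrank κ W = extremalCount w b r A U v v' j ∧
      Module.finrank κ W' = extremalCount w b r A U v v' j ∧
      ∀ T : Set (twistEdges w v v' j),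
        Module.finrank κ (Submodule.span κ (torusOrbit T ∩ {x | x ∈ W})) =
          Module.finrank κ (Submodule.span κ (torusOrbit T ∩ {x | x ∈ W'}))

end Basic

end NodalCurve

/-! ### Inserting chains of projective lines -/

section ProjectiveLine

variable (κ : Type u) [Field κ]

/-- The projective line. -/
noncomputable abbrev projectiveLine : Curve κ where
  K := RatFunc κ
  exists_finite := by
    refine ⟨RatFunc.X, RatFunc.transcendental_X, ?_⟩
    rw [RatFunc.adjoin_X]
    have h : Function.Surjective
        (Algebra.linearMap (⊤ : IntermediateField κ (RatFunc κ)) (RatFunc κ)) :=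
      fun x => ⟨⟨x, trivial⟩, rfl⟩
    exact Module.Finite.of_surjective _ h

/-- The point `0` of the projective line. -/
noncomputable def pointZero : Point (projectiveLine κ) where
  val := (Polynomial.idealX κ).valuation (RatFunc κ)
  surjective := RatFunc.valuation_surjective κ
  trivialOn := ⟨by
    intro a ha
    change (Polynomial.idealX κ).valuation (RatFunc κ) (algebraMap κ (RatFunc κ) a) = 1
    rw [IsScalarTower.algebraMap_apply κ (Polynomial κ) (RatFunc κ),
      IsDedekindDomain.HeightOneSpectrum.valuation_of_algebraMap,
      IsDedekindDomain.HeightOneSpectrum.intValuation_eq_one_iff, Polynomial.idealX_span,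
      Ideal.mem_span_singleton, Polynomial.X_dvd_iff]
    simpa using ha⟩
  rational := by
    intro (f : RatFunc κ) hf
    change (Polynomial.idealX κ).valuation (RatFunc κ) f ≤ 1 at hf
    set v := (Polynomial.idealX κ).valuation (RatFunc κ) with hv
    have key : ∀ p : Polynomial κ, v (algebraMap _ (RatFunc κ) p) < 1 ↔ p.coeff 0 = 0 := by
      intro p
      rw [hv, IsDedekindDomain.HeightOneSpectrum.valuation_of_algebraMap,
        IsDedekindDomain.HeightOneSpectrum.intValuation_lt_one_iff_mem, Polynomial.idealX_span,
        Ideal.mem_span_singleton, Polynomial.X_dvd_iff]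
    have le : ∀ p : Polynomial κ, v (algebraMap _ (RatFunc κ) p) ≤ 1 := by
      intro p
      rw [hv, IsDedekindDomain.HeightOneSpectrum.valuation_of_algebraMap]
      exact IsDedekindDomain.HeightOneSpectrum.intValuation_le_one _ _
    have hq0 : algebraMap _ (RatFunc κ) f.denom ≠ 0 := by
      simpa using f.denom_ne_zero
    have hfq : algebraMap _ (RatFunc κ) f.num = f * algebraMap _ (RatFunc κ) f.denom := by
      nth_rewrite 2 [← RatFunc.num_div_denom f]
      field_simp
    have hden : f.denom.coeff 0 ≠ 0 := by
      intro h0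
      have h1 : v (algebraMap _ (RatFunc κ) f.num) < 1 := by
        rw [hfq, map_mul]
        exact (mul_le_of_le_one_left' hf).trans_lt ((key _).2 h0)
      have h2 := (key _).1 h1
      rw [← Polynomial.X_dvd_iff] at h0 h2
      exact Polynomial.not_isUnit_X (f.isCoprime_num_denom.isUnit_of_dvd' h2 h0)
    have hvden : v (algebraMap _ (RatFunc κ) f.denom) = 1 :=
      le_antisymm (le _) (not_lt.1 fun h => hden ((key _).1 h))
    refine ⟨f.num.coeff 0 / f.denom.coeff 0, ?_⟩
    set c := f.num.coeff 0 / f.denom.coeff 0 with hc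
    change v (f - algebraMap κ (RatFunc κ) c) < 1
    have h3 : v ((f - algebraMap κ (RatFunc κ) c) * algebraMap _ (RatFunc κ) f.denom) < 1 := by
      have : (f - algebraMap κ (RatFunc κ) c) * algebraMap _ (RatFunc κ) f.denom =
          algebraMap _ (RatFunc κ) (f.num - Polynomial.C c * f.denom) := by
        rw [map_sub, map_mul, hfq, sub_mul]
        congr 2
      rw [this, key, Polynomial.coeff_sub, Polynomial.coeff_C_mul, hc, div_mul_cancel₀ _ hden,
        sub_self]
    rwa [map_mul, hvden, mul_one] at h3

open Classical in
/-- The point `∞` of the projective line. -/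
noncomputable def pointInfty : Point (projectiveLine κ) where
  val := RatFunc.inftyValuation κ
  surjective := by
    have h : ∀ m, ∃ f : RatFunc κ, RatFunc.inftyValuation κ f = m := by
      intro m
      by_cases hm : m = 0
      · exact ⟨0, by rw [hm, map_zero]⟩
      · exact ⟨RatFunc.X ^ (WithZero.log m), by
          rw [RatFunc.inftyValuation.X_zpow, WithZero.exp_log hm]⟩
    exact h
  trivialOn := inferInstanceAs (Valuation.IsTrivialOn κ (RatFunc.inftyValuation κ))
  rational := by
    intro (f : RatFunc κ) hf
    change RatFunc.inftyValuation κ f ≤ 1 at hf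
    set v := RatFunc.inftyValuation κ with hv
    by_cases hlt : v f < 1
    · refine ⟨0, ?_⟩
      change v (f - algebraMap κ (RatFunc κ) 0) < 1
      simpa using hlt
    have h1 : v f = 1 := le_antisymm hf (not_lt.1 hlt)
    have hpoly : ∀ p : Polynomial κ, p ≠ 0 →
        v (algebraMap _ (RatFunc κ) p) = WithZero.exp (p.natDegree : ℤ) :=
      fun p hp => RatFunc.inftyValuation.polynomial κ hp
    have hq : f.denom ≠ 0 := f.denom_ne_zero
    have hq0 : algebraMap _ (RatFunc κ) f.denom ≠ 0 := by simpa using hq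
    have hfq : algebraMap _ (RatFunc κ) f.num = f * algebraMap _ (RatFunc κ) f.denom := by
      nth_rewrite 2 [← RatFunc.num_div_denom f]
      field_simp
    have hp : f.num ≠ 0 := by
      intro h
      have : f = 0 := RatFunc.num_eq_zero_iff.1 h
      rw [this, map_zero] at h1
      exact zero_ne_one h1
    have hdeg : f.num.natDegree = f.denom.natDegree := by
      have h2 := congrArg v hfq
      rw [map_mul, h1, one_mul, hpoly _ hp, hpoly _ hq, WithZero.exp_inj] at h2
      exact_mod_cast h2
    have hlq : f.denom.leadingCoeff ≠ 0 := by simpa using hq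
    have hlp : f.num.leadingCoeff ≠ 0 := by simpa using hp
    refine ⟨f.num.leadingCoeff / f.denom.leadingCoeff, ?_⟩
    set c := f.num.leadingCoeff / f.denom.leadingCoeff with hc
    have hc0 : c ≠ 0 := div_ne_zero hlp hlq
    change v (f - algebraMap κ (RatFunc κ) c) < 1
    have h3 : v ((f - algebraMap κ (RatFunc κ) c) * algebraMap _ (RatFunc κ) f.denom) <
        v (algebraMap _ (RatFunc κ) f.denom) := by
      have : (f - algebraMap κ (RatFunc κ) c) * algebraMap _ (RatFunc κ) f.denom =
          algebraMap _ (RatFunc κ) (f.num - Polynomial.C c * f.denom) := by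
        rw [map_sub, map_mul, hfq, sub_mul]
        congr 2
      rw [this]
      by_cases hz : f.num - Polynomial.C c * f.denom = 0
      · rw [hz, map_zero, map_zero, zero_lt_iff, Valuation.ne_zero_iff]
        exact hq0
      · rw [hpoly _ hz, hpoly _ hq, WithZero.exp_lt_exp]
        have hd : (Polynomial.C c * f.denom).degree = f.num.degree := by
          rw [Polynomial.degree_C_mul hc0, Polynomial.degree_eq_natDegree hq,
            Polynomial.degree_eq_natDegree hp, hdeg]
        have hl : f.num.leadingCoeff = (Polynomial.C c * f.denom).leadingCoeff := by
          rw [Polynomial.leadingCoeff_mul, Polynomial.leadingCoeff_C, hc, div_mul_cancel₀ _ hlq]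
        have h4 := Polynomial.degree_sub_lt_left hd.symm hp hl
        rw [← hdeg]
        exact_mod_cast Polynomial.natDegree_lt_natDegree hz h4
    rw [map_mul] at h3
    by_contra hcon
    exact absurd h3 (not_lt.2 (le_mul_of_one_le_left' (not_lt.1 hcon)))

theorem pointZero_ne_pointInfty : pointZero κ ≠ pointInfty κ := by
  intro h
  have h1 : (pointZero κ).val RatFunc.X = (pointInfty κ).val RatFunc.X := by rw [h]
  have h2 : (pointZero κ).val RatFunc.X = WithZero.exp (-1 : ℤ) :=
    Polynomial.valuation_X_eq_neg_one κ
  have h3 : (pointInfty κ).val RatFunc.X = WithZero.exp (1 : ℤ) := by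
    classical
    exact RatFunc.inftyValuation.X κ
  rw [h2, h3, WithZero.exp_inj] at h1
  norm_num at h1

end ProjectiveLine

namespace NodalCurve

section Chains

variable {κ : Type u} [Field κ] (X : NodalCurve κ) (n : X.E → ℕ+)

/-- The vertices of the dual graph after inserting a chain of `n e - 1` projective lines at every
node `e`; the line `⟨e, k⟩` corresponds to the point at distance `k + 1` from the tail of `e`. -/
abbrev ChainV : Type := X.V ⊕ (Σ e : X.E, Fin ((n e : ℕ) - 1))

/-- The components after inserting chains of projective lines. -/
noncomputable abbrev chainComp (u : X.ChainV n) : Curve κ :=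
  Sum.elim X.comp (fun _ => projectiveLine κ) u

/-- The nodes after inserting chains: the node `⟨e, k⟩` joins the components at the distances `k`
and `k + 1` from the tail of `e`. -/
noncomputable def chainNode (p : Σ e : X.E, Fin (n e)) :
    Bool → Σ u, Point (X.chainComp n u)
  | false => if h : p.2.val = 0 then ⟨Sum.inl (X.node p.1 false).1, (X.node p.1 false).2⟩
      else ⟨Sum.inr ⟨p.1, ⟨p.2.val - 1, by have := p.2.isLt; omega⟩⟩, pointInfty κ⟩
  | true => if h : p.2.val + 1 = n p.1 then ⟨Sum.inl (X.node p.1 true).1, (X.node p.1 true).2⟩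
      else ⟨Sum.inr ⟨p.1, ⟨p.2.val, by have := p.2.isLt; omega⟩⟩, pointZero κ⟩

theorem chainNode_loopless (p : Σ e : X.E, Fin (n e)) :
    (X.chainNode n p false).1 ≠ (X.chainNode n p true).1 := by
  have := X.loopless p.1
  unfold chainNode
  split_ifs with h1 h2 h2
  · simpa using this
  · simp
  · simp
  · simp only [ne_eq, Sum.inr.injEq, Sigma.mk.injEq, heq_eq_eq, Fin.mk.injEq, true_and]
    omega

theorem chainNode_injective :
    Function.Injective fun q : (Σ e : X.E, Fin (n e)) × Bool => X.chainNode n q.1 q.2 := by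
  have hX : ∀ e b e' b', X.node e b = X.node e' b' → e = e' ∧ b = b' := by
    intro e b e' b' h
    have := @X.injective (e, b) (e', b') h
    simpa using this
  have emb : ∀ x y : X.Pt,
      (⟨Sum.inl x.1, x.2⟩ : Σ u, Point (X.chainComp n u)) = ⟨Sum.inl y.1, y.2⟩ → x = y := by
    intro x y h
    obtain ⟨h1, h2⟩ := Sigma.ext_iff.1 h
    exact Sigma.ext (Sum.inl.inj h1) h2
  have lr : ∀ (x : X.Pt) (u) (P : Point (projectiveLine κ)),
      (⟨Sum.inl x.1, x.2⟩ : Σ u, Point (X.chainComp n u)) ≠ ⟨Sum.inr u, P⟩ := by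
    intro x u P h
    exact Sum.inl_ne_inr (congrArg Sigma.fst h)
  have line : ∀ (u u') (P P' : Point (projectiveLine κ)),
      (⟨Sum.inr u, P⟩ : Σ u, Point (X.chainComp n u)) = ⟨Sum.inr u', P'⟩ → u = u' ∧ P = P' := by
    intro u u' P P' h
    obtain ⟨h1, h2⟩ := Sigma.ext_iff.1 h
    exact ⟨Sum.inr.inj h1, eq_of_heq h2⟩
  have chain : ∀ (e e' : X.E) (k : Fin (n e)) (k' : Fin (n e')), e = e' → k.val = k'.val →
      (⟨e, k⟩ : Σ e : X.E, Fin (n e)) = ⟨e', k'⟩ := by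
    rintro e _ k k' rfl h
    rw [Fin.ext h]
  have lines : ∀ (e e' : X.E) (k : Fin ((n e : ℕ) - 1)) (k' : Fin ((n e' : ℕ) - 1)),
      (⟨e, k⟩ : Σ e : X.E, Fin ((n e : ℕ) - 1)) = ⟨e', k'⟩ → e = e' ∧ k.val = k'.val := by
    intro e e' k k' h
    obtain ⟨rfl, h⟩ := Sigma.mk.inj_iff.1 h
    exact ⟨rfl, congrArg Fin.val (eq_of_heq h)⟩
  rintro ⟨⟨e, k⟩, b⟩ ⟨⟨e', k'⟩, b'⟩ h
  have hk := k.isLt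
  have hk' := k'.isLt
  cases b <;> cases b' <;> simp only [chainNode] at h <;> split_ifs at h with h1 h2 h2
  · obtain ⟨h3, -⟩ := hX _ _ _ _ (emb _ _ h)
    rw [chain e e' k k' h3 (by omega)]
  · exact (lr _ _ _ h).elim
  · exact (lr _ _ _ h.symm).elim
  · obtain ⟨h3, h4⟩ := lines _ _ _ _ (line _ _ _ _ h).1
    rw [chain e e' k k' h3 (by dsimp only at h4; omega)]
  · exact absurd (hX _ _ _ _ (emb _ _ h)).2 (by simp)
  · exact (lr _ _ _ h).elim
  · exact (lr _ _ _ h.symm).elim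
  · exact absurd (line _ _ _ _ h).2 (pointZero_ne_pointInfty κ).symm
  · exact absurd (hX _ _ _ _ (emb _ _ h)).2 (by simp)
  · exact (lr _ _ _ h).elim
  · exact (lr _ _ _ h.symm).elim
  · exact absurd (line _ _ _ _ h).2 (pointZero_ne_pointInfty κ)
  · obtain ⟨rfl, -⟩ := hX _ _ _ _ (emb _ _ h)
    rw [chain e e k k' rfl (by omega)]
  · exact (lr _ _ _ h).elim
  · exact (lr _ _ _ h.symm).elim
  · obtain ⟨h3, h4⟩ := lines _ _ _ _ (line _ _ _ _ h).1
    rw [chain e e' k k' h3 (by dsimp only at h4; omega)]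

/-- The curve obtained from `X` by inserting a chain of `n e - 1` projective lines at every
node `e`. -/
noncomputable abbrev withChains : NodalCurve κ where
  V := X.ChainV n
  E := Σ e : X.E, Fin (n e)
  comp := X.chainComp n
  node := X.chainNode n
  loopless := X.chainNode_loopless n
  injective := X.chainNode_injective n

variable {X n}

/-- The divisor `D_w` on the dual graph of the curve with chains. -/
def Multidegree.toDiv (w : X.Multidegree n) : (X.withChains n).V → ℤ
  | Sum.inl v => w.deg v
  | Sum.inr p => if (w.chip p.1).val = p.2.val + 1 then 1 else 0

/-- Firing every vertex `u` of the dual graph of the curve with chains `F u` times transforms the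
divisor `D_w` into `D_{w'}`. -/
def IsFiring (w w' : X.Multidegree n) (F : (X.withChains n).V → ℤ) : Prop :=
  ∀ u, w'.toDiv u = w.toDiv u - ∑ e : (X.withChains n).E,
    ((if (X.withChains n).tail e = u then F u - F ((X.withChains n).head e) else 0)
      + (if (X.withChains n).head e = u then F u - F ((X.withChains n).tail e) else 0))

open Classical in
/-- A firing function transforming `w` into `w'` (unique up to an additive constant). -/
noncomputable def firing (w w' : X.Multidegree n) : (X.withChains n).V → ℤ :=
  if h : ∃ F, IsFiring w w' F then h.choose else 0

/-- `L` is of multidegree `w`. -/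
def LineBundle.HasMultidegree (L : (X.withChains n).LineBundle) (w : X.Multidegree n) : Prop :=
  ∀ u, (L.D u).degree = w.toDiv u

/-- The line bundle `L_w` of multidegree `w` induced by the line bundle `L` of multidegree `w₀` and
the enriched structure: `L` is tensored with `O_u` for every firing at `u` in passing from `w₀`
to `w`. -/
noncomputable def LineBundle.inDegree (L : (X.withChains n).LineBundle)
    (O : (X.withChains n).EnrichedStructure) (w₀ w : X.Multidegree n) :
    (X.withChains n).LineBundle :=
  L.twistBy O.O (firing w₀ w)

/-- The line bundles `L^v`, the restrictions of `L_{w v}` to `Z_v`. -/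
noncomputable def LineBundle.onComponents (L : (X.withChains n).LineBundle)
    (O : (X.withChains n).EnrichedStructure) (w₀ : X.Multidegree n)
    (w : X.V → X.Multidegree n) : X.Div :=
  fun v => (L.inDegree O w₀ (w v)).D (Sum.inl v)

/-- The values of a section `s` of `M` on `Z_v` and of a section `s'` of `M` on `Z_{v'}` at the
branches of the nodes in `I` (all of which lie on `Z_v` and `Z_{v'}`) correspond to each other
under `M` along the inserted chains: there are sections of `M` on the projective lines of the
chains inserted at the nodes in `I` which together with `s` and `s'` are compatible with the
glueing isomorphisms of `M`.  (If `M` has degree zero on these lines, it is trivial along the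
chains, and this is the graph of an isomorphism between the fibres at the two ends.) -/
def LineBundle.Corresponds (M : (X.withChains n).LineBundle) (I : Finset X.E) (v v' : X.V)
    (s : (X.comp v).K) (s' : (X.comp v').K) : Prop :=
  ∃ t : ∀ u, ((X.withChains n).comp u).K,
    (t (Sum.inl v) : (X.comp v).K) = s ∧ (t (Sum.inl v') : (X.comp v').K) = s' ∧
      ∀ e ∈ I, (∀ k, t (Sum.inr ⟨e, k⟩) ∈ H0 (M.D (Sum.inr ⟨e, k⟩))) ∧
        ∀ k : Fin (n e), M.MatchesAt ⟨e, k⟩ t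

/-- The second condition in the definition of limit linear series, for the pair `v, v'` of adjacent
vertices.  The glueing isomorphism
`φ_j : L^v(-D_j) / L^v(-D_{j+1}) ≅ L^{v'}(-D'_{b-j}) / L^{v'}(-D'_{b-j+1})` is given by the line
bundle `M` induced by `L` in the multidegree obtained by twisting `j` times at `(e, v)` from `w v`:
the restrictions of `M` to `Z_v` and `Z_{v'}` are isomorphic, uniquely up to scalars, to
`L^v(-D_j)` and `L^{v'}(-D'_{b-j})` by multiplication with functions `α` and `β`, and `M` has degree
zero on the chains inserted at the nodes where `D_{j+1} - D_j` is supported. -/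
def GlueingCondition (O : (X.withChains n).EnrichedStructure) (w₀ : X.Multidegree n)
    (w : X.V → X.Multidegree n) (b : X.V → X.V → ℕ) (r : ℕ) (L : (X.withChains n).LineBundle)
    (U : ∀ v, Submodule κ (X.comp v).K) (v v' : X.V) : Prop :=
  ∃ (s : Module.Basis (Fin (r + 1)) κ (U v)) (s' : Module.Basis (Fin (r + 1)) κ (U v')),
    (∀ l, HasOrder (L.onComponents O w₀ w v) (twistSeq w v v') (s l)
      (vanSeq w r (L.onComponents O w₀ w) U v v' l)) ∧
    (∀ l, HasOrder (L.onComponents O w₀ w v') (twistSeq w v' v) (s' l)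
      (vanSeq w r (L.onComponents O w₀ w) U v' v l)) ∧
    ∀ j ≤ b v v', IsCritical (twistSeq w v v') j →
      ∃ (α : (X.comp v).K) (β : (X.comp v').K),
        IsBundleIso α (L.onComponents O w₀ w v - twistSeq w v v' j)
          ((L.inDegree O w₀ ((Multidegree.partialTwist v v')^[j] (w v))).D (Sum.inl v)) ∧
        IsBundleIso β (L.onComponents O w₀ w v' - twistSeq w v' v (b v v' - j))
          ((L.inDegree O w₀ ((Multidegree.partialTwist v v')^[j] (w v))).D (Sum.inl v')) ∧
        ∀ l : Fin (r + 1),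
          vanSeq w r (L.onComponents O w₀ w) U v v' l = (twistSeq w v v' j).degree →
          vanSeq w r (L.onComponents O w₀ w) U v' v (Fin.rev l) =
            (twistSeq w v' v (b v v' - j)).degree →
          (L.inDegree O w₀ ((Multidegree.partialTwist v v')^[j] (w v))).Corresponds
            (twistEdges w v v' j) v v' (α * s l) (β * s' (Fin.rev l))

/-- `(L, (U v)_v)` is a limit linear series of rank `r` and multidegree `w₀` with respect to the
tight tuple `w` and the enriched structure `O`. -/
def IsLimitLinearSeries (O : (X.withChains n).EnrichedStructure) (w₀ : X.Multidegree n)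
    (w : X.V → X.Multidegree n) (b : X.V → X.V → ℕ) (r : ℕ) (L : (X.withChains n).LineBundle)
    (U : ∀ v, Submodule κ (X.comp v).K) : Prop :=
  L.HasMultidegree w₀ ∧
  (∀ v, U v ≤ H0 (L.onComponents O w₀ w v) ∧ Module.finrank κ (U v) = r + 1) ∧
  ∀ v v', X.mergedGraph.Adj v v' →
    VanishingCondition w b r (L.onComponents O w₀ w) U v v' ∧
    GlueingCondition O w₀ w b r L U v v'

/-- The pre-limit linear series `(𝒪(A v), U v)_v` lifts to a limit linear series: for some line
bundle `L` of multidegree `w₀` there are isomorphisms `𝒪(A v) ≅ L^v` such that `L` together with the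
images of the spaces `U v` is a limit linear series. -/
def LiftsToLimit (O : (X.withChains n).EnrichedStructure) (w₀ : X.Multidegree n)
    (w : X.V → X.Multidegree n) (b : X.V → X.V → ℕ) (r : ℕ) (A : X.Div)
    (U : ∀ v, Submodule κ (X.comp v).K) : Prop :=
  ∃ L : (X.withChains n).LineBundle, L.HasMultidegree w₀ ∧
    ∃ h : ∀ v, (X.comp v).K, (∀ v, IsBundleIso (h v) (A v) (L.onComponents O w₀ w v)) ∧
      IsLimitLinearSeries O w₀ w b r L fun v => (U v).map (LinearMap.mulLeft κ (h v))

end Chains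

end NodalCurve

end OssermanLLS

/-! Fix an edge `e = {v, v'}` of the merged graph and a critical `j`. In coordinates given by the
nodes in `I_j`, the glueing `φ_j` is diagonal, i.e. an element of the torus `(κˣ)^{I_j}`. Condition
(II) asks that `φ_j` carry the leading terms of the `g_j` extremal basis sections on `Z_v` to those
on `Z_{v'}`. These leading terms are independent, because a basis with the prescribed orders is
independent in every graded piece (`linearIndepOn_graded`). So a lift provides `g_j`-dimensional
spaces `W` and `W' = φ_j W`, and a torus element preserves each orbit and hence the dimensions of
the intersections with it. This is the weak glueing condition.

Conversely, `I_j` has at most three elements, so a proper nonzero `W` is a line or a hyperplane. Up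
to the torus, a line is determined by the support of a generator and a hyperplane by the support of
its equation, and both supports can be read off from the orbits that are met. Hence `W' = θ_j W` for
a torus element `θ_j` (`exists_scale_map_eq`). Fix a line bundle with the required restrictions to
the components (`liftBundle`). Its glueing can still be rescaled by one scalar for each node of the
original curve (`rescale`), and this multiplies all the `φ_j` of one edge by restrictions of a
single torus element. The glueing scalars of the enriched structure only contribute to the fixed
factor with which one starts, so the structure can be arbitrary. What is needed is one element of
`(κˣ)^{edges over e}` with prescribed restriction, up to a scalar, to every `I_j` with `g_j > 0`.

Among at most three edges such an element exists if those `I_j` meet pairwise in at most one edge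
and contain no triangle (`exists_torus_of_forest`). This is where the numerical hypothesis enters. A
node common to `I_i` and `I_k` has `n` dividing `k - i`. Two common nodes, or a triangle, therefore
yield integers `x` with `∑ x n = 0`, exactly one of them positive, whose positive term is the
largest difference `k - i` of the indices involved. Then `∑ ⌊(k - i) / n⌋ > d'`, and this sum is at
most `deg D_k - deg D_i` (`sum_div_le_degree_sub`). On the other hand `deg D_k - deg D_i ≤ d` when
both indices are extremal (`IsPreLimit.degree_sub_le_total`): an extremal section of index `k` on
`Z_v`, one of index `i` on `Z_{v'}`, and suitable nonzero sections on the other components all leave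
bundles of nonnegative degree, and these degrees are added up over the tree rooted at `v`. As `d ≤
d'`, this is a contradiction.

Curves are given by function fields, so the degree theory is derived directly: a transcendental
function has at most `[K : κ(f)]` zeros and at least that many poles (`sum_zeros_le_finrank`,
`finrank_le_degree_polar`), whence a bundle with a nonzero section has nonnegative degree. The
passage between multidegrees rests on the uniqueness of firing functions up to constants
(`IsFiring.sub_eq_sub`): an arbitrary choice of `firing` still gives the expected isomorphism
classes on the components. -/

namespace OssermanLLS

open Polynomial IntermediateField

/-! ### Function fields of one variable: finiteness over `κ(f)` and linear relations over `κ[f]` -/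

section FunctionField

variable {κ : Type u} [Field κ]

-- Since `K` is algebraic over `κ(x)`, its transcendence degree is at most one, so `f` alone is a
-- transcendence basis. Then `κ(f)(x)` is finite over `κ(f)`, and `K` is finite over it because it
-- is already finite over `κ(x)`.
open scoped IntermediateField.algebraAdjoinAdjoin in
theorem Curve.finiteDimensional_adjoin (C : Curve κ) {f : C.K} (hf : Transcendental κ f) :
    FiniteDimensional κ⟮f⟯ C.K := by
  obtain ⟨x, -, hfin⟩ := C.exists_finite
  have halg : Algebra.IsAlgebraic (Algebra.adjoin κ {x}) C.K := by
    have h : Algebra.IsAlgebraic κ⟮x⟯ C.K := inferInstance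
    have h' : Algebra.IsAlgebraic (Algebra.adjoin κ {x}) κ⟮x⟯ :=
      IsLocalization.isAlgebraic _ (nonZeroDivisors (Algebra.adjoin κ {x}))
    exact Algebra.IsAlgebraic.trans (Algebra.adjoin κ {x}) κ⟮x⟯ C.K
  have htr : Algebra.trdeg κ C.K ≤ 1 := by
    simpa using Algebra.IsAlgebraic.trdeg_le_cardinalMk κ ({x} : Set C.K)
  have hb : IsTranscendenceBasis κ (fun _ : PUnit.{u + 1} => f) := by
    refine AlgebraicIndependent.isTranscendenceBasis_of_trdeg_le_of_finite ?_ (by simpa using htr)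
    exact (algebraicIndependent_unique_type_iff).2 hf
  have halg' : Algebra.IsAlgebraic κ⟮f⟯ C.K := by
    have := hb.isAlgebraic_field
    rwa [Set.range_const] at this
  have h1 : FiniteDimensional κ⟮f⟯ κ⟮f⟯⟮x⟯ :=
    IntermediateField.adjoin.finiteDimensional (Algebra.IsAlgebraic.isAlgebraic x).isIntegral
  have h2 : FiniteDimensional κ⟮f⟯⟮x⟯ C.K := by
    have hle : κ⟮x⟯ ≤ (κ⟮f⟯⟮x⟯).restrictScalars κ := by
      rw [IntermediateField.adjoin_simple_le_iff]
      exact IntermediateField.mem_adjoin_simple_self _ x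
    let : Algebra κ⟮x⟯ κ⟮f⟯⟮x⟯ := (IntermediateField.inclusion hle).toRingHom.toAlgebra
    have : IsScalarTower κ⟮x⟯ κ⟮f⟯⟮x⟯ C.K := IsScalarTower.of_algebraMap_eq fun _ => rfl
    exact Module.Finite.of_restrictScalars_finite κ⟮x⟯ κ⟮f⟯⟮x⟯ C.K
  exact Module.Finite.trans κ⟮f⟯⟮x⟯ C.K

/-- A linear dependence over `κ(f)` can be normalized. -/
theorem exists_aeval_relation {K : Type*} [Field K] [Algebra κ K] {f : K} (hf : Transcendental κ f)
    {ι : Type*} [Fintype ι] {u : ι → K} (hu : ¬ LinearIndependent κ⟮f⟯ u) :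
    ∃ c : ι → κ[X], (∃ i, (c i).coeff 0 ≠ 0) ∧ ∑ i, aeval f (c i) * u i = 0 := by
  classical
  have hf' : ∀ p : κ[X], p ≠ 0 → aeval f p ≠ 0 := fun p hp h => hp (by
    exact (transcendental_iff.1 hf) p h)
  obtain ⟨g, hg, i₀, hi₀⟩ := Fintype.not_linearIndependent_iff.1 hu
  have hrs : ∀ i, ∃ r s : κ[X], s ≠ 0 ∧ (g i : K) * aeval f s = aeval f r := by
    intro i
    obtain ⟨r, s, h⟩ := (mem_adjoin_simple_iff κ (g i : K)).1 (g i).2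
    -- A fraction with denominator zero stands for `0`, and is rewritten as `0 / 1`.
    by_cases hs : s = 0
    · refine ⟨0, 1, one_ne_zero, ?_⟩
      rw [h, hs]
      simp
    · exact ⟨r, s, hs, by rw [h, div_mul_cancel₀ _ (hf' s hs)]⟩
  choose R S hS hRS using hrs
  have hex : ∃ c : ι → κ[X], c i₀ ≠ 0 ∧ ∑ i, aeval f (c i) * u i = 0 := by
    -- The relation is multiplied by the product of all denominators.
    refine ⟨fun i => R i * ∏ j ∈ Finset.univ.erase i, S j, ?_, ?_⟩
    · refine mul_ne_zero ?_ (Finset.prod_ne_zero_iff.2 fun j _ => hS j)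
      intro h
      have h1 := hRS i₀
      rw [h, map_zero, mul_eq_zero] at h1
      rcases h1 with h1 | h1
      · exact hi₀ (by exact_mod_cast h1)
      · exact hf' _ (hS i₀) h1
    · have : ∀ i, aeval f (R i * ∏ j ∈ Finset.univ.erase i, S j) * u i
          = aeval f (∏ j, S j) * (g i • u i) := by
        intro i
        rw [← Finset.mul_prod_erase Finset.univ S (Finset.mem_univ i), map_mul, map_mul, ← hRS i,
          Algebra.smul_def]
        change _ = _ * ((g i : K) * u i)
        ring
      rw [Finset.sum_congr rfl fun i _ => this i, ← Finset.mul_sum, hg, mul_zero]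
  obtain ⟨c, hc, hsum⟩ := hex
  -- As long as all constant coefficients vanish, the relation can be divided by `f`. This lowers
  -- the degree of the nonzero polynomial `c i₀`, so the process stops.
  induction h : (c i₀).natDegree using Nat.strong_induction_on generalizing c with
  | _ m ih =>
    by_cases h0 : ∃ i, (c i).coeff 0 ≠ 0
    · exact ⟨c, h0, hsum⟩
    push Not at h0
    have hX : ∀ i, c i = X * (c i).divX := by
      intro i
      conv_lhs => rw [← Polynomial.X_mul_divX_add (c i)]
      simp [h0 i]
    have hne : (c i₀).divX ≠ 0 := by
      intro h1
      exact hc (by rw [hX i₀, h1, mul_zero])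
    refine ih _ ?_ (fun i => (c i).divX) hne ?_ rfl
    · rw [← h]
      conv_rhs => rw [hX i₀]
      rw [natDegree_X_mul hne]
      exact Nat.lt_succ_self _
    · have : f * ∑ i, aeval f (c i).divX * u i = 0 := by
        rw [← hsum, Finset.mul_sum]
        refine Finset.sum_congr rfl fun i _ => ?_
        conv_rhs => rw [hX i]
        rw [map_mul, aeval_X, mul_assoc]
      rcases mul_eq_zero.1 this with h1 | h1
      · have := hf' X X_ne_zero
        rw [aeval_X] at this
        exact absurd h1 this
      · exact h1

/-- A family of elements of `K` for which normalized relations over `κ[f]` are impossible has at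
most `[K : κ(f)]` members. -/
theorem card_le_finrank_of_relation {K : Type*} [Field K] [Algebra κ K] {f : K}
    (hf : Transcendental κ f) [FiniteDimensional κ⟮f⟯ K] {ι : Type*} [Fintype ι] (u : ι → K)
    (hu : ∀ c : ι → κ[X], (∃ i, (c i).coeff 0 ≠ 0) → ∑ i, aeval f (c i) * u i ≠ 0) :
    Fintype.card ι ≤ Module.finrank κ⟮f⟯ K := by
  refine LinearIndependent.fintype_card_le_finrank (b := u) ?_
  by_contra h
  obtain ⟨c, hc, hsum⟩ := exists_aeval_relation hf h
  exact hu c hc hsum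

end FunctionField
end OssermanLLS

namespace OssermanLLS

open Polynomial IntermediateField

/-! ### Places of the function field: discreteness and residue field -/

section Places

variable {κ : Type u} [Field κ] {K : Type*} [Field K] [Algebra κ K] {Γ : Type*}
  [LinearOrderedCommGroupWithZero Γ] {v : Valuation K Γ} {t : K}

theorem valuation_algebraMap_le_one (hv : v.IsTrivialOn κ) (c : κ) : v (algebraMap κ K c) ≤ 1 := by
  by_cases hc : c = 0
  · simp [hc]
  · exact (Valuation.IsTrivialOn.eq_one c hc).le

theorem valuation_aeval_le_one (hv : v.IsTrivialOn κ) (ht : v t ≤ 1) (p : κ[X]) :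
    v (aeval t p) ≤ 1 := by
  rw [aeval_eq_sum_range]
  refine v.map_sum_le fun i _ => ?_
  rw [Algebra.smul_def, map_mul, map_pow]
  exact mul_le_one' (valuation_algebraMap_le_one hv _) (pow_le_one' ht _)

theorem valuation_aeval_sub_coeff_zero_le (hv : v.IsTrivialOn κ) (ht : v t ≤ 1) (p : κ[X]) :
    v (aeval t p - algebraMap κ K (p.coeff 0)) ≤ v t := by
  have h : aeval t p - algebraMap κ K (p.coeff 0) = t * aeval t p.divX := by
    have h' := congrArg (aeval t) (Polynomial.X_mul_divX_add p)
    simp only [map_add, map_mul, aeval_X, aeval_C] at h'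
    rw [← h', add_sub_cancel_right]
  rw [h, map_mul]
  exact mul_le_of_le_one_right' (valuation_aeval_le_one hv ht _)

theorem valuation_aeval_le (hv : v.IsTrivialOn κ) (ht : v t ≤ 1) {p : κ[X]} (hp : p.coeff 0 = 0) :
    v (aeval t p) ≤ v t := by
  simpa [hp] using valuation_aeval_sub_coeff_zero_le hv ht p

theorem valuation_aeval_eq_one (hv : v.IsTrivialOn κ) (ht : v t < 1) {p : κ[X]}
    (hp : p.coeff 0 ≠ 0) : v (aeval t p) = 1 := by
  have h1 : v (algebraMap κ K (p.coeff 0)) = 1 := Valuation.IsTrivialOn.eq_one _ hp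
  have h2 := (valuation_aeval_sub_coeff_zero_le hv ht.le p).trans_lt ht
  rw [← h1] at h2 ⊢
  rw [← sub_add_cancel (aeval t p) (algebraMap κ K (p.coeff 0)), v.map_add_eq_of_lt_right h2]

/-- After splitting off the largest power of `X` dividing `p`, the cofactor has nonzero constant
term and hence value one at `t`. -/
theorem exists_pow_le_valuation_aeval (hv : v.IsTrivialOn κ) (ht : v t < 1) {p : κ[X]}
    (hp : p ≠ 0) : ∃ m : ℕ, v t ^ m ≤ v (aeval t p) := by
  obtain ⟨q, hq, hd⟩ := exists_eq_pow_rootMultiplicity_mul_and_not_dvd p hp 0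
  generalize p.rootMultiplicity 0 = m at hq
  rw [C_0, sub_zero, X_dvd_iff] at hd
  refine ⟨m, ?_⟩
  rw [hq, map_mul, map_mul, valuation_aeval_eq_one hv ht hd, mul_one]
  simp

variable [FiniteDimensional κ⟮t⟯ K]

/-- In a normalized relation, the terms with nonzero constant coefficient have the distinct values
`v (u i)`, all above `v t`, while the other terms have value at most `v t`. The largest term cannot
cancel. So only finitely many values lie above `v t` and at most at `1`. -/
theorem card_le_finrank_of_valuation (hv : v.IsTrivialOn κ) (htr : Transcendental κ t)
    (ht : v t < 1) {ι : Type*} [Fintype ι] {u : ι → K} (h1 : ∀ i, v (u i) ≤ 1)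
    (h2 : ∀ i, v t < v (u i)) (hinj : Function.Injective fun i => v (u i)) :
    Fintype.card ι ≤ Module.finrank κ⟮t⟯ K := by
  classical
  refine card_le_finrank_of_relation htr u fun c hc hsum => ?_
  obtain ⟨j, hj, hmax⟩ := Finset.exists_max_image (Finset.univ.filter fun i => (c i).coeff 0 ≠ 0)
    (fun i => v (u i)) (by obtain ⟨i, hi⟩ := hc; exact ⟨i, by simpa using hi⟩)
  simp only [Finset.mem_filter, Finset.mem_univ, true_and] at hj hmax
  have hjv : v (aeval t (c j) * u j) = v (u j) := by
    rw [map_mul, valuation_aeval_eq_one hv ht hj, one_mul]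
  have hrest : v (∑ i ∈ Finset.univ.erase j, aeval t (c i) * u i) < v (aeval t (c j) * u j) := by
    rw [hjv]
    refine v.map_sum_lt (((zero_le).trans_lt (h2 j)).ne') fun i hi => ?_
    rw [map_mul]
    by_cases h0 : (c i).coeff 0 = 0
    · exact (mul_le_of_le_one_right' (h1 i)).trans_lt
        ((valuation_aeval_le hv ht.le h0).trans_lt (h2 j))
    · rw [valuation_aeval_eq_one hv ht h0, one_mul]
      exact lt_of_le_of_ne (hmax i h0) fun h => (Finset.ne_of_mem_erase hi) (hinj h)
  rw [← Finset.add_sum_erase _ _ (Finset.mem_univ j)] at hsum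
  have := v.map_add_eq_of_lt_left hrest
  rw [hsum, map_zero, hjv] at this
  exact ((zero_le).trans_lt (h2 j)).ne this

/-- Without a largest value below `1` there would be an infinite increasing sequence of values
between `v t` and `1`. -/
theorem exists_uniformizer (hv : v.IsTrivialOn κ) (htr : Transcendental κ t) (ht : v t < 1) :
    ∃ π : K, π ≠ 0 ∧ v π < 1 ∧ ∀ u, v u < 1 → v u ≤ v π := by
  have ht0 : t ≠ 0 := by
    rintro rfl
    exact htr (isAlgebraic_zero)
  by_contra! hcon
  have hstep : ∀ π : {π : K // π ≠ 0 ∧ v π < 1}, ∃ ρ : {π : K // π ≠ 0 ∧ v π < 1},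
      v π.1 < v ρ.1 := by
    rintro ⟨π, h0, h1⟩
    obtain ⟨u, hu1, hu2⟩ := hcon π h0 h1
    exact ⟨⟨u, fun h => by simp [h] at hu2, hu1⟩, hu2⟩
  choose s hs using hstep
  let seq : ℕ → {π : K // π ≠ 0 ∧ v π < 1} := fun k => s^[k] ⟨t, ht0, ht⟩
  have hmono : StrictMono fun k => v (seq k).1 := by
    refine strictMono_nat_of_lt_succ fun k => ?_
    simp only [seq, Function.iterate_succ_apply']
    exact hs _
  -- The sequence starts at `t`, whose value is not above `v t`; hence the shift of the index by
  -- one.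
  have := card_le_finrank_of_valuation (v := v) hv htr ht
    (u := fun i : Fin (Module.finrank κ⟮t⟯ K + 1) => (seq (i + 1)).1)
    (fun i => (seq _).2.2.le) (fun i => hmono (Nat.succ_pos i.1))
    (fun i j hij => by
      have := hmono.injective hij
      exact Fin.ext (by omega))
  simp at this

/-- The powers of `π` have distinct values, so only finitely many of these can exceed `v t`. -/
theorem exists_uniformizer_pow_le (hv : v.IsTrivialOn κ) (htr : Transcendental κ t) (ht : v t < 1)
    {π : K} (h0 : π ≠ 0) (h1 : v π < 1) : ∃ m : ℕ, v π ^ m ≤ v t := by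
  by_contra! hcon
  have hpos : 0 < v π := (v.pos_iff).2 h0
  have := card_le_finrank_of_valuation (v := v) hv htr ht
    (u := fun i : Fin (Module.finrank κ⟮t⟯ K + 1) => π ^ i.1)
    (fun i => by rw [map_pow]; exact pow_le_one' h1.le _)
    (fun i => by rw [map_pow]; exact hcon _)
    (fun i j hij => by
      simp only [map_pow] at hij
      exact Fin.ext (pow_right_injective₀ hpos h1.ne hij))
  simp at this

theorem exists_relation_pow (htr : Transcendental κ t) (f : K) :
    ∃ c : Fin (Module.finrank κ⟮t⟯ K + 1) → κ[X], (∃ i, (c i).coeff 0 ≠ 0) ∧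
      ∑ i, aeval t (c i) * f ^ i.1 = 0 := by
  by_contra! hcon
  have := card_le_finrank_of_relation htr
    (fun i : Fin (Module.finrank κ⟮t⟯ K + 1) => f ^ i.1) hcon
  simp at this

/-- In an algebraic equation for `f` over `κ[t]`, the lowest nonzero coefficient is, after division
by a power of `f`, a multiple of `f` by an element of the valuation ring. Its value is therefore at
most `v f`, and it is at least a power of `v t`. -/
theorem exists_pow_le_valuation (hv : v.IsTrivialOn κ) (htr : Transcendental κ t) (ht : v t < 1)
    {f : K} (hf : f ≠ 0) (hf1 : v f ≤ 1) : ∃ m : ℕ, v t ^ m ≤ v f := by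
  classical
  obtain ⟨c, ⟨i, hi⟩, hsum⟩ := exists_relation_pow htr f
  obtain ⟨j, hj, hmin⟩ := Finset.exists_min_image (Finset.univ.filter fun i => c i ≠ 0) id
    ⟨i, by simp only [Finset.mem_filter, Finset.mem_univ, true_and]; rintro h; simp [h] at hi⟩
  simp only [Finset.mem_filter, Finset.mem_univ, true_and, id] at hj hmin
  obtain ⟨m, hm⟩ := exists_pow_le_valuation_aeval hv ht hj
  refine ⟨m, hm.trans ?_⟩
  have hrest : v (∑ i ∈ Finset.univ.erase j, aeval t (c i) * f ^ i.1) ≤ v f ^ (j.1 + 1) := by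
    refine v.map_sum_le fun i hi => ?_
    by_cases h0 : c i = 0
    · simp [h0]
    have : j.1 + 1 ≤ i.1 := lt_of_le_of_ne (hmin i h0) fun h =>
      (Finset.ne_of_mem_erase hi) h.symm
    rw [map_mul, map_pow]
    exact (mul_le_of_le_one_left' (valuation_aeval_le_one hv ht.le _)).trans
      (pow_le_pow_right_of_le_one' hf1 this)
  rw [← Finset.add_sum_erase _ _ (Finset.mem_univ j)] at hsum
  rw [← neg_eq_of_add_eq_zero_right hsum, v.map_neg, map_mul, map_pow, pow_succ, mul_comm] at hrest
  exact le_of_mul_le_mul_left hrest (pow_pos ((v.pos_iff).2 hf) _)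

/-- Reducing an algebraic equation for `f` modulo `t` gives a nonzero polynomial over `κ` whose
value at `f` is below `1`. It splits into linear factors, and one of these must have value below `1`
at `f`. -/
theorem exists_valuation_sub_lt_one [IsAlgClosed κ] (hv : v.IsTrivialOn κ)
    (htr : Transcendental κ t) (ht : v t < 1) {f : K} (hf1 : v f ≤ 1) :
    ∃ c : κ, v (f - algebraMap κ K c) < 1 := by
  obtain ⟨c, ⟨i, hi⟩, hsum⟩ := exists_relation_pow htr f
  have hq : ∃ q : κ[X], q ≠ 0 ∧ v (aeval f q) < 1 := by
    refine ⟨∑ i, C ((c i).coeff 0) * X ^ i.1, ?_, ?_⟩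
    · intro h
      have h1 := congrArg (fun p => p.coeff i.1) h
      simp only [finsetSum_coeff, coeff_C_mul, coeff_X_pow, coeff_zero] at h1
      rw [Finset.sum_eq_single i] at h1
      · simp at h1
        exact hi h1
      · intro j _ hj
        rw [if_neg fun h => hj (Fin.ext h.symm), mul_zero]
      · simp
    · have : aeval f (∑ i, C ((c i).coeff 0) * X ^ i.1) =
          - ∑ i, (aeval t (c i) - algebraMap κ K ((c i).coeff 0)) * f ^ i.1 := by
        simp only [sub_mul, Finset.sum_sub_distrib, hsum, map_sum, map_mul, map_pow, aeval_X,
          aeval_C]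
        ring
      rw [this, v.map_neg]
      refine v.map_sum_lt one_ne_zero fun i _ => ?_
      rw [map_mul, map_pow]
      exact (mul_le_of_le_one_right' (pow_le_one' hf1 _)).trans_lt
        ((valuation_aeval_sub_coeff_zero_le hv ht.le _).trans_lt ht)
  obtain ⟨q, hq0, hq1⟩ := hq
  induction h : q.natDegree using Nat.strong_induction_on generalizing q with
  | _ m ih =>
    by_cases hd : q.degree = 0
    · rw [eq_C_of_degree_eq_zero hd, aeval_C] at hq1
      have h0 : q.coeff 0 ≠ 0 := fun h0 => hq0 (by rw [eq_C_of_degree_eq_zero hd, h0, C_0])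
      rw [Valuation.IsTrivialOn.eq_one _ h0] at hq1
      exact absurd hq1 (lt_irrefl _)
    obtain ⟨r, hr⟩ := IsAlgClosed.exists_root q hd
    obtain ⟨q', rfl⟩ := dvd_iff_isRoot.2 hr
    have hq' : q' ≠ 0 := right_ne_zero_of_mul hq0
    by_cases hlt : v (f - algebraMap κ K r) < 1
    · exact ⟨r, hlt⟩
    refine ih q'.natDegree ?_ q' hq' ?_ rfl
    · rw [← h, natDegree_mul (X_sub_C_ne_zero r) hq', natDegree_X_sub_C]
      omega
    · rw [map_mul, map_mul] at hq1
      simp only [map_sub, aeval_X, aeval_C] at hq1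
      by_contra hcon
      exact absurd hq1 (not_lt.2 (one_le_mul (not_lt.1 hlt) (not_lt.1 hcon)))

end Places
end OssermanLLS

namespace OssermanLLS

open Polynomial IntermediateField

/-! ### Points as normalized discrete valuations; existence of zeros -/

section Points

variable {κ : Type u} [Field κ] {C : Curve κ}

theorem Point.ext_val {P Q : Point C} (h : P.val = Q.val) : P = Q := by
  cases P
  cases Q
  cases h
  rfl

/-- A valuation with a uniformizer of which the powers bound all values is a point. -/
theorem exists_point_of_uniformizer {Γ : Type*} [LinearOrderedCommGroupWithZero Γ]
    {v : Valuation C.K Γ} (hv : v.IsTrivialOn κ)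
    (hres : ∀ f : C.K, v f ≤ 1 → ∃ c : κ, v (f - algebraMap κ C.K c) < 1) {π : C.K} (h0 : π ≠ 0)
    (h1 : v π < 1) (hmax : ∀ u, v u < 1 → v u ≤ v π)
    (harch : ∀ f, f ≠ 0 → v f ≤ 1 → ∃ m : ℕ, v π ^ m ≤ v f) :
    ∃ P : Point C, ∀ f, P.val f < 1 ↔ v f < 1 := by
  classical
  have hpos : 0 < v π := (v.pos_iff).2 h0
  have hex' : ∀ f : C.K, f ≠ 0 → v f ≤ 1 → ∃ k : ℤ, v f = v π ^ k := by
    intro f hf hf1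
    -- For the least `m` with `v π ^ m ≤ v f`, the quotient `f / π ^ (m - 1)` has value below `1`,
    -- hence at most `v π`; this forces equality.
    let m := Nat.find (harch f hf hf1)
    have hm : v π ^ m ≤ v f := Nat.find_spec (harch f hf hf1)
    have hmin : ∀ k < m, ¬ v π ^ k ≤ v f := fun k hk => Nat.find_min (harch f hf hf1) hk
    refine ⟨m, le_antisymm ?_ (by exact_mod_cast hm)⟩
    rcases Nat.eq_zero_or_pos m with h | h
    · rw [h]
      simpa using hf1
    · have h2 := not_le.1 (hmin (m - 1) (by omega))
      have h3 : v (f / π ^ (m - 1)) < 1 := by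
        rw [map_div₀, map_pow]
        exact (div_lt_one₀ (pow_pos hpos _)).2 h2
      have h4 := hmax _ h3
      rw [map_div₀, map_pow, div_le_iff₀ (pow_pos hpos _), ← pow_succ',
        Nat.sub_add_cancel h] at h4
      exact_mod_cast h4
  have hex : ∀ f : C.K, f ≠ 0 → ∃ k : ℤ, v f = v π ^ k := by
    intro f hf
    rcases le_total (v f) 1 with h | h
    · exact hex' f hf h
    · obtain ⟨k, hk⟩ := hex' f⁻¹ (inv_ne_zero hf) (by rw [map_inv₀]; exact inv_le_one_of_one_le₀ h)
      exact ⟨-k, by rw [zpow_neg, ← hk, map_inv₀, inv_inv]⟩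
  choose! k hk using hex
  have hinj : ∀ a b : ℤ, v π ^ a ≤ v π ^ b ↔ b ≤ a := fun a b =>
    zpow_le_zpow_iff_right_of_lt_one₀ hpos h1
  let ord : C.K → ℤᵐ⁰ := fun f => if f = 0 then 0 else WithZero.exp (- k f)
  have hord : ∀ f g, ord f ≤ ord g ↔ v f ≤ v g := by
    intro f g
    by_cases hf : f = 0
    · simp [ord, hf]
    by_cases hg : g = 0
    · simp [ord, hf, hg]
    · simp only [ord, hf, hg, if_false, WithZero.exp_le_exp, hk f hf, hk g hg, hinj]
      omega
  have hval : ∀ f (m : ℤ), v f = v π ^ m → ord f = WithZero.exp (-m) := by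
    intro f m hm
    have hf : f ≠ 0 := by
      rintro rfl
      rw [map_zero] at hm
      exact (zpow_pos hpos m).ne hm
    simp only [ord, hf, if_false]
    congr 2
    rw [hk f hf] at hm
    exact le_antisymm ((hinj _ _).1 hm.ge) ((hinj _ _).1 hm.le)
  have hmul : ∀ f g, ord (f * g) = ord f * ord g := by
    intro f g
    by_cases hf : f = 0
    · simp [ord, hf]
    by_cases hg : g = 0
    · simp [ord, hg]
    rw [hval f _ (hk f hf), hval g _ (hk g hg), hval (f * g) (k f + k g) (by
      rw [map_mul, hk f hf, hk g hg, zpow_add₀ hpos.ne']), ← WithZero.exp_add]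
    congr 1
    ring
  have hone : ord 1 = 1 := by
    rw [hval 1 0 (by simp)]
    simp
  let val : Valuation C.K ℤᵐ⁰ :=
    { toFun := ord
      map_zero' := by simp [ord]
      map_one' := hone
      map_mul' := hmul
      map_add_le_max' := by
        intro f g
        rcases le_total (v f) (v g) with h | h
        · exact le_max_of_le_right ((hord _ _).2 ((v.map_add f g).trans (max_le h le_rfl)))
        · exact le_max_of_le_left ((hord _ _).2 ((v.map_add f g).trans (max_le le_rfl h))) }
  have hlt : ∀ f, val f < 1 ↔ v f < 1 := by
    intro f
    rw [← not_le, ← not_le, not_iff_not, ← v.map_one, ← hord, hone]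
    rfl
  have hle : ∀ f, val f ≤ 1 ↔ v f ≤ 1 := by
    intro f
    rw [← v.map_one, ← hord, hone]
    rfl
  refine ⟨⟨val, ?_, ⟨?_⟩, ?_⟩, hlt⟩
  · intro m
    by_cases hm : m = 0
    · exact ⟨0, by rw [hm, map_zero]⟩
    · refine ⟨π ^ (- WithZero.log m), ?_⟩
      change ord _ = _
      rw [hval _ _ (map_zpow₀ v π _), neg_neg, WithZero.exp_log hm]
  · intro c hc
    change ord _ = 1
    have h2 : v (algebraMap κ C.K c) = 1 := Valuation.IsTrivialOn.eq_one _ hc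
    rw [hval _ 0 (by simpa using h2)]
    simp
  · intro f hf
    obtain ⟨c, hc⟩ := hres f ((hle f).1 hf)
    exact ⟨c, (hlt _).2 hc⟩

/-- The element `t` generates a proper ideal of `κ[t]`, so by Chevalley's extension theorem some
valuation ring of `K` containing `κ[t]` has `t` in its maximal ideal. The results on places show
that it is discrete with residue field `κ`. -/
theorem exists_point_val_lt_one [IsAlgClosed κ] {t : C.K} (ht : Transcendental κ t) :
    ∃ P : Point C, P.val t < 1 := by
  have := C.finiteDimensional_adjoin ht
  let A : Subring C.K := (Algebra.adjoin κ {t}).toSubring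
  have htA : t ∈ A := Algebra.self_mem_adjoin_singleton κ t
  have hI : Ideal.span {(⟨t, htA⟩ : A)} ≠ ⊤ := by
    intro h
    rw [Ideal.span_singleton_eq_top] at h
    obtain ⟨⟨a, ha⟩, hu⟩ := h.exists_right_inv
    have hu' : t * a = 1 := congrArg Subtype.val hu
    have ha' : a ∈ Algebra.adjoin κ {t} := ha
    rw [Algebra.adjoin_singleton_eq_range_aeval] at ha'
    obtain ⟨p, rfl⟩ := ha'
    have hp : aeval t (X * p - 1) = 0 := by
      simp only [map_sub, map_mul, aeval_X, map_one, sub_eq_zero]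
      exact hu'
    have h0 := congrArg (fun q => q.coeff 0) (transcendental_iff.1 ht _ hp)
    simp at h0
  obtain ⟨B, hAB, hB⟩ := Ideal.image_subset_nonunits_valuationSubring _ hI
  have htriv : B.valuation.IsTrivialOn κ := ⟨by
    intro c hc
    have hmem : ∀ c : κ, B.valuation (algebraMap κ C.K c) ≤ 1 := fun c =>
      (B.valuation_le_one_iff _).2 (hAB ((Algebra.adjoin κ {t}).algebraMap_mem c))
    refine le_antisymm (hmem c) ?_
    have h := hmem c⁻¹
    rw [map_inv₀, map_inv₀] at h
    have hpos : 0 < B.valuation (algebraMap κ C.K c) :=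
      B.valuation.pos_iff.2 (by simpa using hc)
    exact (inv_le_one₀ hpos).1 h⟩
  have hlt : B.valuation t < 1 := by
    have : t ∈ B.nonunits := hB ⟨⟨t, htA⟩, Ideal.subset_span rfl, rfl⟩
    exact B.mem_nonunits_iff.1 this
  obtain ⟨π, h0, h1, hmax⟩ := exists_uniformizer htriv ht hlt
  obtain ⟨m, hm⟩ := exists_uniformizer_pow_le htriv ht hlt h0 h1
  obtain ⟨P, hP⟩ := exists_point_of_uniformizer htriv
    (fun f hf => exists_valuation_sub_lt_one htriv ht hlt hf) h0 h1 hmax (fun f hf hf1 => by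
      obtain ⟨k, hk⟩ := exists_pow_le_valuation htriv ht hlt hf hf1
      refine ⟨m * k, le_trans ?_ hk⟩
      rw [pow_mul]
      exact pow_le_pow_left₀ zero_le hm k)
  exact ⟨P, (hP t).2 hlt⟩

theorem Point.val_unif (P : Point C) : P.val P.unif = WithZero.exp (-1) :=
  (P.surjective (WithZero.exp (-1))).choose_spec

theorem Point.unif_ne_zero (P : Point C) : P.unif ≠ 0 := by
  intro h
  have := P.val_unif
  rw [h, map_zero] at this
  exact WithZero.exp_ne_zero this.symm

theorem Point.val_unif_zpow (P : Point C) (m : ℤ) : P.val (P.unif ^ m) = WithZero.exp (-m) := by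
  rw [map_zpow₀, P.val_unif, ← WithZero.exp_zsmul]
  simp

theorem Point.val_algebraMap (P : Point C) {c : κ} (hc : c ≠ 0) :
    P.val (algebraMap κ C.K c) = 1 :=
  have := P.trivialOn
  Valuation.IsTrivialOn.eq_one _ hc

theorem Point.val_algebraMap_le_one (P : Point C) (c : κ) :
    P.val (algebraMap κ C.K c) ≤ 1 :=
  valuation_algebraMap_le_one P.trivialOn c

theorem Point.val_eq_exp (P : Point C) {f : C.K} (hf : f ≠ 0) :
    P.val f = WithZero.exp (WithZero.log (P.val f)) :=
  (WithZero.exp_log ((Valuation.ne_zero_iff _).2 hf)).symm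

/-- Distinct points have incomparable valuation rings. -/
theorem Point.exists_le_one_one_lt {P Q : Point C} (h : P ≠ Q) :
    ∃ f, P.val f ≤ 1 ∧ 1 < Q.val f := by
  by_contra! hcon
  refine h (Point.ext_val ?_)
  have hone : ∀ f, P.val f = 1 → Q.val f = 1 := by
    intro f hf
    refine le_antisymm (hcon f hf.le) ?_
    have h1 := hcon f⁻¹ (by rw [map_inv₀, hf, inv_one])
    rw [map_inv₀] at h1
    have hf0 : f ≠ 0 := by rintro rfl; simp at hf
    exact (inv_le_one₀ (Q.val.pos_iff.2 hf0)).1 h1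
  obtain ⟨m, hm⟩ : ∃ m : ℤ, Q.val P.unif = WithZero.exp m := ⟨_, Q.val_eq_exp P.unif_ne_zero⟩
  -- Units at `P` are units at `Q`, so the order at `Q` is a constant multiple of the order at `P`.
  have hform : ∀ f, f ≠ 0 → Q.val f = WithZero.exp (-m * WithZero.log (P.val f)) := by
    intro f hf
    have h1 : Q.val (f * P.unif ^ (WithZero.log (P.val f))) = 1 := by
      refine hone _ ?_
      rw [map_mul, P.val_unif_zpow]
      nth_rw 1 [P.val_eq_exp hf]
      rw [← WithZero.exp_add, add_neg_cancel, WithZero.exp_zero]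
    rw [map_mul, map_zpow₀, hm, ← WithZero.exp_zsmul] at h1
    rw [eq_inv_of_mul_eq_one_left h1, ← WithZero.exp_neg]
    congr 1
    simp only [smul_eq_mul]
    ring
  have hm0 : m ≤ 0 := by
    have := hcon P.unif (by rw [P.val_unif, ← WithZero.exp_zero, WithZero.exp_le_exp]; norm_num)
    rwa [hm, ← WithZero.exp_zero, WithZero.exp_le_exp] at this
  -- Evaluated at the uniformizer of `Q`, the formula shows that `m` divides `1`, and the sign is
  -- known.
  have hm1 : m = -1 := by
    have h1 := hform Q.unif Q.unif_ne_zero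
    rw [Q.val_unif, WithZero.exp_inj] at h1
    have h2 : m * WithZero.log (P.val Q.unif) = 1 := by linarith
    rcases Int.eq_one_or_neg_one_of_mul_eq_one h2 with h | h
    · omega
    · exact h
  ext f
  by_cases hf : f = 0
  · simp [hf]
  · rw [hform f hf, hm1, neg_neg, one_mul, ← P.val_eq_exp hf]

end Points
end OssermanLLS

namespace OssermanLLS

open Polynomial IntermediateField

/-! ### Weak approximation and the bound on the number of zeros -/

section Approximation

variable {κ : Type u} [Field κ] {C : Curve κ}

theorem Point.val_lt_one_iff (P : Point C) {f : C.K} : P.val f < 1 ↔ P.val f ≤ WithZero.exp (-1) := by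
  by_cases hf : f = 0
  · simp [hf]
  · rw [P.val_eq_exp hf, ← WithZero.exp_zero, WithZero.exp_lt_exp, WithZero.exp_le_exp]
    omega

theorem Point.val_pow_le (P : Point C) {f : C.K} (hf : P.val f < 1) (m : ℕ) :
    P.val (f ^ m) ≤ WithZero.exp (-(m : ℤ)) := by
  rw [P.val_lt_one_iff] at hf
  rw [map_pow]
  refine (pow_le_pow_left₀ zero_le hf m).trans_eq ?_
  rw [← WithZero.exp_nsmul]
  simp

theorem exists_exponent (S : Finset (Point C)) {f : C.K} (hf : f ≠ 0) (N : Point C → ℤ) :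
    ∃ m : ℕ, ∀ Q ∈ S, WithZero.exp (-(m : ℤ)) * Q.val f ≤ WithZero.exp (N Q) := by
  refine ⟨S.sup fun Q => (WithZero.log (Q.val f) - N Q).toNat, fun Q hQ => ?_⟩
  have h := Finset.le_sup (f := fun Q => (WithZero.log (Q.val f) - N Q).toNat) hQ
  rw [Q.val_eq_exp hf, ← WithZero.exp_add, WithZero.exp_le_exp]
  omega

/-- Artin–Whaples induction: `g` works for `S`, and `f` separates `P` from the new point `Q`. If `g`
is small at `Q` it can be kept; if it has value one there, `f * g ^ m` works; if it is large there,
its powers have to be damped. -/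
theorem exists_one_lt_lt_one {P : Point C} (S : Finset (Point C)) (hP : P ∉ S) :
    ∃ g, 1 < P.val g ∧ ∀ Q ∈ S, Q.val g < 1 := by
  classical
  induction S using Finset.induction_on with
  | empty =>
    refine ⟨P.unif⁻¹, ?_, by simp⟩
    rw [map_inv₀, P.val_unif, ← WithZero.exp_neg, ← WithZero.exp_zero, WithZero.exp_lt_exp]
    norm_num
  | insert Q S hQ ih =>
    rw [Finset.mem_insert, not_or] at hP
    obtain ⟨g, hg1, hg2⟩ := ih hP.2
    obtain ⟨a, ha1, ha2⟩ := Point.exists_le_one_one_lt hP.1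
    obtain ⟨b, hb1, hb2⟩ := Point.exists_le_one_one_lt (Ne.symm hP.1)
    obtain ⟨f, hf1, hf2⟩ : ∃ f, 1 < P.val f ∧ Q.val f < 1 := by
      have hapos : 0 < P.val a := P.val.pos_iff.2 (by rintro rfl; simp at ha2)
      refine ⟨b / a, ?_, ?_⟩
      · rw [map_div₀, one_lt_div₀ hapos]
        exact ha1.trans_lt hb2
      · rw [map_div₀, div_lt_one₀ (zero_lt_one.trans ha2)]
        exact hb1.trans_lt ha2
    have hf0 : f ≠ 0 := by rintro rfl; simp at hf1
    obtain ⟨m, hm⟩ := exists_exponent S hf0 fun _ => -1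
    have hS : ∀ R ∈ S, R.val (f * g ^ m) < 1 := by
      intro R hR
      rw [R.val_lt_one_iff, map_mul, mul_comm]
      exact (mul_le_mul_left (R.val_pow_le (hg2 R hR) m) _).trans (hm R hR)
    rcases lt_trichotomy (Q.val g) 1 with h | h | h
    · refine ⟨g, hg1, fun R hR => ?_⟩
      rcases Finset.mem_insert.1 hR with rfl | hR
      exacts [h, hg2 R hR]
    · refine ⟨f * g ^ m, ?_, fun R hR => ?_⟩
      · rw [map_mul, map_pow]
        exact one_lt_mul_of_lt_of_le hf1 (one_le_pow₀ hg1.le)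
      · rcases Finset.mem_insert.1 hR with rfl | hR
        · rwa [map_mul, map_pow, h, one_pow, mul_one]
        · exact hS R hR
    -- The factor `g ^ (m + 1) / (1 + g ^ (m + 1))` has value one where `g` is large and is small
    -- where `g` is small.
    · have hbig : ∀ R : Point C, 1 < R.val g → R.val (f * g ^ (m + 1) / (1 + g ^ (m + 1))) = R.val f := by
        intro R hR
        have h1 : R.val 1 < R.val (g ^ (m + 1)) := by
          rw [map_one, map_pow]
          exact one_lt_pow₀ hR (Nat.succ_ne_zero m)
        rw [map_div₀, map_mul, R.val.map_add_eq_of_lt_right h1, mul_div_cancel_right₀]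
        exact (zero_lt_one.trans_le (R.val.map_one.symm.le.trans h1.le)).ne'
      refine ⟨f * g ^ (m + 1) / (1 + g ^ (m + 1)), ?_, fun R hR => ?_⟩
      · rwa [hbig P hg1]
      · rcases Finset.mem_insert.1 hR with rfl | hR
        · rwa [hbig R h]
        · have h1 : R.val (g ^ (m + 1)) < R.val 1 := by
            rw [map_one, map_pow]
            exact pow_lt_one₀ zero_le (hg2 R hR) (Nat.succ_ne_zero m)
          rw [map_div₀, R.val.map_add_eq_of_lt_left h1, map_one, div_one, pow_succ, ← mul_assoc,
            map_mul]
          exact mul_lt_one_of_nonneg_of_lt_one_left zero_le (hS R hR) (hg2 R hR).le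

/-- Where `g` is large, `g ^ (N + 1) / (1 + g ^ (N + 1))` has value one; where `g` is small, it
vanishes to order at least `N`. -/
theorem exists_eq_one_le_exp {P : Point C} (S : Finset (Point C)) (hP : P ∉ S) (N : ℕ) :
    ∃ z, P.val z = 1 ∧ ∀ Q ∈ S, Q.val z ≤ WithZero.exp (-(N : ℤ)) := by
  obtain ⟨g, hg1, hg2⟩ := exists_one_lt_lt_one S hP
  refine ⟨g ^ (N + 1) / (1 + g ^ (N + 1)), ?_, fun R hR => ?_⟩
  · have h1 : P.val 1 < P.val (g ^ (N + 1)) := by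
      rw [map_one, map_pow]
      exact one_lt_pow₀ hg1 (Nat.succ_ne_zero N)
    rw [map_div₀, P.val.map_add_eq_of_lt_right h1, div_self]
    exact (zero_lt_one.trans_le (P.val.map_one.symm.le.trans h1.le)).ne'
  · have h1 : R.val (g ^ (N + 1)) < R.val 1 := by
      rw [map_one, map_pow]
      exact pow_lt_one₀ zero_le (hg2 R hR) (Nat.succ_ne_zero N)
    rw [map_div₀, R.val.map_add_eq_of_lt_left h1, map_one, div_one]
    refine (R.val_pow_le (hg2 R hR) _).trans (WithZero.exp_le_exp.2 ?_)
    push_cast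
    omega

/-- Weak approximation: prescribed order at one point, and high order at finitely many others. -/
theorem exists_eq_exp_le_exp {P : Point C} (S : Finset (Point C)) (hP : P ∉ S) (k : ℤ)
    (N : Point C → ℤ) :
    ∃ z, P.val z = WithZero.exp k ∧ ∀ Q ∈ S, Q.val z ≤ WithZero.exp (N Q) := by
  obtain ⟨m, hm⟩ := exists_exponent S (zpow_ne_zero (-k) P.unif_ne_zero) N
  obtain ⟨z, hz1, hz2⟩ := exists_eq_one_le_exp S hP m
  refine ⟨z * P.unif ^ (-k), ?_, fun Q hQ => ?_⟩
  · rw [map_mul, hz1, one_mul, P.val_unif_zpow, neg_neg]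
  · rw [map_mul]
    exact (mul_le_mul_left (hz2 Q hQ) _).trans (hm Q hQ)

/-- The zeros of `f`, counted with multiplicities, are at most `[K : κ(f)]` in number. -/
theorem sum_zeros_le_finrank {f : C.K} (hf : Transcendental κ f) (S : Finset (Point C))
    (e : Point C → ℕ) (he : ∀ P ∈ S, P.val f ≤ WithZero.exp (-(e P : ℤ))) :
    ∑ P ∈ S, e P ≤ Module.finrank κ⟮f⟯ C.K := by
  classical
  have := C.finiteDimensional_adjoin hf
  have hu : ∀ (P : S) (k : Fin (e P)), ∃ z, P.1.val z = WithZero.exp (-(k.1 : ℤ)) ∧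
      ∀ Q ∈ S.erase P, Q.val z ≤ WithZero.exp (-(e Q : ℤ)) := fun P k =>
    exists_eq_exp_le_exp _ (Finset.notMem_erase _ _) _ _
  choose z hz1 hz2 using hu
  have := card_le_finrank_of_relation hf (ι := Σ P : S, Fin (e P)) (fun p => z p.1 p.2) ?_
  · simpa [Finset.sum_attach S e] using this
  rintro c ⟨⟨P, k₀⟩, hk₀⟩ hsum
  -- At `P`, the term of least index `k` with nonzero constant coefficient has order exactly `k < e
  -- P`. The terms belonging to other points have order at least `e P`, and so do those whose
  -- coefficient vanishes at `f = 0`; the remaining ones have larger index. So nothing cancels it.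
  obtain ⟨k, hk, hmin⟩ := Finset.exists_min_image
    (Finset.univ.filter fun k : Fin (e P) => (c ⟨P, k⟩).coeff 0 ≠ 0) id ⟨k₀, by simpa using hk₀⟩
  simp only [Finset.mem_filter, Finset.mem_univ, true_and, id] at hk hmin
  have hkP : (k.1 : ℤ) < e P := by exact_mod_cast k.2
  have htriv := P.1.trivialOn
  have hf1 : P.1.val f < 1 := by
    refine (he P P.2).trans_lt ?_
    rw [← WithZero.exp_zero, WithZero.exp_lt_exp]
    omega
  have hfk : P.1.val f < WithZero.exp (-(k.1 : ℤ)) :=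
    (he P P.2).trans_lt (WithZero.exp_lt_exp.2 (by omega))
  have hterm : P.1.val (aeval f (c ⟨P, k⟩) * z P k) = WithZero.exp (-(k.1 : ℤ)) := by
    rw [map_mul, valuation_aeval_eq_one htriv hf1 hk, one_mul, hz1]
  have hrest : P.1.val (∑ p ∈ Finset.univ.erase (⟨P, k⟩ : Σ P : S, Fin (e P)),
      aeval f (c p) * z p.1 p.2) < P.1.val (aeval f (c ⟨P, k⟩) * z P k) := by
    rw [hterm]
    refine P.1.val.map_sum_lt WithZero.exp_ne_zero ?_
    rintro ⟨Q, l⟩ hp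
    rw [map_mul]
    by_cases hQ : Q = P
    · subst hQ
      have hz : Q.1.val (z Q l) ≤ 1 := by
        rw [hz1, ← WithZero.exp_zero, WithZero.exp_le_exp]
        omega
      by_cases h0 : (c ⟨Q, l⟩).coeff 0 = 0
      · exact (mul_le_of_le_one_right' hz).trans_lt
          ((valuation_aeval_le htriv hf1.le h0).trans_lt hfk)
      · rw [valuation_aeval_eq_one htriv hf1 h0, one_mul, hz1, WithZero.exp_lt_exp]
        have h1 : k ≤ l := hmin l h0
        have h2 : k ≠ l := by
          rintro rfl
          exact (Finset.ne_of_mem_erase hp) rfl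
        have h3 : k.1 < l.1 := lt_of_le_of_ne h1 fun h => h2 (Fin.ext h)
        simpa using h3
    · refine (mul_le_of_le_one_left' (valuation_aeval_le_one htriv hf1.le _)).trans_lt
        ((hz2 Q l P (Finset.mem_erase.2 ⟨fun h => hQ (Subtype.ext h.symm), P.2⟩)).trans_lt ?_)
      rw [WithZero.exp_lt_exp]
      omega
  rw [← Finset.add_sum_erase _ _ (Finset.mem_univ (⟨P, k⟩ : Σ P : S, Fin (e P)))] at hsum
  have h := P.1.val.map_add_eq_of_lt_left hrest
  rw [hsum, map_zero, hterm] at h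
  exact WithZero.exp_ne_zero h.symm

end Approximation
end OssermanLLS

namespace OssermanLLS

open Polynomial IntermediateField

/-! ### Coordinates of sections in the fibres -/

section Coefficients

variable {κ : Type u} [Field κ] {C : Curve κ} (P : Point C)

theorem Point.val_mul_unif_zpow_le_one {m : ℤ} {f : C.K} (hf : P.val f ≤ WithZero.exp m) :
    P.val (f * P.unif ^ m) ≤ 1 := by
  rw [map_mul, P.val_unif_zpow]
  refine (mul_le_mul_left hf _).trans_eq ?_
  rw [← WithZero.exp_add, add_neg_cancel, WithZero.exp_zero]

theorem Point.coeff_spec {m : ℤ} {f : C.K} (hf : P.val f ≤ WithZero.exp m) :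
    P.val (f * P.unif ^ m - algebraMap κ C.K (P.coeff m f)) < 1 := by
  have h := P.rational _ (P.val_mul_unif_zpow_le_one hf)
  rw [Point.coeff, dif_pos h]
  exact h.choose_spec

theorem Point.eq_zero_of_val_algebraMap_lt {c : κ} (h : P.val (algebraMap κ C.K c) < 1) : c = 0 := by
  by_contra hc
  exact h.ne (P.val_algebraMap hc)

theorem Point.coeff_eq {m : ℤ} {f : C.K} {c : κ}
    (h : P.val (f * P.unif ^ m - algebraMap κ C.K c) < 1) : P.coeff m f = c := by
  have hex : ∃ c : κ, P.val (f * P.unif ^ m - algebraMap κ C.K c) < 1 := ⟨c, h⟩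
  have h1 := hex.choose_spec
  rw [Point.coeff, dif_pos hex, ← sub_eq_zero]
  apply P.eq_zero_of_val_algebraMap_lt
  rw [map_sub]
  have := P.val.map_sub_lt h h1
  rwa [sub_sub_sub_cancel_left] at this

theorem Point.coeff_add {m : ℤ} {f g : C.K} (hf : P.val f ≤ WithZero.exp m)
    (hg : P.val g ≤ WithZero.exp m) : P.coeff m (f + g) = P.coeff m f + P.coeff m g := by
  apply P.coeff_eq
  rw [map_add, add_mul, add_sub_add_comm]
  exact P.val.map_add_lt (P.coeff_spec hf) (P.coeff_spec hg)

theorem Point.coeff_mul {m m' : ℤ} {f g : C.K} (hf : P.val f ≤ WithZero.exp m)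
    (hg : P.val g ≤ WithZero.exp m') :
    P.coeff (m + m') (f * g) = P.coeff m f * P.coeff m' g := by
  apply P.coeff_eq
  have : f * g * P.unif ^ (m + m') - algebraMap κ C.K (P.coeff m f * P.coeff m' g) =
      (f * P.unif ^ m) * (g * P.unif ^ m' - algebraMap κ C.K (P.coeff m' g)) +
      (f * P.unif ^ m - algebraMap κ C.K (P.coeff m f)) * algebraMap κ C.K (P.coeff m' g) := by
    rw [zpow_add₀ P.unif_ne_zero, map_mul]
    ring
  rw [this]
  refine P.val.map_add_lt ?_ ?_ <;> rw [map_mul]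
  · exact (mul_le_of_le_one_left' (P.val_mul_unif_zpow_le_one hf)).trans_lt (P.coeff_spec hg)
  · exact (mul_le_of_le_one_right' (P.val_algebraMap_le_one _)).trans_lt (P.coeff_spec hf)

theorem Point.coeff_algebraMap (c : κ) : P.coeff 0 (algebraMap κ C.K c) = c := by
  apply P.coeff_eq
  simp

theorem Point.coeff_smul {m : ℤ} (c : κ) {f : C.K} (hf : P.val f ≤ WithZero.exp m) :
    P.coeff m (c • f) = c * P.coeff m f := by
  have h : P.val (algebraMap κ C.K c) ≤ WithZero.exp 0 := P.val_algebraMap_le_one c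
  have := P.coeff_mul h hf
  rwa [zero_add, P.coeff_algebraMap, ← Algebra.smul_def] at this

theorem Point.coeff_eq_zero_iff {m : ℤ} {f : C.K} (hf : P.val f ≤ WithZero.exp m) :
    P.coeff m f = 0 ↔ P.val f ≤ WithZero.exp (m - 1) := by
  have key : P.val (f * P.unif ^ m) < 1 ↔ P.val f ≤ WithZero.exp (m - 1) := by
    by_cases h0 : f = 0
    · simp [h0]
    · rw [map_mul, P.val_unif_zpow, P.val_eq_exp h0, ← WithZero.exp_add, ← WithZero.exp_zero,
        WithZero.exp_lt_exp, WithZero.exp_le_exp]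
      omega
  rw [← key]
  constructor
  · intro h
    have := P.coeff_spec hf
    rwa [h, map_zero, sub_zero] at this
  · intro h
    apply P.coeff_eq
    rwa [map_zero, sub_zero]

theorem Point.coeff_ne_zero {m : ℤ} {f : C.K} (hf : P.val f = WithZero.exp m) :
    P.coeff m f ≠ 0 := by
  rw [Ne, P.coeff_eq_zero_iff hf.le, hf, WithZero.exp_le_exp]
  omega

end Coefficients

/-! ### Degrees of divisors: a bundle with a nonzero section has nonnegative degree -/

section Degree

variable {κ : Type u} [Field κ] {C : Curve κ}

/-- The degree as a homomorphism. -/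
noncomputable def Divisor.degreeHom (C : Curve κ) : Divisor C →+ ℤ where
  toFun := Divisor.degree
  map_zero' := by simp [Divisor.degree]
  map_add' A B := Finsupp.sum_add_index' (fun _ => rfl) fun _ _ _ => rfl

theorem Divisor.degreeHom_apply (D : Divisor C) : Divisor.degreeHom C D = D.degree := rfl

theorem Divisor.degree_add (A B : Divisor C) : (A + B).degree = A.degree + B.degree :=
  map_add (Divisor.degreeHom C) A B

theorem Divisor.degree_sub (A B : Divisor C) : (A - B).degree = A.degree - B.degree :=
  map_sub (Divisor.degreeHom C) A B

theorem Divisor.degree_sum {ι : Type*} (s : Finset ι) (A : ι → Divisor C) :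
    (∑ i ∈ s, A i).degree = ∑ i ∈ s, (A i).degree :=
  map_sum (Divisor.degreeHom C) A s

theorem Divisor.degree_zsmul (m : ℤ) (A : Divisor C) : (m • A).degree = m * A.degree :=
  (map_zsmul (Divisor.degreeHom C) m A).trans (smul_eq_mul _ _)

theorem Divisor.degree_zero : (0 : Divisor C).degree = 0 :=
  map_zero (Divisor.degreeHom C)

theorem Divisor.degree_single (P : Point C) (m : ℤ) :
    Divisor.degree (Finsupp.single P m : Divisor C) = m := by
  simp [Divisor.degree]

theorem Divisor.degree_nonneg {A : Divisor C} (hA : 0 ≤ A) : 0 ≤ A.degree :=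
  Finset.sum_nonneg fun P _ => hA P

theorem Divisor.degree_mono {A B : Divisor C} (h : A ≤ B) : A.degree ≤ B.degree := by
  have := Divisor.degree_nonneg (sub_nonneg.2 h)
  rw [Divisor.degree_sub] at this
  linarith

theorem Divisor.exists_single_le {A : Divisor C} (hA : 0 ≤ A) (hne : A ≠ 0) :
    ∃ P, Finsupp.single P 1 ≤ A := by
  classical
  obtain ⟨P, hP⟩ := Finsupp.ne_iff.1 hne
  refine ⟨P, fun Q => ?_⟩
  have h0 := hA Q
  rw [Finsupp.coe_zero, Pi.zero_apply] at hP h0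
  rw [Finsupp.single_apply]
  split_ifs with h
  · subst h
    omega
  · exact h0

theorem Divisor.eq_zero_of_degree {A : Divisor C} (hA : 0 ≤ A) (h : A.degree = 0) : A = 0 := by
  by_contra hne
  obtain ⟨P, h1⟩ := Divisor.exists_single_le hA hne
  have := Divisor.degree_mono h1
  rw [Divisor.degree_single] at this
  omega

theorem H0_mono {A B : Divisor C} (h : A ≤ B) : H0 A ≤ H0 B := fun _ hf P =>
  (hf P).trans (WithZero.exp_le_exp.2 (h P))

/-- The coordinate of the value at `P` of a section of `𝒪(D)`. -/
noncomputable def coeffHom (D : Divisor C) (P : Point C) : H0 D →ₗ[κ] κ where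
  toFun f := P.coeff (D P) f.1
  map_add' f g := P.coeff_add (f.2 P) (g.2 P)
  map_smul' c f := P.coeff_smul c (f.2 P)

theorem coeffHom_apply (D : Divisor C) (P : Point C) (f : H0 D) :
    coeffHom D P f = P.coeff (D P) f.1 := rfl

theorem coeff_eq_zero_iff_mem {D : Divisor C} {P : Point C} {f : C.K} (hf : f ∈ H0 D) :
    P.coeff (D P) f = 0 ↔ f ∈ H0 (D - Finsupp.single P 1) := by
  classical
  rw [P.coeff_eq_zero_iff (hf P)]
  constructor
  · intro h Q
    by_cases hQ : Q = P
    · subst hQ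
      simpa using h
    · simpa [Finsupp.single_apply, Ne.symm hQ] using hf Q
  · intro h
    simpa using h P

/-- The sections of `𝒪(D)` are the kernel of the linear functional taking the value at `P` of
sections of `𝒪(D + P)`. -/
theorem finrank_H0_add_single (D : Divisor C) (P : Point C) [FiniteDimensional κ (H0 D)] :
    FiniteDimensional κ (H0 (D + Finsupp.single P 1)) ∧
      Module.finrank κ (H0 (D + Finsupp.single P 1)) ≤ Module.finrank κ (H0 D) + 1 := by
  let φ := coeffHom (D + Finsupp.single P 1) P
  have hker : ∀ f, f ∈ LinearMap.ker φ ↔ f.1 ∈ H0 D := by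
    intro f
    rw [LinearMap.mem_ker, coeffHom_apply, coeff_eq_zero_iff_mem f.2, add_sub_cancel_right]
  let ψ : LinearMap.ker φ →ₗ[κ] H0 D :=
    { toFun f := ⟨f.1.1, (hker f.1).1 f.2⟩
      map_add' _ _ := rfl
      map_smul' _ _ := rfl }
  have hψ : Function.Injective ψ := fun f g h => by
    have := congrArg Subtype.val h
    exact Subtype.ext (Subtype.ext this)
  have h1 : FiniteDimensional κ (LinearMap.ker φ) := FiniteDimensional.of_injective ψ hψ
  have h2 : FiniteDimensional κ (H0 (D + Finsupp.single P 1)) := by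
    have h3 : Module.Finite κ (H0 (D + Finsupp.single P 1) ⧸ LinearMap.ker φ) :=
      Module.Finite.equiv φ.quotKerEquivRange.symm
    exact Module.Finite.of_submodule_quotient (LinearMap.ker φ)
  refine ⟨h2, ?_⟩
  rw [← φ.finrank_range_add_finrank_ker, add_comm]
  refine add_le_add (LinearMap.finrank_le_finrank_of_injective hψ) ?_
  exact (Submodule.finrank_le _).trans (Module.finrank_self κ).le

theorem mem_H0_of_polar {f : C.K} {B : Divisor C} (hB : ∀ P, B P = max 0 (WithZero.log (P.val f))) :
    f ∈ H0 B := by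
  intro P
  by_cases hf0 : f = 0
  · simp [hf0]
  rw [P.val_eq_exp hf0, WithZero.exp_le_exp, hB]
  exact le_max_right _ _

theorem mul_mem_H0 {A B : Divisor C} {f g : C.K} (hf : f ∈ H0 A) (hg : g ∈ H0 B) :
    f * g ∈ H0 (A + B) := by
  intro P
  rw [map_mul, Finsupp.add_apply, WithZero.exp_add]
  exact mul_le_mul' (hf P) (hg P)

theorem one_mem_H0 {A : Divisor C} (hA : 0 ≤ A) : (1 : C.K) ∈ H0 A := by
  intro P
  rw [map_one, ← WithZero.exp_zero, WithZero.exp_le_exp]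
  exact hA P

theorem pow_mem_H0 {B : Divisor C} (hB : 0 ≤ B) {f : C.K} (hf : f ∈ H0 B) {k m : ℕ} (hk : k ≤ m) :
    f ^ k ∈ H0 (m • B) := by
  have h : f ^ k ∈ H0 (k • B) := by
    clear hk
    induction k with
    | zero =>
      rw [pow_zero, zero_smul]
      exact one_mem_H0 le_rfl
    | succ k ih =>
      rw [pow_succ, succ_nsmul]
      exact mul_mem_H0 ih hf
  exact H0_mono (nsmul_le_nsmul_left hB hk) h

variable [IsAlgClosed κ]

theorem transcendental_or_const (f : C.K) : Transcendental κ f ∨ ∃ c, f = algebraMap κ C.K c := by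
  by_cases h : Transcendental κ f
  · exact Or.inl h
  right
  have hint : IsIntegral κ f := (not_not.1 h : IsAlgebraic κ f).isIntegral
  obtain ⟨c, hc⟩ := minpoly.mem_range_of_degree_eq_one κ f
    (IsAlgClosed.degree_eq_one_of_irreducible κ (minpoly.irreducible hint))
  exact ⟨c, hc.symm⟩

/-- A nonconstant function has a pole, namely a zero of its inverse. -/
theorem exists_algebraMap_of_mem_H0_zero {f : C.K} (hf : f ∈ H0 (0 : Divisor C)) :
    ∃ c, f = algebraMap κ C.K c := by
  refine (transcendental_or_const f).resolve_left fun h => ?_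
  have hf0 : f ≠ 0 := by
    rintro rfl
    exact h isAlgebraic_zero
  have h' : Transcendental κ f⁻¹ := fun h' => h (by simpa using h'.inv)
  obtain ⟨P, hP⟩ := exists_point_val_lt_one h'
  have := hf P
  rw [Finsupp.coe_zero, Pi.zero_apply, WithZero.exp_zero] at this
  rw [map_inv₀, inv_lt_one₀ (P.val.pos_iff.2 hf0)] at hP
  exact absurd this (not_le.2 hP)

theorem finrank_H0_zero : FiniteDimensional κ (H0 (0 : Divisor C)) ∧
    Module.finrank κ (H0 (0 : Divisor C)) ≤ 1 := by
  have hspan : H0 (0 : Divisor C) ≤ Submodule.span κ {1} := by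
    intro f hf
    obtain ⟨c, rfl⟩ := exists_algebraMap_of_mem_H0_zero hf
    exact Submodule.mem_span_singleton.2 ⟨c, by rw [Algebra.smul_def, mul_one]⟩
  have : FiniteDimensional κ (Submodule.span κ ({1} : Set C.K)) :=
    FiniteDimensional.span_of_finite κ (Set.finite_singleton _)
  refine ⟨Submodule.finiteDimensional_of_le hspan, (Submodule.finrank_mono hspan).trans ?_⟩
  exact (finrank_span_le_card _).trans (by simp)

theorem finrank_H0_le {D : Divisor C} (hD : 0 ≤ D) :
    FiniteDimensional κ (H0 D) ∧ (Module.finrank κ (H0 D) : ℤ) ≤ D.degree + 1 := by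
  obtain ⟨m, hm⟩ : ∃ m : ℕ, D.degree = m := ⟨_, (Int.toNat_of_nonneg (Divisor.degree_nonneg hD)).symm⟩
  induction m generalizing D with
  | zero =>
    obtain rfl := Divisor.eq_zero_of_degree hD hm
    refine ⟨finrank_H0_zero.1, ?_⟩
    rw [Divisor.degree_zero]
    exact_mod_cast finrank_H0_zero.2
  | succ m ih =>
    have hne : D ≠ 0 := by
      rintro rfl
      rw [Divisor.degree_zero] at hm
      omega
    obtain ⟨P, h1⟩ := Divisor.exists_single_le hD hne
    have hdeg : (D - Finsupp.single P 1 : Divisor C).degree = m := by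
      rw [Divisor.degree_sub, Divisor.degree_single, hm]
      push_cast
      ring
    obtain ⟨ih1, ih2⟩ := ih (sub_nonneg.2 h1) hdeg
    have h2 := finrank_H0_add_single (D - Finsupp.single P 1) P
    rw [sub_add_cancel] at h2
    refine ⟨h2.1, ?_⟩
    rw [hdeg] at ih2
    rw [hm]
    push_cast
    have := h2.2
    omega

/-- The polar divisor. -/
theorem exists_polar_divisor (f : C.K) :
    ∃ B : Divisor C, ∀ P, B P = max 0 (WithZero.log (P.val f)) := by
  classical
  by_cases hf0 : f = 0
  · exact ⟨0, fun P => by simp [hf0]⟩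
  have hfin : {P : Point C | 1 < P.val f}.Finite := by
    rcases transcendental_or_const f with h | ⟨c, hc⟩
    -- Infinitely many poles of `f` would be infinitely many zeros of `f⁻¹`.
    · have h' : Transcendental κ f⁻¹ := fun h' => h (by simpa using h'.inv)
      by_contra hinf
      obtain ⟨S, hS, hcard⟩ := Set.Infinite.exists_subset_card_eq hinf
        (Module.finrank κ⟮f⁻¹⟯ C.K + 1)
      have := sum_zeros_le_finrank h' S (fun _ => 1) fun P hP => by
        have h1 : 1 < P.val f := hS hP
        have := P.val_lt_one_iff (f := f⁻¹)
        rw [map_inv₀] at this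
        rw [map_inv₀]
        exact this.1 (inv_lt_one_of_one_lt₀ h1)
      simp only [Finset.sum_const, hcard, smul_eq_mul, mul_one] at this
      omega
    · convert Set.finite_empty
      ext P
      simp only [Set.mem_ofPred_eq, Set.mem_empty_iff_false, iff_false, not_lt, hc]
      exact P.val_algebraMap_le_one c
  refine ⟨Finsupp.onFinset hfin.toFinset (fun P => max 0 (WithZero.log (P.val f))) ?_,
    fun P => rfl⟩
  intro P hP
  rw [Set.Finite.mem_toFinset, Set.mem_ofPred_eq, P.val_eq_exp hf0, ← WithZero.exp_zero,
    WithZero.exp_lt_exp]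
  by_contra hcon
  exact hP (max_eq_left (not_lt.1 hcon))

/-- A function `f` has at least `[K : κ(f)]` poles, counted with multiplicities. -/
theorem finrank_le_degree_polar {f : C.K} (hf : Transcendental κ f) {B : Divisor C}
    (hB : ∀ P, B P = max 0 (WithZero.log (P.val f))) :
    (Module.finrank κ⟮f⟯ C.K : ℤ) ≤ B.degree := by
  classical
  have hfd := C.finiteDimensional_adjoin hf
  have hB0 : 0 ≤ B := fun P => by rw [hB]; exact le_max_left _ _
  set n := Module.finrank κ⟮f⟯ C.K with hn
  have hnpos : 0 < n := Module.finrank_pos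
  let y := Module.finBasis κ⟮f⟯ C.K
  choose Y hY using fun i => exists_polar_divisor (y i)
  have hY0 : ∀ i, 0 ≤ Y i := fun i P => by rw [hY]; exact le_max_left _ _
  let D := ∑ i, Y i
  have hD : 0 ≤ D := Finset.sum_nonneg fun i _ => hY0 i
  have hyD : ∀ i, y i ∈ H0 D := fun i =>
    H0_mono (Finset.single_le_sum (fun i _ => hY0 i) (Finset.mem_univ i)) (mem_H0_of_polar (hY i))
  -- For a basis `y` of `K` over `κ(f)`, the products `f ^ k * y i` with `k ≤ m` are independent
  -- sections of `𝒪(D + m B)`. Comparing the growth of both sides in `m` gives `n ≤ deg B`.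
  have key : ∀ m : ℕ, ((m + 1) * n : ℤ) ≤ D.degree + m * B.degree + 1 := by
    intro m
    have hli : LinearIndependent κ fun p : Fin (m + 1) × Fin n => f ^ p.1.1 * y p.2 := by
      have h1 : LinearIndependent κ fun k : Fin (m + 1) => (AdjoinSimple.gen κ f) ^ k.1 := by
        rw [Fintype.linearIndependent_iff]
        intro g hg k
        have h1 : aeval f (∑ k : Fin (m + 1), Polynomial.C (g k) * X ^ k.1) = 0 := by
          have := congrArg (algebraMap κ⟮f⟯ C.K) hg
          simpa [Algebra.smul_def, ← IsScalarTower.algebraMap_apply] using this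
        have h2 := congrArg (fun p => p.coeff k.1) (transcendental_iff.1 hf _ h1)
        simp only [finsetSum_coeff, coeff_C_mul, coeff_X_pow, coeff_zero] at h2
        rw [Finset.sum_eq_single k] at h2
        · simpa using h2
        · intro j _ hj
          rw [if_neg fun h => hj (Fin.ext h.symm), mul_zero]
        · simp
      have h2 := linearIndependent_smul h1 y.linearIndependent
      exact h2
    have hfin := finrank_H0_le (add_nonneg hD (nsmul_nonneg hB0 m))
    have := hfin.1
    have hle : Fintype.card (Fin (m + 1) × Fin n) ≤ Module.finrank κ (H0 (D + m • B)) := by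
      refine LinearIndependent.fintype_card_le_finrank (R := κ) (b := fun p : Fin (m + 1) × Fin n =>
        (⟨f ^ p.1.1 * y p.2, ?_⟩ : H0 (D + m • B))) ?_
      · rw [mul_comm]
        exact mul_mem_H0 (hyD _) (pow_mem_H0 hB0 (mem_H0_of_polar hB) (by omega))
      · exact LinearIndependent.of_comp (H0 (D + m • B)).subtype hli
    have h3 := hfin.2
    rw [Divisor.degree_add, ← natCast_zsmul, Divisor.degree_zsmul] at h3
    simp only [Fintype.card_prod, Fintype.card_fin] at hle
    have : (((m + 1) * n : ℕ) : ℤ) ≤ Module.finrank κ (H0 (D + m • B)) := by exact_mod_cast hle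
    push_cast at this
    rw [← natCast_zsmul] at this
    linarith
  have hdD := Divisor.degree_nonneg hD
  -- If `deg B ≤ n - 1`, the inequality reads `n + m ≤ deg D + 1`, which fails for `m = deg D + 1`
  -- as `n > 0`.
  have := key (D.degree + 1).toNat
  rw [Int.toNat_of_nonneg (by omega)] at this
  by_contra hcon
  push Not at hcon
  nlinarith

/-- A line bundle with a nonzero section has nonnegative degree. -/
theorem degree_nonneg_of_mem_H0 {D : Divisor C} {f : C.K} (hf0 : f ≠ 0) (hf : f ∈ H0 D) :
    0 ≤ D.degree := by
  classical
  rcases transcendental_or_const f with h | ⟨c, hc⟩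
  · obtain ⟨B, hB⟩ := exists_polar_divisor f
    have h1 := finrank_le_degree_polar h hB
    have hD : ∀ P, WithZero.log (P.val f) ≤ D P := fun P => by
      have := hf P
      rwa [P.val_eq_exp hf0, WithZero.exp_le_exp] at this
    -- It suffices to count the zeros in the support of `D`. All poles lie there, since `D` is at
    -- least the order of the pole.
    have h2 := sum_zeros_le_finrank h (D.support.filter fun P => WithZero.log (P.val f) ≤ 0)
      (fun P => (- WithZero.log (P.val f)).toNat) (fun P hP => by
        rw [P.val_eq_exp hf0, WithZero.exp_le_exp, ← P.val_eq_exp hf0]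
        have := (Finset.mem_filter.1 hP).2
        omega)
    rw [Finset.sum_filter_of_ne (fun P _ h => by omega)] at h2
    have h3 : B.degree = ∑ P ∈ D.support, B P := by
      refine Finset.sum_subset (fun P hP => ?_) fun P _ hP => Finsupp.notMem_support_iff.1 hP
      rw [Finsupp.mem_support_iff, hB] at hP
      rw [Finsupp.mem_support_iff]
      have := hD P
      omega
    have h4 : D.degree = ∑ P ∈ D.support, D P := rfl
    have h5 : ∑ P ∈ D.support, (B P - ((- WithZero.log (P.val f)).toNat : ℤ)) ≤
        ∑ P ∈ D.support, D P := by
      refine Finset.sum_le_sum fun P _ => ?_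
      have := hD P
      rw [hB]
      omega
    rw [Finset.sum_sub_distrib, ← h3, ← h4] at h5
    have h6 : (∑ P ∈ D.support, ((- WithZero.log (P.val f)).toNat : ℤ)) ≤
        Module.finrank κ⟮f⟯ C.K := by exact_mod_cast h2
    linarith
  · refine Divisor.degree_nonneg fun P => ?_
    have := hf P
    have hc0 : c ≠ 0 := by
      rintro rfl
      exact hf0 (by rw [hc, map_zero])
    rwa [hc, P.val_algebraMap hc0, ← WithZero.exp_zero, WithZero.exp_le_exp] at this

end Degree
end OssermanLLS

namespace OssermanLLS

open Polynomial IntermediateField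

/-! ### Isomorphisms of line bundles and fibres of bundles of degree zero -/

section LinearEquivalence

variable {κ : Type u} [Field κ] {C : Curve κ}

theorem IsBundleIso.val_mul {h : C.K} {A B : Divisor C} (hh : IsBundleIso h A B) (P : Point C)
    (f : C.K) : P.val (h * f) ≤ WithZero.exp (B P) ↔ P.val f ≤ WithZero.exp (A P) := by
  rw [map_mul, hh.2]
  have : WithZero.exp (B P) = WithZero.exp (B P - A P) * WithZero.exp (A P) := by
    rw [← WithZero.exp_add, sub_add_cancel]
  rw [this]
  exact mul_le_mul_iff_right₀ (zero_lt_iff.2 WithZero.exp_ne_zero)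

theorem IsBundleIso.mul_mem_iff {h : C.K} {A B : Divisor C} (hh : IsBundleIso h A B) {f : C.K} :
    h * f ∈ H0 B ↔ f ∈ H0 A :=
  forall_congr' fun P => hh.val_mul P f

theorem IsBundleIso.sub {h : C.K} {A B : Divisor C} (hh : IsBundleIso h A B) (D : Divisor C) :
    IsBundleIso h (A - D) (B - D) :=
  ⟨hh.1, fun P => by rw [hh.2]; simp⟩

theorem IsBundleIso.one (A : Divisor C) : IsBundleIso 1 A A :=
  ⟨one_ne_zero, fun P => by simp⟩

theorem IsBundleIso.mul {h k : C.K} {A B D E : Divisor C} (hh : IsBundleIso h A B)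
    (hk : IsBundleIso k D E) : IsBundleIso (h * k) (A + D) (B + E) :=
  ⟨mul_ne_zero hh.1 hk.1, fun P => by
    rw [map_mul, hh.2, hk.2, ← WithZero.exp_add]
    congr 1
    simp only [Finsupp.add_apply]
    ring⟩

theorem IsBundleIso.inv {h : C.K} {A B : Divisor C} (hh : IsBundleIso h A B) :
    IsBundleIso h⁻¹ B A :=
  ⟨inv_ne_zero hh.1, fun P => by
    rw [map_inv₀, hh.2, ← WithZero.exp_neg]
    congr 1
    ring⟩

theorem IsBundleIso.trans {h k : C.K} {A B D : Divisor C} (hh : IsBundleIso h A B)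
    (hk : IsBundleIso k B D) : IsBundleIso (k * h) A D :=
  ⟨mul_ne_zero hk.1 hh.1, fun P => by
    rw [map_mul, hh.2, hk.2, ← WithZero.exp_add]
    congr 1
    ring⟩

/-- The coordinates of the values of sections are multiplied by nonzero scalars under an
isomorphism. -/
theorem IsBundleIso.coeff_mul {h : C.K} {A B : Divisor C} (hh : IsBundleIso h A B) (P : Point C)
    {f : C.K} (hf : P.val f ≤ WithZero.exp (A P)) :
    P.coeff (B P) (h * f) = P.coeff (B P - A P) h * P.coeff (A P) f := by
  rw [← P.coeff_mul (hh.2 P).le hf, sub_add_cancel]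

theorem IsBundleIso.coeff_ne_zero {h : C.K} {A B : Divisor C} (hh : IsBundleIso h A B)
    (P : Point C) : P.coeff (B P - A P) h ≠ 0 :=
  P.coeff_ne_zero (hh.2 P)

/-- Linear equivalence of divisors. -/
def LinEquiv (A B : Divisor C) : Prop := ∃ h, IsBundleIso h A B

theorem LinEquiv.refl (A : Divisor C) : LinEquiv A A := ⟨1, .one A⟩

theorem LinEquiv.symm {A B : Divisor C} (h : LinEquiv A B) : LinEquiv B A :=
  ⟨_, h.choose_spec.inv⟩

theorem LinEquiv.trans {A B D : Divisor C} (h : LinEquiv A B) (h' : LinEquiv B D) :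
    LinEquiv A D :=
  ⟨_, h.choose_spec.trans h'.choose_spec⟩

theorem LinEquiv.add {A B D E : Divisor C} (h : LinEquiv A B) (h' : LinEquiv D E) :
    LinEquiv (A + D) (B + E) :=
  ⟨_, h.choose_spec.mul h'.choose_spec⟩

theorem LinEquiv.zsmul {A B : Divisor C} (h : LinEquiv A B) (m : ℤ) :
    LinEquiv (m • A) (m • B) := by
  obtain ⟨f, hf⟩ := h
  refine ⟨f ^ m, zpow_ne_zero m hf.1, fun P => ?_⟩
  rw [map_zpow₀, hf.2, ← WithZero.exp_zsmul]
  congr 1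
  simp only [Finsupp.smul_apply, smul_eq_mul]
  ring

theorem LinEquiv.sum {ι : Type*} (s : Finset ι) {A B : ι → Divisor C}
    (h : ∀ i ∈ s, LinEquiv (A i) (B i)) : LinEquiv (∑ i ∈ s, A i) (∑ i ∈ s, B i) := by
  classical
  induction s using Finset.induction_on with
  | empty => exact .refl 0
  | insert i s hi ih =>
    rw [Finset.sum_insert hi, Finset.sum_insert hi]
    exact (h i (Finset.mem_insert_self _ _)).add
      (ih fun j hj => h j (Finset.mem_insert_of_mem hj))

theorem LinEquiv.exists_section {A : Divisor C} (h : LinEquiv A 0) : ∃ f, f ≠ 0 ∧ f ∈ H0 A := by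
  obtain ⟨f, hf⟩ := h.symm
  refine ⟨f, hf.1, ?_⟩
  have := (hf.mul_mem_iff (f := 1)).2 (one_mem_H0 le_rfl)
  rwa [mul_one] at this

variable [IsAlgClosed κ]

/-- The isomorphism is a nonzero section of `𝒪(B - A)`, and its inverse one of `𝒪(A - B)`. -/
theorem LinEquiv.degree_eq {A B : Divisor C} (h : LinEquiv A B) : A.degree = B.degree := by
  have key : ∀ {A B : Divisor C}, LinEquiv A B → A.degree ≤ B.degree := by
    intro A B h
    obtain ⟨f, hf⟩ := h
    have : f ∈ H0 (B - A) := fun P => (hf.2 P).le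
    have := degree_nonneg_of_mem_H0 hf.1 this
    rw [Divisor.degree_sub] at this
    linarith
  exact le_antisymm (key h) (key h.symm)

/-- A nonzero section of a line bundle of degree zero vanishes nowhere. -/
theorem coeff_ne_zero_of_degree_zero {D : Divisor C} (hD : D.degree = 0) {f : C.K} (hf0 : f ≠ 0)
    (hf : f ∈ H0 D) (P : Point C) : P.coeff (D P) f ≠ 0 := by
  intro h
  have := degree_nonneg_of_mem_H0 hf0 ((coeff_eq_zero_iff_mem hf).1 h)
  rw [Divisor.degree_sub, Divisor.degree_single, hD] at this
  omega

/-- In degree zero a nonzero section vanishes nowhere, so two sections that agree at `P` are equal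
and all sections are multiples of one. If there is no nonzero section, any unit will do; triviality
of the bundle is not needed. -/
theorem exists_coeff_ratio {D : Divisor C} (hD : D.degree = 0) (P Q : Point C) :
    ∃ c : κˣ, ∀ f ∈ H0 D, Q.coeff (D Q) f = c * P.coeff (D P) f := by
  by_cases h : ∃ f, f ≠ 0 ∧ f ∈ H0 D
  · obtain ⟨f, hf0, hf⟩ := h
    have hP := coeff_ne_zero_of_degree_zero hD hf0 hf P
    have hQ := coeff_ne_zero_of_degree_zero hD hf0 hf Q
    refine ⟨Units.mk0 _ hQ * (Units.mk0 _ hP)⁻¹, fun g hg => ?_⟩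
    have hsub : coeffHom D P (⟨g, hg⟩ - (P.coeff (D P) g / P.coeff (D P) f) • ⟨f, hf⟩) = 0 := by
      rw [map_sub, map_smul, coeffHom_apply, coeffHom_apply, smul_eq_mul, div_mul_cancel₀ _ hP,
        sub_self]
    have hzero : (⟨g, hg⟩ - (P.coeff (D P) g / P.coeff (D P) f) • ⟨f, hf⟩ : H0 D) = 0 := by
      by_contra hne
      exact coeff_ne_zero_of_degree_zero hD (fun h => hne (Subtype.ext h)) (Subtype.prop _) P hsub
    have := congrArg (coeffHom D Q) hzero
    rw [map_sub, map_smul, coeffHom_apply, coeffHom_apply, map_zero, smul_eq_mul,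
      sub_eq_zero] at this
    rw [this]
    push_cast
    simp only [Units.val_mk0]
    field_simp
  · push Not at h
    refine ⟨1, fun f hf => ?_⟩
    have : f = 0 := by
      by_contra h0
      exact h f h0 hf
    subst this
    have hz : ∀ R : Point C, R.coeff (D R) 0 = 0 := fun R => map_zero (coeffHom D R)
    rw [hz, hz, mul_zero]

open Classical in
/-- The factor by which the coordinates at `P` and `Q` of the value of a section of the bundle
`𝒪(D)` of degree zero differ. -/
noncomputable def coeffRatio (D : Divisor C) (P Q : Point C) : κˣ :=
  if h : D.degree = 0 then (exists_coeff_ratio h P Q).choose else 1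

theorem coeff_eq_coeffRatio_mul {D : Divisor C} (hD : D.degree = 0) (P Q : Point C) {f : C.K}
    (hf : f ∈ H0 D) : Q.coeff (D Q) f = coeffRatio D P Q * P.coeff (D P) f := by
  rw [coeffRatio, dif_pos hD]
  exact (exists_coeff_ratio hD P Q).choose_spec f hf

theorem exists_coeff_eq {D : Divisor C} (hD : LinEquiv D 0) (P : Point C) (x : κ) :
    ∃ f ∈ H0 D, P.coeff (D P) f = x := by
  obtain ⟨f, hf0, hf⟩ := hD.exists_section
  have h0 : D.degree = 0 := by rw [hD.degree_eq, Divisor.degree_zero]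
  have hP := coeff_ne_zero_of_degree_zero h0 hf0 hf P
  refine ⟨(x / P.coeff (D P) f) • f, Submodule.smul_mem _ _ hf, ?_⟩
  rw [P.coeff_smul _ (hf P), div_mul_cancel₀ _ hP]

end LinearEquivalence

/-! ### The projective line: principal divisors supported at `0` and `∞` -/

section Line

variable (κ : Type u) [Field κ]

theorem pointZero_val_X : (pointZero κ).val (RatFunc.X : RatFunc κ) = WithZero.exp (-1 : ℤ) :=
  Polynomial.valuation_X_eq_neg_one κ

theorem pointInfty_val_X : (pointInfty κ).val (RatFunc.X : RatFunc κ) = WithZero.exp (1 : ℤ) := by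
  classical
  exact RatFunc.inftyValuation.X κ

theorem finrank_adjoin_ratFuncX : Module.finrank κ⟮(RatFunc.X : RatFunc κ)⟯ (RatFunc κ) = 1 := by
  rw [RatFunc.adjoin_X]
  exact IntermediateField.finrank_top

theorem finrank_adjoin_ratFuncX_inv :
    Module.finrank κ⟮(RatFunc.X : RatFunc κ)⁻¹⟯ (RatFunc κ) = 1 := by
  have : κ⟮(RatFunc.X : RatFunc κ)⁻¹⟯ = ⊤ := by
    rw [eq_top_iff, ← RatFunc.adjoin_X, IntermediateField.adjoin_simple_le_iff]
    simpa using inv_mem (IntermediateField.mem_adjoin_simple_self κ (RatFunc.X : RatFunc κ)⁻¹)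
  rw [this]
  exact IntermediateField.finrank_top

variable {κ}

/-- Both `X` and `X⁻¹` generate the function field, so the degree bounding the number of zeros is
one. The zeros at `0` and at `∞` already exhaust it. -/
theorem val_X_eq_one {P : Point (projectiveLine κ)} (h0 : P ≠ pointZero κ)
    (h1 : P ≠ pointInfty κ) : P.val (RatFunc.X : RatFunc κ) = 1 := by
  classical
  have ht : Transcendental κ (RatFunc.X : RatFunc κ) := RatFunc.transcendental_X
  have ht' : Transcendental κ (RatFunc.X : RatFunc κ)⁻¹ := fun h' => ht (by simpa using h'.inv)
  have hX : (RatFunc.X : RatFunc κ) ≠ 0 := RatFunc.X_ne_zero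
  refine le_antisymm ?_ ?_
  · by_contra hcon
    have hP : P.val (RatFunc.X : RatFunc κ)⁻¹ ≤ WithZero.exp (-1) := by
      refine (P.val_lt_one_iff (f := (RatFunc.X : RatFunc κ)⁻¹)).1 ?_
      rw [map_inv₀]
      exact inv_lt_one_of_one_lt₀ (not_le.1 hcon)
    have := sum_zeros_le_finrank (C := projectiveLine κ) ht' {P, pointInfty κ} (fun _ => 1) (by
      intro Q hQ
      rcases Finset.mem_insert.1 hQ with rfl | hQ
      · exact hP
      · rw [Finset.mem_singleton.1 hQ, map_inv₀, pointInfty_val_X, ← WithZero.exp_neg]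
        rfl)
    rw [Finset.sum_pair h1] at this
    have h2 := this.trans_eq (finrank_adjoin_ratFuncX_inv κ)
    omega
  · by_contra hcon
    have hP : P.val (RatFunc.X : RatFunc κ) ≤ WithZero.exp (-1) :=
      (P.val_lt_one_iff (f := (RatFunc.X : RatFunc κ))).1 (not_le.1 hcon)
    have := sum_zeros_le_finrank (C := projectiveLine κ) ht {P, pointZero κ} (fun _ => 1) (by
      intro Q hQ
      rcases Finset.mem_insert.1 hQ with rfl | hQ
      · exact hP
      · rw [Finset.mem_singleton.1 hQ, pointZero_val_X]
        rfl)
    rw [Finset.sum_pair h0] at this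
    have h2 := this.trans_eq (finrank_adjoin_ratFuncX κ)
    omega

theorem linEquiv_pointZero_pointInfty :
    LinEquiv (Finsupp.single (pointZero κ) 1 : Divisor (projectiveLine κ))
      (Finsupp.single (pointInfty κ) 1) := by
  classical
  refine ⟨(RatFunc.X : RatFunc κ), RatFunc.X_ne_zero, fun P => ?_⟩
  by_cases h0 : P = pointZero κ
  · rw [h0, pointZero_val_X, Finsupp.single_eq_same, Finsupp.single_eq_of_ne
      (pointZero_ne_pointInfty κ)]
    rfl
  by_cases h1 : P = pointInfty κ
  · rw [h1, pointInfty_val_X, Finsupp.single_eq_same, Finsupp.single_eq_of_ne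
      (pointZero_ne_pointInfty κ).symm]
    rfl
  · rw [val_X_eq_one h0 h1, Finsupp.single_eq_of_ne h0, Finsupp.single_eq_of_ne h1]
    simp

/-- A divisor of degree zero on the projective line supported on `0` and `∞` is principal. -/
theorem linEquiv_zero_of_mem_closure {D : Divisor (projectiveLine κ)}
    (hD : D ∈ AddSubgroup.closure {Finsupp.single (pointZero κ) 1, Finsupp.single (pointInfty κ) 1})
    (hdeg : D.degree = 0) : LinEquiv D 0 := by
  obtain ⟨a, b, rfl⟩ := AddSubgroup.mem_closure_pair.1 hD
  rw [Divisor.degree_add, Divisor.degree_zsmul, Divisor.degree_zsmul, Divisor.degree_single,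
    Divisor.degree_single] at hdeg
  have h := (linEquiv_pointZero_pointInfty (κ := κ)).zsmul a
  have h2 := h.add (.refl (b • Finsupp.single (pointInfty κ) 1))
  rwa [← add_zsmul, show a + b = 0 by linarith, zero_zsmul] at h2

end Line
end OssermanLLS

namespace OssermanLLS

namespace NodalCurve

/-! ### Twisting by an enriched structure, in terms of divisors -/

section Boundary

variable {κ : Type u} [Field κ] (X : NodalCurve κ)

theorem tail_ne_head (e : X.E) : X.tail e ≠ X.head e := X.loopless e

theorem degree_pointDiv (x : X.Pt) (v : X.V) :
    (X.pointDiv x v).degree = if x.1 = v then 1 else 0 := by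
  obtain ⟨u, P⟩ := x
  by_cases h : u = v
  · subst h
    rw [if_pos rfl, pointDiv, Pi.single_eq_same, Divisor.degree_single]
  · rw [if_neg h, pointDiv, Pi.single_eq_of_ne (Ne.symm h), Divisor.degree_zero]

theorem sum_zsmul_boundary (F : X.V → ℤ) :
    ∑ u, F u • X.boundary u = ∑ e, (F (X.tail e) - F (X.head e)) •
      (X.pointDiv (X.node e true) - X.pointDiv (X.node e false)) := by
  simp only [boundary, Finset.smul_sum, smul_add, smul_ite, smul_zero]
  rw [Finset.sum_comm]
  refine Finset.sum_congr rfl fun e _ => ?_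
  rw [Finset.sum_add_distrib, Finset.sum_ite_eq, Finset.sum_ite_eq, if_pos (Finset.mem_univ _),
    if_pos (Finset.mem_univ _), sub_smul, smul_sub, smul_sub, smul_sub]
  abel

/-- The degrees of the bundle obtained by firing every vertex `u` of the dual graph `F u` times. -/
theorem degree_sum_zsmul_boundary (F : X.V → ℤ) (v : X.V) :
    ((∑ u, F u • X.boundary u) v).degree =
      - ∑ e, ((if X.tail e = v then 1 else 0) - (if X.head e = v then 1 else 0)) *
        (F (X.tail e) - F (X.head e)) := by
  rw [sum_zsmul_boundary, Finset.sum_apply, Divisor.degree_sum, ← Finset.sum_neg_distrib]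
  refine Finset.sum_congr rfl fun e _ => ?_
  rw [Pi.smul_apply, Divisor.degree_zsmul, Pi.sub_apply, Divisor.degree_sub, degree_pointDiv,
    degree_pointDiv]
  change _ * ((if X.head e = v then 1 else 0) - (if X.tail e = v then 1 else 0)) = _
  ring

variable {X}

/-- On each single component the bundles of an enriched structure have a prescribed isomorphism
class; their glueing scalars play no role for divisors and degrees. -/
theorem EnrichedStructure.linEquiv_boundary (O : X.EnrichedStructure) (u v : X.V) :
    LinEquiv ((O.O u).D v) (X.boundary u v) := by
  by_cases h : v = u
  · subst h
    obtain ⟨f, hf, -⟩ := O.iso_component v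
    exact ⟨f v, hf v rfl⟩
  · obtain ⟨f, hf, -⟩ := O.iso_complement u
    exact ⟨f v, hf v h⟩

theorem EnrichedStructure.linEquiv_sum (O : X.EnrichedStructure) (F : X.V → ℤ) (v : X.V) :
    LinEquiv ((∑ u, F u • (O.O u).D) v) ((∑ u, F u • X.boundary u) v) := by
  rw [Finset.sum_apply, Finset.sum_apply]
  exact LinEquiv.sum _ fun u _ => (O.linEquiv_boundary u v).zsmul _

end Boundary

/-! ### Chip firing on the dual graph with chains -/

section Firing

variable {κ : Type u} [Field κ] {X : NodalCurve κ} {n : X.E → ℕ+}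

theorem isFiring_iff {w w' : X.Multidegree n} {F : (X.withChains n).V → ℤ} :
    IsFiring w w' F ↔ ∀ u, w'.toDiv u = w.toDiv u -
      ∑ e, ((if (X.withChains n).tail e = u then 1 else 0) -
        (if (X.withChains n).head e = u then 1 else 0)) *
        (F ((X.withChains n).tail e) - F ((X.withChains n).head e)) := by
  refine forall_congr' fun u => ?_
  have : ∀ e : (X.withChains n).E,
      ((if (X.withChains n).tail e = u then F u - F ((X.withChains n).head e) else 0)
        + (if (X.withChains n).head e = u then F u - F ((X.withChains n).tail e) else 0)) =
      ((if (X.withChains n).tail e = u then 1 else 0) -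
        (if (X.withChains n).head e = u then 1 else 0)) *
        (F ((X.withChains n).tail e) - F ((X.withChains n).head e)) := by
    intro e
    split_ifs with h1 h2 h2
    · exact absurd (h1.trans h2.symm) ((X.withChains n).tail_ne_head e)
    · rw [h1]; ring
    · rw [h2]; ring
    · ring
  rw [Finset.sum_congr rfl fun e _ => this e]

theorem IsFiring.trans {w w' w'' : X.Multidegree n} {F F' : (X.withChains n).V → ℤ}
    (h : IsFiring w w' F) (h' : IsFiring w' w'' F') : IsFiring w w'' (F + F') := by
  rw [isFiring_iff] at *
  intro u
  rw [h', h, sub_sub, ← Finset.sum_add_distrib]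
  congr 1
  refine Finset.sum_congr rfl fun e _ => ?_
  simp only [Pi.add_apply]
  ring

theorem IsFiring.refl (w : X.Multidegree n) : IsFiring w w 0 := by
  rw [isFiring_iff]
  intro u
  simp

theorem IsFiring.symm {w w' : X.Multidegree n} {F : (X.withChains n).V → ℤ}
    (h : IsFiring w w' F) : IsFiring w' w (-F) := by
  rw [isFiring_iff] at *
  intro u
  rw [h, sub_sub, ← Finset.sum_add_distrib, eq_comm, sub_eq_self]
  refine Finset.sum_eq_zero fun e _ => ?_
  simp only [Pi.neg_apply]
  ring

/-- A firing function is determined up to additive constants by its effect. -/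
theorem IsFiring.sub_eq_sub {w w' : X.Multidegree n} {F F' : (X.withChains n).V → ℤ}
    (h : IsFiring w w' F) (h' : IsFiring w w' F') (e : (X.withChains n).E) :
    F ((X.withChains n).tail e) - F ((X.withChains n).head e) =
      F' ((X.withChains n).tail e) - F' ((X.withChains n).head e) := by
  have h0 := isFiring_iff.1 (h.trans h'.symm)
  set H := F + -F' with hH
  have hzero : ∑ u, H u * ∑ e, ((if (X.withChains n).tail e = u then 1 else 0) -
        (if (X.withChains n).head e = u then 1 else 0)) *
        (H ((X.withChains n).tail e) - H ((X.withChains n).head e)) = 0 := by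
    refine Finset.sum_eq_zero fun u _ => ?_
    have := h0 u
    rw [eq_comm, sub_eq_self] at this
    rw [this, mul_zero]
  -- Summation by parts: pairing `H` with its Laplacian gives the energy of `H`. As the difference
  -- `H` of two firing functions has zero Laplacian, it does not vary along any edge.
  have henergy : ∑ e, (H ((X.withChains n).tail e) - H ((X.withChains n).head e)) ^ 2 = 0 := by
    rw [← hzero]
    simp only [Finset.mul_sum]
    rw [Finset.sum_comm]
    refine Finset.sum_congr rfl fun e _ => ?_
    have : ∀ u, H u * (((if (X.withChains n).tail e = u then 1 else 0) -
        (if (X.withChains n).head e = u then 1 else 0)) *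
        (H ((X.withChains n).tail e) - H ((X.withChains n).head e))) =
        (if (X.withChains n).tail e = u then
          H u * (H ((X.withChains n).tail e) - H ((X.withChains n).head e)) else 0) -
        (if (X.withChains n).head e = u then
          H u * (H ((X.withChains n).tail e) - H ((X.withChains n).head e)) else 0) := by
      intro u
      split_ifs <;> ring
    rw [Finset.sum_congr rfl fun u _ => this u, Finset.sum_sub_distrib, Finset.sum_ite_eq,
      Finset.sum_ite_eq, if_pos (Finset.mem_univ _), if_pos (Finset.mem_univ _)]
    ring
  have := (Finset.sum_eq_zero_iff_of_nonneg fun e _ => sq_nonneg _).1 henergy e (Finset.mem_univ e)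
  have h1 := pow_eq_zero_iff (two_ne_zero) |>.1 this
  simp only [hH, Pi.add_apply, Pi.neg_apply] at h1
  linarith

theorem IsFiring.sum_boundary_eq {w w' : X.Multidegree n} {F F' : (X.withChains n).V → ℤ}
    (h : IsFiring w w' F) (h' : IsFiring w w' F') :
    ∑ u, F u • (X.withChains n).boundary u = ∑ u, F' u • (X.withChains n).boundary u := by
  rw [sum_zsmul_boundary, sum_zsmul_boundary]
  exact Finset.sum_congr rfl fun e _ => by rw [h.sub_eq_sub h']

theorem firing_spec {w w' : X.Multidegree n} (h : ∃ F, IsFiring w w' F) :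
    IsFiring w w' (firing w w') := by
  rw [firing, dif_pos h]
  exact h.choose_spec

theorem Multidegree.total_eq_sum (w : X.Multidegree n) : w.total = ∑ u, w.toDiv u := by
  rw [Fintype.sum_sum_type, Multidegree.total, add_comm, Fintype.sum_sigma]
  congr 1
  rw [Finset.card_filter]
  push_cast
  refine Finset.sum_congr rfl fun e _ => ?_
  have hval : ∀ k : Fin ((n e : ℕ) - 1), w.toDiv (Sum.inr ⟨e, k⟩) =
      if (w.chip e).val = k.val + 1 then 1 else 0 := fun k => rfl
  simp only [hval]
  by_cases h : w.chip e = 0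
  · rw [if_neg (not_not.2 h)]
    refine (Finset.sum_eq_zero fun k _ => if_neg ?_).symm
    rw [h, ZMod.val_zero]
    omega
  · rw [if_pos h]
    have h1 : (w.chip e).val ≠ 0 := fun h' => h ((ZMod.val_eq_zero _).1 h')
    have h2 : (w.chip e).val < n e := ZMod.val_lt _
    -- The inserted line with index `k` sits at distance `k + 1` from the tail.
    rw [Finset.sum_eq_single ⟨(w.chip e).val - 1, by omega⟩]
    · rw [if_pos]
      dsimp only
      omega
    · intro k _ hk
      refine if_neg fun h' => hk (Fin.ext ?_)
      dsimp only
      omega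
    · simp

theorem IsFiring.total_eq {w w' : X.Multidegree n} {F : (X.withChains n).V → ℤ}
    (h : IsFiring w w' F) : w'.total = w.total := by
  rw [isFiring_iff] at h
  rw [Multidegree.total_eq_sum, Multidegree.total_eq_sum, Finset.sum_congr rfl fun u _ => h u,
    Finset.sum_sub_distrib, sub_eq_self, Finset.sum_comm]
  refine Finset.sum_eq_zero fun e _ => ?_
  rw [← Finset.sum_mul, Finset.sum_sub_distrib, Finset.sum_ite_eq, Finset.sum_ite_eq,
    if_pos (Finset.mem_univ _), if_pos (Finset.mem_univ _), sub_self, zero_mul]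

end Firing

/-! ### Positions along an inserted chain -/

section Chain

variable {κ : Type u} [Field κ] (X : NodalCurve κ) (n : X.E → ℕ+)

/-- The component at distance `p` from the tail of `e`. -/
def chainPos (e : X.E) (p : ℕ) : X.ChainV n :=
  if h0 : p = 0 then Sum.inl (X.tail e)
  else if h : p < n e then Sum.inr ⟨e, ⟨p - 1, by omega⟩⟩ else Sum.inl (X.head e)

theorem withChains_tail (e : X.E) (k : Fin (n e)) :
    (X.withChains n).tail ⟨e, k⟩ = X.chainPos n e k := by
  change (X.chainNode n ⟨e, k⟩ false).1 = _
  rw [chainPos]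
  by_cases h : k.val = 0
  · simp [chainNode, h, tail]
  · simp [chainNode, h]

theorem withChains_head (e : X.E) (k : Fin (n e)) :
    (X.withChains n).head ⟨e, k⟩ = X.chainPos n e (k + 1) := by
  change (X.chainNode n ⟨e, k⟩ true).1 = _
  have := k.2
  rw [chainPos, dif_neg (Nat.succ_ne_zero _)]
  by_cases h : k.val + 1 = n e
  · rw [dif_neg (by omega)]
    simp [chainNode, h, head]
  · rw [dif_pos (by omega)]
    simp [chainNode, h]

variable {X n}

theorem chainPos_val_eq_inl {e : X.E} {c : ZMod (n e)} {x : X.V} :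
    X.chainPos n e c.val = Sum.inl x ↔ c = 0 ∧ X.tail e = x := by
  have h2 : c.val < n e := ZMod.val_lt _
  rw [chainPos]
  by_cases h : c.val = 0
  · rw [dif_pos h, Sum.inl.injEq, (ZMod.val_eq_zero _).1 h]
    simp
  · rw [dif_neg h, dif_pos h2]
    simp only [reduceCtorEq, false_iff, not_and]
    intro h'
    exact absurd (by rw [h', ZMod.val_zero]) h

theorem chainPos_val_eq_inr {e e' : X.E} {c : ZMod (n e)} {k : Fin ((n e' : ℕ) - 1)} :
    X.chainPos n e c.val = Sum.inr ⟨e', k⟩ ↔ e = e' ∧ c.val = k.val + 1 := by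
  have h2 : c.val < n e := ZMod.val_lt _
  rw [chainPos]
  by_cases h : c.val = 0
  · rw [dif_pos h]
    simp only [reduceCtorEq, false_iff, not_and]
    omega
  · rw [dif_neg h, dif_pos h2, Sum.inr.injEq]
    constructor
    · intro h'
      obtain ⟨rfl, h'⟩ := Sigma.mk.inj_iff.1 h'
      have := congrArg Fin.val (eq_of_heq h')
      dsimp only at this
      exact ⟨rfl, by omega⟩
    · rintro ⟨rfl, h'⟩
      congr 1
      exact Fin.ext (by dsimp only; omega)

theorem val_add_one (m : ℕ+) (c : ZMod m) :
    (c + 1).val = if c.val + 1 = m then 0 else c.val + 1 := by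
  have h2 : c.val < m := ZMod.val_lt _
  rw [ZMod.val_add, ZMod.val_one_eq_one_mod, Nat.add_mod_mod]
  split_ifs with h
  · rw [h, Nat.mod_self]
  · exact Nat.mod_eq_of_lt (by omega)

theorem chainPos_val_succ_eq_inl {e : X.E} {c : ZMod (n e)} {x : X.V} :
    X.chainPos n e (c.val + 1) = Sum.inl x ↔ c + 1 = 0 ∧ X.head e = x := by
  have h2 : c.val < n e := ZMod.val_lt _
  rw [← ZMod.val_eq_zero, val_add_one, chainPos, dif_neg (Nat.succ_ne_zero _)]
  by_cases h : c.val + 1 = n e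
  · rw [dif_neg (by omega), if_pos h]
    simp
  · rw [dif_pos (by omega), if_neg h]
    simp

theorem chainPos_val_succ_eq_inr {e e' : X.E} {c : ZMod (n e)} {k : Fin ((n e' : ℕ) - 1)} :
    X.chainPos n e (c.val + 1) = Sum.inr ⟨e', k⟩ ↔ e = e' ∧ (c + 1).val = k.val + 1 := by
  have h2 : c.val < n e := ZMod.val_lt _
  rw [val_add_one]
  by_cases h : c.val + 1 = n e
  · rw [if_pos h, chainPos, dif_neg (Nat.succ_ne_zero _), dif_neg (by omega)]
    simp
  · have := chainPos_val_eq_inr (c := c + 1) (k := k)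
    rw [val_add_one, if_neg h] at this
    rwa [if_neg h]

end Chain

end NodalCurve
end OssermanLLS

namespace OssermanLLS

namespace NodalCurve

/-! ### Twists as firings of step functions -/

section Step

variable {κ : Type u} [Field κ] {X : NodalCurve κ} {n : X.E → ℕ+}

/-- The place where the function `stepFun` jumps along the chain of `e`. -/
def cut (w : X.Multidegree n) (G : X.V → ℤ) (e : X.E) : ZMod (n e) :=
  if G (X.head e) < G (X.tail e) then w.chip e else w.chip e - 1

/-- The extension of a function on the vertices to the vertices of the chains which jumps at the
chips. -/
def stepFun (w : X.Multidegree n) (G : X.V → ℤ) : (X.withChains n).V → ℤ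
  | Sum.inl v => G v
  | Sum.inr p => if p.2.val + 1 ≤ (cut w G p.1).val then G (X.tail p.1) else G (X.head p.1)

theorem stepFun_chainPos (w : X.Multidegree n) (G : X.V → ℤ) (e : X.E) {p : ℕ} (hp : p ≤ n e) :
    stepFun w G (X.chainPos n e p) =
      if p ≤ (cut w G e).val then G (X.tail e) else G (X.head e) := by
  have h2 : (cut w G e).val < n e := ZMod.val_lt _
  rw [chainPos]
  by_cases h0 : p = 0
  · rw [dif_pos h0, if_pos (by omega)]
    rfl
  rw [dif_neg h0]
  by_cases h : p < n e
  · rw [dif_pos h]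
    change (if p - 1 + 1 ≤ _ then _ else _) = _
    rw [Nat.sub_add_cancel (by omega)]
  · rw [dif_neg h, if_neg (by omega)]
    rfl

theorem stepFun_tail_sub_head (w : X.Multidegree n) (G : X.V → ℤ) (e : X.E) (k : Fin (n e)) :
    stepFun w G ((X.withChains n).tail ⟨e, k⟩) - stepFun w G ((X.withChains n).head ⟨e, k⟩) =
      if k = ⟨(cut w G e).val, ZMod.val_lt _⟩ then G (X.tail e) - G (X.head e) else 0 := by
  have := k.2
  rw [withChains_tail, withChains_head, stepFun_chainPos _ _ _ (by omega),
    stepFun_chainPos _ _ _ (by omega)]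
  have hiff : k = ⟨(cut w G e).val, ZMod.val_lt _⟩ ↔ k.val = (cut w G e).val := Fin.ext_iff
  simp only [hiff]
  split_ifs <;> omega

/-- Along the chain of an edge where `G` changes by one, the extension jumps at the node next to the
chip on the lower side, so firing it carries exactly this chip one step downwards. A chip value `0`
means that the chip is taken from the vertex itself; for an edge rising towards its head the cut is
then `-1`, the last node of the chain. -/
theorem isFiring_stepFun {w w' : X.Multidegree n} {G : X.V → ℤ}
    (hG : ∀ e, G (X.tail e) - G (X.head e) = 0 ∨ G (X.tail e) - G (X.head e) = 1 ∨
      G (X.tail e) - G (X.head e) = -1)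
    (hchip : ∀ e, w'.chip e = w.chip e + ((G (X.tail e) - G (X.head e) : ℤ) : ZMod (n e)))
    (hdeg : ∀ u, w'.deg u = w.deg u - ∑ e,
      ((if cut w G e = 0 ∧ X.tail e = u then 1 else 0) -
        (if cut w G e + 1 = 0 ∧ X.head e = u then 1 else 0)) * (G (X.tail e) - G (X.head e))) :
    IsFiring w w' (stepFun w G) := by
  rw [isFiring_iff]
  intro u
  have hsum : ∑ e, ((if (X.withChains n).tail e = u then 1 else 0) -
        (if (X.withChains n).head e = u then 1 else 0)) *
        (stepFun w G ((X.withChains n).tail e) - stepFun w G ((X.withChains n).head e)) =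
      ∑ e, ((if X.chainPos n e (cut w G e).val = u then 1 else 0) -
        (if X.chainPos n e ((cut w G e).val + 1) = u then 1 else 0)) *
        (G (X.tail e) - G (X.head e)) := by
    rw [Fintype.sum_sigma]
    refine Finset.sum_congr rfl fun e _ => ?_
    simp only [stepFun_tail_sub_head, mul_ite, mul_zero]
    rw [Finset.sum_ite_eq', if_pos (Finset.mem_univ _), withChains_tail, withChains_head]
  rw [hsum]
  rcases u with u | ⟨e₀, k⟩
  · simp only [chainPos_val_eq_inl, chainPos_val_succ_eq_inl]
    exact hdeg u
  · simp only [chainPos_val_eq_inr, chainPos_val_succ_eq_inr]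
    rw [Finset.sum_eq_single e₀]
    · simp only [true_and]
      change (if (w'.chip e₀).val = k.val + 1 then 1 else 0) =
        (if (w.chip e₀).val = k.val + 1 then 1 else 0) - _
      rw [hchip]
      rcases hG e₀ with h | h | h
      · rw [h]
        simp
      · have hcut : cut w G e₀ = w.chip e₀ := if_pos (by omega)
        rw [h, hcut]
        simp
      · have hcut : cut w G e₀ = w.chip e₀ - 1 := if_neg (by omega)
        rw [h, hcut]
        simp [sub_eq_add_neg]
    · intro e _ he
      simp [he]
    · simp

theorem pointDiv_inl (x : X.Pt) (v : X.V) :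
    ((X.withChains n).pointDiv ⟨Sum.inl x.1, x.2⟩ (Sum.inl v) : Divisor (X.comp v)) =
      X.pointDiv x v := by
  obtain ⟨u, P⟩ := x
  by_cases h : v = u
  · subst h
    rw [pointDiv, pointDiv, Pi.single_eq_same]
    exact (Pi.single_eq_same (M := fun u => Divisor (X.comp u)) v _).symm
  · rw [pointDiv, pointDiv, Pi.single_eq_of_ne h]
    exact Pi.single_eq_of_ne (M := fun u => Divisor ((X.withChains n).comp u))
      (fun h' => h (Sum.inl.inj h')) _

theorem pointDiv_of_ne {X : NodalCurve κ} {x : X.Pt} {v : X.V} (h : x.1 ≠ v) : X.pointDiv x v = 0 :=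
  Pi.single_eq_of_ne (Ne.symm h) _

theorem chainNode_false_zero (e : X.E) (h : 0 < (n e : ℕ)) :
    X.chainNode n ⟨e, ⟨0, h⟩⟩ false = ⟨Sum.inl (X.node e false).1, (X.node e false).2⟩ := by
  rw [chainNode, dif_pos rfl]

theorem chainNode_true_last (e : X.E) (k : Fin (n e)) (h : k.val + 1 = n e) :
    X.chainNode n ⟨e, k⟩ true = ⟨Sum.inl (X.node e true).1, (X.node e true).2⟩ := by
  rw [chainNode, dif_pos h]

/-- The effect of the step function on the component `v`, if it is a step down from `v`. -/
theorem sum_stepFun_boundary_inl (w : X.Multidegree n) (G : X.V → ℤ) (v : X.V) (s : Finset X.E)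
    (hs : ∀ e ∈ s, X.tail e = v ∨ X.head e = v)
    (hG : ∀ e, X.tail e = v ∨ X.head e = v →
      G (X.tail e) - G (X.head e) = if e ∈ s then X.sgn e v else 0) :
    ((∑ u, stepFun w G u • (X.withChains n).boundary u) (Sum.inl v) : Divisor (X.comp v)) =
      - ∑ e ∈ s.filter fun e => w.chip e = 0, X.pointDiv (X.branch e v) v := by
  rw [sum_zsmul_boundary, Fintype.sum_sigma]
  have hinner : ∀ e : X.E, ∑ k : Fin (n e),
      (stepFun w G ((X.withChains n).tail ⟨e, k⟩) - stepFun w G ((X.withChains n).head ⟨e, k⟩)) •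
      ((X.withChains n).pointDiv ((X.withChains n).node ⟨e, k⟩ true) -
        (X.withChains n).pointDiv ((X.withChains n).node ⟨e, k⟩ false)) =
      (G (X.tail e) - G (X.head e)) •
      ((X.withChains n).pointDiv (X.chainNode n ⟨e, ⟨(cut w G e).val, ZMod.val_lt _⟩⟩ true) -
        (X.withChains n).pointDiv
          (X.chainNode n ⟨e, ⟨(cut w G e).val, ZMod.val_lt _⟩⟩ false)) := by
    intro e
    simp only [stepFun_tail_sub_head, ite_smul, zero_smul]
    rw [Finset.sum_ite_eq', if_pos (Finset.mem_univ _)]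
  rw [Finset.sum_congr rfl fun e _ => hinner e, Finset.sum_apply, Finset.sum_filter,
    ← Finset.sum_neg_distrib]
  have hpt : ∀ (e : X.E) (k : Fin (n e)) (b : Bool),
      (X.chainNode n ⟨e, k⟩ b).1 ≠ Sum.inl v →
      (X.withChains n).pointDiv (X.chainNode n ⟨e, k⟩ b) (Sum.inl v) = 0 := fun e k b h =>
    pointDiv_of_ne h
  have htail : ∀ (e : X.E) (c : ZMod (n e)), (X.chainNode n ⟨e, ⟨c.val, ZMod.val_lt _⟩⟩ false).1 =
      X.chainPos n e c.val := fun e c => X.withChains_tail n e _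
  have hhead : ∀ (e : X.E) (c : ZMod (n e)), (X.chainNode n ⟨e, ⟨c.val, ZMod.val_lt _⟩⟩ true).1 =
      X.chainPos n e (c.val + 1) := fun e c => X.withChains_head n e _
  rw [← Finset.sum_subset (Finset.subset_univ s)]
  · refine Finset.sum_congr rfl fun e he => ?_
    rw [hG e (hs e he), if_pos he, sgn, Pi.smul_apply, Pi.sub_apply]
    by_cases ht : X.tail e = v
    · have hne : X.head e ≠ v := fun h => X.tail_ne_head e (ht.trans h.symm)
      have hcut : cut w G e = w.chip e := by
        have := hG e (hs e he)
        rw [if_pos he, sgn, if_pos ht] at this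
        rw [cut, if_pos (by omega)]
      rw [if_pos ht, one_smul, hpt _ _ true, zero_sub]
      · by_cases h0 : w.chip e = 0
        · rw [if_pos h0]
          congr 1
          have hcut0 : (cut w G e).val = 0 := by rw [hcut, h0, ZMod.val_zero]
          have : (⟨(cut w G e).val, ZMod.val_lt _⟩ : Fin (n e)) = ⟨0, (n e).pos⟩ :=
            Fin.ext (hcut0)
          rw [this, chainNode_false_zero, branch, if_pos ht]
          exact pointDiv_inl _ _
        · rw [if_neg h0]
          refine congrArg Neg.neg (hpt _ _ _ ?_)
          rw [htail, Ne, chainPos_val_eq_inl, hcut]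
          exact fun h => h0 h.1
      · rw [hhead, Ne, chainPos_val_succ_eq_inl]
        exact fun h => hne h.2
    · have hh : X.head e = v := (hs e he).resolve_left ht
      have hcut : cut w G e = w.chip e - 1 := by
        have := hG e (hs e he)
        rw [if_pos he, sgn, if_neg ht] at this
        rw [cut, if_neg (by omega)]
      rw [if_neg ht, neg_one_smul, hpt _ _ false, sub_zero]
      · by_cases h0 : w.chip e = 0
        · rw [if_pos h0]
          congr 1
          rw [chainNode_true_last, branch, if_neg ht]
          · exact pointDiv_inl _ _
          · have h1 := val_add_one (n e) (cut w G e)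
            rw [hcut, sub_add_cancel, h0, ZMod.val_zero] at h1
            by_contra hcon
            rw [hcut, h0] at hcon
            dsimp only at hcon
            rw [if_neg hcon] at h1
            omega
        · rw [if_neg h0]
          refine congrArg Neg.neg (hpt _ _ _ ?_)
          rw [hhead, Ne, chainPos_val_succ_eq_inl, hcut, sub_add_cancel]
          exact fun h => h0 h.1
      · rw [htail, Ne, chainPos_val_eq_inl]
        exact fun h => ht h.2
  · intro e _ he
    rw [Pi.smul_apply, Pi.sub_apply]
    by_cases h : X.tail e = v ∨ X.head e = v
    · rw [hG e h, if_neg he, zero_smul]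
    · push Not at h
      rw [hpt _ _ true, hpt _ _ false, sub_zero, smul_zero]
      · rw [htail, Ne, chainPos_val_eq_inl]
        exact fun h' => h.1 h'.2
      · rw [hhead, Ne, chainPos_val_succ_eq_inl]
        exact fun h' => h.2 h'.2

theorem mem_edges {v v' : X.V} {e : X.E} :
    e ∈ X.edges v v' ↔ (X.tail e = v ∧ X.head e = v') ∨ (X.tail e = v' ∧ X.head e = v) := by
  simp [edges]

theorem edges_comm (v v' : X.V) : X.edges v v' = X.edges v' v := by
  ext e
  rw [mem_edges, mem_edges]
  tauto

theorem mem_edgesAt {v : X.V} {e : X.E} : e ∈ X.edgesAt v ↔ X.tail e = v ∨ X.head e = v := by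
  simp [edgesAt]

theorem card_filter_eq_sum {ι : Type*} [Fintype ι] [DecidableEq ι] (s : Finset ι) (p : ι → Prop)
    [DecidablePred p] : ((s.filter p).card : ℤ) = ∑ i, if i ∈ s ∧ p i then 1 else 0 := by
  have : s.filter p = Finset.univ.filter fun i => i ∈ s ∧ p i := by
    ext
    simp
  rw [this, Finset.card_filter]
  push_cast
  rfl

theorem isFiring_twist (w : X.Multidegree n) (v : X.V) :
    IsFiring w (w.twist v) (stepFun w fun u => if u = v then 1 else 0) := by
  have hne := X.tail_ne_head
  apply isFiring_stepFun
  · intro e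
    have := hne e
    split_ifs with h1 h2
    · exact absurd (h1.trans h2.symm) this
    all_goals simp
  · intro e
    have := hne e
    simp only [Multidegree.twist, mem_edgesAt, sgn]
    split_ifs with h1 h2 h3 <;> simp_all
  · intro u
    simp only [Multidegree.twist, card_filter_eq_sum]
    rw [sub_add, sub_right_inj]
    have h1 : (if u = v then ∑ e, (if e ∈ X.edgesAt v ∧ w.chip e = 0 then (1 : ℤ) else 0) else 0) =
        ∑ e, if u = v ∧ e ∈ X.edgesAt v ∧ w.chip e = 0 then 1 else 0 := by
      split_ifs with h <;> simp [h]
    rw [h1, ← Finset.sum_sub_distrib]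
    refine Finset.sum_congr rfl fun e _ => ?_
    have := hne e
    simp only [mem_edges, mem_edgesAt, sgn, cut]
    by_cases ht : X.tail e = v
    · have hh : X.head e ≠ v := fun h => this (ht.trans h.symm)
      simp only [ht, hh, eq_comm (a := v) (b := u)]
      simp [and_comm]
    · by_cases hh : X.head e = v
      · simp only [ht, hh, eq_comm (a := v) (b := u)]
        simp [and_comm, sub_eq_add_neg]
      · simp [ht, hh]

end Step

end NodalCurve
end OssermanLLS

namespace OssermanLLS

/-- In a tree, an edge separates its two endpoints. -/
theorem exists_side {V : Type*} {G : SimpleGraph V} (hG : G.IsTree) {v v' : V} (h : G.Adj v v') :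
    ∃ S : Set V, v ∈ S ∧ v' ∉ S ∧ ∀ x y, G.Adj x y → s(x, y) ≠ s(v, v') → (x ∈ S ↔ y ∈ S) := by
  refine ⟨{x | (G.deleteEdges {s(v, v')}).Reachable v x}, SimpleGraph.Reachable.refl _, ?_, ?_⟩
  · have := SimpleGraph.isAcyclic_iff_forall_adj_isBridge.1 hG.isAcyclic h
    rw [SimpleGraph.isBridge_iff] at this
    exact this
  · intro x y hxy hne
    have hadj : (G.deleteEdges {s(v, v')}).Adj x y := by
      rw [SimpleGraph.deleteEdges_adj]
      exact ⟨hxy, hne⟩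
    exact ⟨fun hx => SimpleGraph.Reachable.trans hx hadj.reachable,
      fun hy => SimpleGraph.Reachable.trans hy hadj.symm.reachable⟩

namespace NodalCurve

/-! ### Partial twists, twisting divisors and tight tuples -/

section PartialTwist

variable {κ : Type u} [Field κ] {X : NodalCurve κ} {n : X.E → ℕ+}

theorem Multidegree.ext {w w' : X.Multidegree n} (hdeg : ∀ u, w.deg u = w'.deg u)
    (hchip : ∀ e, w.chip e = w'.chip e) : w = w' := by
  cases w
  cases w'
  congr
  · exact funext hdeg
  · exact funext hchip

theorem mergedGraph_adj_tail_head (e : X.E) : X.mergedGraph.Adj (X.tail e) (X.head e) :=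
  ⟨X.tail_ne_head e, e, by simp [mem_edges]⟩

theorem edges_subset (v v' : X.V) : ∀ e ∈ X.edges v v', X.tail e = v ∨ X.head e = v := by
  intro e he
  rw [mem_edges] at he
  tauto

theorem sgn_eq_neg {v v' : X.V} {e : X.E} (he : e ∈ X.edges v v') : X.sgn e v' = - X.sgn e v := by
  have := X.tail_ne_head e
  rw [mem_edges] at he
  rcases he with ⟨rfl, rfl⟩ | ⟨rfl, rfl⟩ <;> simp [sgn, this]

theorem sgn_mul_self (e : X.E) (v : X.V) : X.sgn e v * X.sgn e v = 1 := by
  rw [sgn]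
  split_ifs <;> rfl

/-- In a multitree the edge `v v'` separates the graph, so the indicator function of the side of `v`
jumps precisely at the nodes over this edge. Firing its step extension is the partial twist. The
change of the bundle on `Z_v` is one increment of the twisting divisor. -/
theorem exists_firing_partialTwist (hX : X.IsPseudocompact) {v v' : X.V}
    (hadj : X.mergedGraph.Adj v v') (w : X.Multidegree n) :
    ∃ F, IsFiring w (w.partialTwist v v') F ∧
      ((∑ u, F u • (X.withChains n).boundary u) (Sum.inl v) : Divisor (X.comp v)) =
        - ∑ e ∈ (X.edges v v').filter fun e => w.chip e = 0, X.pointDiv (X.branch e v) v := by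
  classical
  obtain ⟨S, hv, hv', hS⟩ := exists_side hX hadj
  have hvv : v ≠ v' := hadj.1
  let G : X.V → ℤ := fun u => if u ∈ S then 1 else 0
  have hG : ∀ e, G (X.tail e) - G (X.head e) = if e ∈ X.edges v v' then X.sgn e v else 0 := by
    intro e
    by_cases he : e ∈ X.edges v v'
    · rw [if_pos he]
      rw [mem_edges] at he
      rcases he with ⟨h1, h2⟩ | ⟨h1, h2⟩
      · simp [G, sgn, h1, h2, hv, hv']
      · simp [G, sgn, h1, h2, hv, hv', hvv.symm]
    · rw [if_neg he, sub_eq_zero]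
      have := hS _ _ (mergedGraph_adj_tail_head e) (fun h => he (by
        rw [mem_edges]
        simpa using h))
      simp only [G, this]
  refine ⟨stepFun w G, isFiring_stepFun ?_ ?_ ?_, ?_⟩
  · intro e
    rw [hG, sgn]
    split_ifs <;> simp
  · intro e
    rw [hG]
    simp only [Multidegree.partialTwist]
    split_ifs <;> simp
  · intro u
    simp only [Multidegree.partialTwist, card_filter_eq_sum]
    rw [sub_add, sub_right_inj]
    have h1 : (if u = v then ∑ e, (if e ∈ X.edges v v' ∧ w.chip e = 0 then (1 : ℤ) else 0) else 0) =
        ∑ e, if u = v ∧ e ∈ X.edges v v' ∧ w.chip e = 0 then 1 else 0 := by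
      split_ifs with h <;> simp [h]
    have h2 : (if u = v' then ∑ e, (if e ∈ X.edges v v' ∧
        w.chip e + (X.sgn e v : ZMod (n e)) = 0 then (1 : ℤ) else 0) else 0) =
        ∑ e, if u = v' ∧ e ∈ X.edges v v' ∧ w.chip e + (X.sgn e v : ZMod (n e)) = 0
          then 1 else 0 := by
      split_ifs with h <;> simp [h]
    rw [h1, h2, ← Finset.sum_sub_distrib]
    refine Finset.sum_congr rfl fun e _ => ?_
    by_cases he : e ∈ X.edges v v'
    · have hGe := hG e
      rw [if_pos he] at hGe
      rw [hGe]
      have he' := he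
      rw [mem_edges] at he'
      rcases he' with ⟨h1, h2⟩ | ⟨h1, h2⟩
      · have hsg : X.sgn e v = 1 := if_pos h1
        have hcut : cut w G e = w.chip e := if_pos (by omega)
        rw [hcut, hsg]
        simp [he, h1, h2, and_comm, eq_comm]
      · have hsg : X.sgn e v = -1 := if_neg fun h => hvv (h.symm.trans h1)
        have hcut : cut w G e = w.chip e - 1 := if_neg (by omega)
        rw [hcut, hsg]
        simp [he, h1, h2, and_comm, eq_comm, sub_eq_add_neg]
    · have hGe := hG e
      rw [if_neg he] at hGe
      rw [hGe]
      simp [he]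
  · exact sum_stepFun_boundary_inl w G v _ (edges_subset v v') fun e _ => hG e

/-- The edges over `v v'` on which the chip reaches `v` after twisting `k` times at `v`. -/
def stepEdges (w : X.Multidegree n) (v v' : X.V) (k : ℕ) : Finset X.E :=
  (X.edges v v').filter fun e => w.chip e + (k : ZMod (n e)) * (X.sgn e v : ZMod (n e)) = 0

theorem twistEdges_eq_stepEdges (w : X.V → X.Multidegree n) (v v' : X.V) (k : ℕ) :
    twistEdges w v v' k = stepEdges (w v) v v' k := by
  ext e
  rw [twistEdges, stepEdges, Finset.mem_filter, Finset.mem_filter, and_congr_right_iff]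
  intro _
  have : X.sgn e v = 1 ∨ X.sgn e v = -1 := by
    rw [sgn]
    split_ifs <;> simp
  rcases this with h | h <;> rw [h] <;> push_cast
  · rw [one_mul, mul_one, eq_neg_iff_add_eq_zero]
  · rw [neg_one_mul, mul_neg_one, neg_inj, add_neg_eq_zero]

theorem partialTwist_iterate_chip (w : X.Multidegree n) (v v' : X.V) (k : ℕ) (e : X.E) :
    ((Multidegree.partialTwist v v')^[k] w).chip e =
      if e ∈ X.edges v v' then w.chip e + (k : ZMod (n e)) * (X.sgn e v : ZMod (n e))
      else w.chip e := by
  induction k with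
  | zero => simp
  | succ k ih =>
    rw [Function.iterate_succ_apply']
    simp only [Multidegree.partialTwist]
    rw [ih]
    split_ifs
    · push_cast
      ring
    · rfl

theorem partialTwist_iterate_deg (w : X.Multidegree n) {v v' u : X.V} (k : ℕ) (h : u ≠ v)
    (h' : u ≠ v') : ((Multidegree.partialTwist v v')^[k] w).deg u = w.deg u := by
  induction k with
  | zero => rfl
  | succ k ih =>
    rw [Function.iterate_succ_apply']
    simp only [Multidegree.partialTwist]
    rw [if_neg h, if_neg h', ih]
    ring

/-- The divisor removed from `Z_v` when twisting `j` times at `v` along the edge `v v'`. -/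
noncomputable def stepDiv (w : X.Multidegree n) (v v' : X.V) (j : ℕ) : Divisor (X.comp v) :=
  ∑ k ∈ Finset.range j, ∑ e ∈ stepEdges w v v' k, X.pointDiv (X.branch e v) v

theorem twistSeq_eq_stepDiv (w : X.V → X.Multidegree n) (v v' : X.V) (j : ℕ) :
    twistSeq w v v' j = stepDiv (w v) v v' j := by
  rw [twistSeq, twistDiv, stepDiv, Finset.sum_apply]
  refine Finset.sum_congr rfl fun k _ => ?_
  rw [Finset.sum_apply, twistEdges_eq_stepEdges]

theorem exists_firing_iterate (hX : X.IsPseudocompact) {v v' : X.V}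
    (hadj : X.mergedGraph.Adj v v') (w : X.Multidegree n) (j : ℕ) :
    ∃ F, IsFiring w ((Multidegree.partialTwist v v')^[j] w) F ∧
      ((∑ u, F u • (X.withChains n).boundary u) (Sum.inl v) : Divisor (X.comp v)) =
        - stepDiv w v v' j := by
  induction j with
  | zero =>
    refine ⟨0, .refl w, ?_⟩
    simp only [Pi.zero_apply, zero_smul, Finset.sum_const_zero, stepDiv, Finset.range_zero,
      Finset.sum_empty]
    exact neg_zero.symm
  | succ j ih =>
    obtain ⟨F, hF, hF'⟩ := ih
    obtain ⟨F₁, hF₁, hF₁'⟩ := exists_firing_partialTwist hX hadj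
      ((Multidegree.partialTwist v v')^[j] w)
    refine ⟨F + F₁, ?_, ?_⟩
    · rw [Function.iterate_succ_apply']
      exact hF.trans hF₁
    · have hst : ((X.edges v v').filter fun e =>
          ((Multidegree.partialTwist v v')^[j] w).chip e = 0) = stepEdges w v v' j := by
        rw [stepEdges]
        refine Finset.filter_congr fun e he => ?_
        rw [partialTwist_iterate_chip, if_pos he]
      rw [hst] at hF₁'
      simp only [Pi.add_apply, add_smul, Finset.sum_add_distrib]
      rw [stepDiv, Finset.sum_range_succ, neg_add]
      exact congrArg₂ (· + ·) hF' hF₁'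

theorem IsFiring.toDiv_eq {w w' : X.Multidegree n} {F : (X.withChains n).V → ℤ}
    (h : IsFiring w w' F) (u : (X.withChains n).V) :
    w'.toDiv u = w.toDiv u + ((∑ u, F u • (X.withChains n).boundary u) u).degree := by
  rw [isFiring_iff.1 h u, degree_sum_zsmul_boundary]
  rfl

theorem branch_fst {v v' : X.V} {e : X.E} (he : e ∈ X.edges v v') : (X.branch e v).1 = v := by
  rw [branch]
  split_ifs with h
  · exact h
  · exact (edges_subset v v' e he).resolve_left h

theorem degree_stepDiv (w : X.Multidegree n) (v v' : X.V) (j : ℕ) :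
    (stepDiv w v v' j).degree = ∑ k ∈ Finset.range j, ((stepEdges w v v' k).card : ℤ) := by
  rw [stepDiv, Divisor.degree_sum]
  refine Finset.sum_congr rfl fun k _ => ?_
  rw [Divisor.degree_sum, Finset.card_eq_sum_ones]
  push_cast
  refine Finset.sum_congr rfl fun e he => ?_
  rw [degree_pointDiv, if_pos (branch_fst (Finset.mem_filter.1 he).1)]

theorem partialTwist_iterate_deg_self (hX : X.IsPseudocompact) {v v' : X.V}
    (hadj : X.mergedGraph.Adj v v') (w : X.Multidegree n) (j : ℕ) :
    ((Multidegree.partialTwist v v')^[j] w).deg v = w.deg v - (stepDiv w v v' j).degree := by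
  obtain ⟨F, hF, hF'⟩ := exists_firing_iterate hX hadj w j
  have h1 := hF.toDiv_eq (Sum.inl v)
  have h2 : ((∑ u, F u • (X.withChains n).boundary u) (Sum.inl v)).degree =
      - (stepDiv w v v' j).degree := by
    rw [← Divisor.degreeHom_apply (stepDiv w v v' j), ← map_neg, ← hF']
    rfl
  rw [h2] at h1
  exact h1

theorem total_partialTwist_iterate (hX : X.IsPseudocompact) {v v' : X.V}
    (hadj : X.mergedGraph.Adj v v') (w : X.Multidegree n) (j : ℕ) :
    ((Multidegree.partialTwist v v')^[j] w).total = w.total := by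
  obtain ⟨F, hF, -⟩ := exists_firing_iterate hX hadj w j
  exact hF.total_eq

theorem partialTwist_deg (w : X.Multidegree n) (v v' u : X.V) :
    (w.partialTwist v v').deg u = w.deg u
    - (if u = v then (((X.edges v v').filter fun e => w.chip e = 0).card : ℤ) else 0)
    + (if u = v' then
        (((X.edges v v').filter fun e => w.chip e + (X.sgn e v : ZMod (n e)) = 0).card : ℤ)
        else 0) := rfl

theorem partialTwist_chip (w : X.Multidegree n) (v v' : X.V) (e : X.E) :
    (w.partialTwist v v').chip e =
      if e ∈ X.edges v v' then w.chip e + (X.sgn e v : ZMod (n e)) else w.chip e := rfl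

/-- The signs of an edge at its two ends are opposite, so twisting at the other end moves the same
chips back. -/
theorem partialTwist_leftInverse (v v' : X.V) :
    Function.LeftInverse (Multidegree.partialTwist v' v : X.Multidegree n → _)
      (Multidegree.partialTwist v v') := by
  intro w
  have hchip : ∀ e ∈ X.edges v v', w.chip e + (X.sgn e v : ZMod (n e)) +
      (X.sgn e v' : ZMod (n e)) = w.chip e := by
    intro e he
    rw [sgn_eq_neg he]
    push_cast
    ring
  apply Multidegree.ext
  · intro u
    rw [partialTwist_deg, partialTwist_deg, edges_comm v' v]
    have h1 : ((X.edges v v').filter fun e => (w.partialTwist v v').chip e = 0) =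
        (X.edges v v').filter fun e => w.chip e + (X.sgn e v : ZMod (n e)) = 0 :=
      Finset.filter_congr fun e he => by rw [partialTwist_chip, if_pos he]
    have h2 : ((X.edges v v').filter fun e => (w.partialTwist v v').chip e + (X.sgn e v' : ZMod (n e)) = 0) =
        (X.edges v v').filter fun e => w.chip e = 0 :=
      Finset.filter_congr fun e he => by rw [partialTwist_chip, if_pos he, hchip e he]
    rw [h1, h2]
    ring
  · intro e
    simp only [Multidegree.partialTwist]
    rw [edges_comm v' v]
    split_ifs with he
    · exact hchip e he
    · rfl

theorem reachable_firing {w₀ w : X.Multidegree n} (h : Multidegree.Reachable w₀ w) :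
    ∃ F, IsFiring w₀ w F := by
  obtain ⟨l, rfl⟩ := h
  induction l generalizing w₀ with
  | nil => exact ⟨0, .refl _⟩
  | cons v l ih =>
    obtain ⟨F, hF⟩ := ih (w₀ := w₀.twist v)
    exact ⟨_, (isFiring_twist w₀ v).trans hF⟩

theorem exists_mem_stepEdges {v v' : X.V} {e : X.E} (he : e ∈ X.edges v v')
    (w : X.Multidegree n) : ∃ k < (n e : ℕ), e ∈ stepEdges w v v' k := by
  -- This solves `chip + k * sgn = 0`, because `sgn` squares to one.
  refine ⟨(-((X.sgn e v : ZMod (n e)) * w.chip e)).val, ZMod.val_lt _, ?_⟩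
  rw [stepEdges, Finset.mem_filter, ZMod.natCast_val, ZMod.cast_id]
  refine ⟨he, ?_⟩
  have : (X.sgn e v : ZMod (n e)) * (X.sgn e v : ZMod (n e)) = 1 := by
    exact_mod_cast congrArg (Int.cast : ℤ → ZMod (n e)) (sgn_mul_self e v)
  linear_combination (- w.chip e) * this

variable {w : X.V → X.Multidegree n} {b : X.V → X.V → ℕ}

theorem IsTight.eq_iterate (ht : IsTight w b) {v v' : X.V} (hadj : X.mergedGraph.Adj v v') :
    w v = (Multidegree.partialTwist v' v)^[b v v'] (w v') :=
  ht.2 v v' hadj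

theorem IsTight.eq_iterate' (ht : IsTight w b) {v v' : X.V} (hadj : X.mergedGraph.Adj v v') :
    w v' = (Multidegree.partialTwist v v')^[b v v'] (w v) := by
  rw [ht.eq_iterate hadj, (partialTwist_leftInverse _ _).iterate]

/-- A positive number of partial twists at `v` never restores a multidegree, since repeating them
strictly lowers the degree at `v`. So the number of twists leading from `w v` to `w v'` is unique.
-/
theorem IsTight.symm (ht : IsTight w b) (hX : X.IsPseudocompact) {v v' : X.V}
    (hadj : X.mergedGraph.Adj v v') : b v v' = b v' v := by
  have key : ∀ {v v' : X.V}, X.mergedGraph.Adj v v' → ∀ (u : X.Multidegree n) (d : ℕ),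
      (Multidegree.partialTwist v v')^[d] u = u → d = 0 := by
    intro v v' hadj u d hd
    by_contra hd0
    obtain ⟨e, he⟩ := hadj.2
    obtain ⟨k, hk, hek⟩ := exists_mem_stepEdges he u
    -- After `d * n e` steps, at least a full period of `e`, the chip of `e` has certainly passed
    -- through `v`.
    have h1 : (Multidegree.partialTwist v v')^[d * n e] u = u := by
      rw [Function.iterate_mul]
      exact Function.iterate_fixed hd _
    have h2 := partialTwist_iterate_deg_self hX hadj u (d * n e)
    rw [h1, degree_stepDiv, eq_comm, sub_eq_self] at h2
    have h3 := (Finset.sum_eq_zero_iff_of_nonneg fun k _ => Int.natCast_nonneg _).1 h2 k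
      (Finset.mem_range.2 (hk.trans_le (Nat.le_mul_of_pos_left _ (Nat.pos_of_ne_zero hd0))))
    rw [Nat.cast_eq_zero, Finset.card_eq_zero] at h3
    rw [h3] at hek
    simp at hek
  have key2 : ∀ {v v' : X.V}, X.mergedGraph.Adj v v' → b v' v ≤ b v v' := by
    intro v v' hadj
    have h1 := ht.eq_iterate' hadj
    have h2 := ht.eq_iterate hadj.symm
    by_contra hlt
    have h3 : b v' v = (b v' v - b v v') + b v v' := by omega
    rw [h3, Function.iterate_add_apply, ← h1] at h2
    have := key hadj _ _ h2.symm
    omega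
  exact le_antisymm (key2 hadj.symm) (key2 hadj)

/-- The multidegrees between `w v` and `w v'` can be reached from either end; index `j` seen from
`v` is index `b - j` seen from `v'`. -/
theorem IsTight.iterate_eq (ht : IsTight w b) {v v' : X.V}
    (hadj : X.mergedGraph.Adj v v') {j : ℕ} (hj : j ≤ b v v') :
    (Multidegree.partialTwist v' v)^[b v v' - j] (w v') =
      (Multidegree.partialTwist v v')^[j] (w v) := by
  have h := Function.iterate_add_apply (Multidegree.partialTwist v v') (b v v' - j) j (w v)
  rw [Nat.sub_add_cancel hj] at h
  rw [ht.eq_iterate' hadj, h, (partialTwist_leftInverse _ _).iterate]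

theorem IsTight.twistEdges_eq (ht : IsTight w b) {v v' : X.V}
    (hadj : X.mergedGraph.Adj v v') {j : ℕ} (hj : j ≤ b v v') :
    twistEdges w v' v (b v v' - j) = twistEdges w v v' j := by
  rw [twistEdges_eq_stepEdges, twistEdges_eq_stepEdges, stepEdges, stepEdges, edges_comm v' v]
  refine Finset.filter_congr fun e he => ?_
  rw [ht.eq_iterate' hadj, partialTwist_iterate_chip, if_pos he, sgn_eq_neg he, Nat.cast_sub hj]
  push_cast
  ring_nf

end PartialTwist

end NodalCurve
end OssermanLLS

namespace OssermanLLS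

/-! ### Linear algebra of filtrations and adapted bases -/

section Filtration

variable {κ M : Type*} [Field κ] [AddCommGroup M] [Module κ M]

theorem finrank_map_mkQ {F F' : Submodule κ M} (hle : F' ≤ F) [FiniteDimensional κ F] :
    Module.finrank κ (F.map F'.mkQ) + Module.finrank κ F' = Module.finrank κ F := by
  have h := (F'.mkQ.domRestrict F).finrank_range_add_finrank_ker
  rw [LinearMap.range_domRestrict, LinearMap.ker_domRestrict, Submodule.ker_mkQ] at h
  rw [← h]
  congr 1
  exact (Submodule.submoduleOfEquivOfLe hle).finrank_eq.symm

/-- A family of vectors in `F` which is independent modulo `F'` extends to a larger index set. -/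
theorem exists_extension {ι : Type*} {F F' : Submodule κ M} (hle : F' ≤ F) [FiniteDimensional κ F]
    {N G : Finset ι} (hGN : G ⊆ N) (hN : N.card + Module.finrank κ F' = Module.finrank κ F)
    (y : ι → M) (hy : ∀ l ∈ G, y l ∈ F) (hli : LinearIndepOn κ (fun l => F'.mkQ (y l)) (G : Set ι)) :
    ∃ z : ι → M, (∀ l ∈ G, z l = y l) ∧ (∀ l ∈ N, z l ∈ F) ∧
      LinearIndepOn κ (fun l => F'.mkQ (z l)) (N : Set ι) := by
  classical
  induction h : (N \ G).card generalizing G y with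
  | zero =>
    have : N = G := by
      rw [Finset.card_eq_zero, Finset.sdiff_eq_empty_iff_subset] at h
      exact Finset.Subset.antisymm h hGN
    subst this
    exact ⟨y, fun _ _ => rfl, hy, hli⟩
  | succ m ih =>
    obtain ⟨l₀, hl₀⟩ := Finset.card_pos.1 (by omega : 0 < (N \ G).card)
    rw [Finset.mem_sdiff] at hl₀
    have hcard : G.card < N.card := Finset.card_lt_card
      ⟨hGN, fun h => hl₀.2 (h hl₀.1)⟩
    obtain ⟨v, hv, hv'⟩ : ∃ v ∈ F, F'.mkQ v ∉
        Submodule.span κ ((fun l => F'.mkQ (y l)) '' (G : Set ι)) := by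
      by_contra! hcon
      have hsub : F.map F'.mkQ ≤ Submodule.span κ ((fun l => F'.mkQ (y l)) '' (G : Set ι)) := by
        rintro _ ⟨v, hv, rfl⟩
        exact hcon v hv
      have hfin : FiniteDimensional κ
          (Submodule.span κ ((fun l => F'.mkQ (y l)) '' (G : Set ι))) :=
        FiniteDimensional.span_of_finite κ (G.finite_toSet.image _)
      have h1 := Submodule.finrank_mono hsub
      have h2 : Module.finrank κ (Submodule.span κ ((fun l => F'.mkQ (y l)) '' (G : Set ι))) ≤
          G.card := by
        rw [← Finset.coe_image]
        exact (finrank_span_finset_le_card _).trans Finset.card_image_le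
      have h3 := finrank_map_mkQ hle
      omega
    let y' := Function.update y l₀ v
    have hyy : ∀ l ∈ G, y' l = y l := fun l hl =>
      Function.update_of_ne (by rintro rfl; exact hl₀.2 hl) _ _
    have hy₀ : y' l₀ = v := Function.update_self _ _ _
    obtain ⟨z, hz1, hz2, hz3⟩ := ih (G := insert l₀ G) (Finset.insert_subset hl₀.1 hGN) y' (by
        intro l hl
        rcases Finset.mem_insert.1 hl with rfl | hl
        · rwa [hy₀]
        · rw [hyy l hl]
          exact hy l hl) (by
        rw [Finset.coe_insert]
        have hEq : Set.EqOn (fun l => F'.mkQ (y l)) (fun l => F'.mkQ (y' l)) (G : Set ι) :=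
          fun l hl => by simp only [hyy l hl]
        refine LinearIndepOn.insert (hli.congr hEq) ?_
        rw [← Set.image_congr hEq, hy₀]
        exact hv') (by
        rw [Finset.sdiff_insert, Finset.card_erase_of_mem (Finset.mem_sdiff.2 hl₀)]
        omega)
    exact ⟨z, fun l hl => by rw [hz1 l (Finset.mem_insert_of_mem hl), hyy l hl], hz2, hz3⟩

variable {ι : Type*} [Fintype ι] {F : ℕ → Submodule κ M} {i : ι → ℕ}

/-- A family adapted to a filtration is independent. -/
theorem linearIndependent_of_adapted (hF : Antitone F) {s : ι → M} (hs : ∀ l, s l ∈ F (i l))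
    (hli : ∀ k, LinearIndepOn κ (fun l => (F (k + 1)).mkQ (s l))
      ((Finset.univ.filter fun l => i l = k : Finset ι) : Set ι)) : LinearIndependent κ s := by
  -- Coefficients are shown to vanish by increasing index: once those below `k` are gone, the
  -- relation can be read modulo `F (k + 1)`.
  rw [Fintype.linearIndependent_iff]
  intro c hc
  have key : ∀ k, ∀ l, i l = k → c l = 0 := by
    intro k
    induction k using Nat.strong_induction_on with
    | _ k ih =>
      intro l hl
      refine linearIndepOn_finset_iff.1 (hli k) c ?_ l (by simpa using hl)
      rw [← Finset.sum_filter_add_sum_filter_not Finset.univ (fun l => i l = k)] at hc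
      have h1 : ∑ l ∈ Finset.univ.filter fun l => ¬ i l = k, c l • s l ∈ F (k + 1) := by
        refine Submodule.sum_mem _ fun l hl => ?_
        rcases lt_or_gt_of_ne (Finset.mem_filter.1 hl).2 with h | h
        · rw [ih _ h l rfl, zero_smul]
          exact Submodule.zero_mem _
        · exact Submodule.smul_mem _ _ (hF h (hs l))
      have h2 : ∑ l ∈ Finset.univ.filter fun l => i l = k, c l • s l ∈ F (k + 1) := by
        rw [eq_neg_of_add_eq_zero_left hc]
        exact Submodule.neg_mem _ h1
      have h3 := (Submodule.Quotient.mk_eq_zero _).2 h2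
      rw [← Submodule.mkQ_apply, map_sum] at h3
      simpa using h3
  exact fun l => key _ l rfl

/-- A partial family which is independent in the graded pieces extends to an adapted family. -/
theorem exists_adapted (hF : Antitone F) [FiniteDimensional κ (F 0)]
    (hcard : ∀ k, (Finset.univ.filter fun l => i l = k).card + Module.finrank κ (F (k + 1)) =
      Module.finrank κ (F k)) (G : Finset ι) (y : ι → M) (hy : ∀ l ∈ G, y l ∈ F (i l))
    (hli : ∀ k, LinearIndepOn κ (fun l => (F (k + 1)).mkQ (y l))
      ((G.filter fun l => i l = k : Finset ι) : Set ι)) :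
    ∃ s : ι → M, (∀ l ∈ G, s l = y l) ∧ (∀ l, s l ∈ F (i l)) ∧
      (∀ l, s l ∉ F (i l + 1)) ∧ LinearIndependent κ s := by
  have hfd : ∀ k, FiniteDimensional κ (F k) := fun k =>
    Submodule.finiteDimensional_of_le (hF (Nat.zero_le k))
  have hex : ∀ k, ∃ z : ι → M, (∀ l ∈ G.filter fun l => i l = k, z l = y l) ∧
      (∀ l ∈ Finset.univ.filter fun l => i l = k, z l ∈ F k) ∧
      LinearIndepOn κ (fun l => (F (k + 1)).mkQ (z l))
        ((Finset.univ.filter fun l => i l = k : Finset ι) : Set ι) := by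
    intro k
    refine exists_extension (hF (Nat.le_succ k)) (Finset.filter_subset_filter _ (Finset.subset_univ G))
      (hcard k) y ?_ (hli k)
    intro l hl
    obtain ⟨h1, rfl⟩ := Finset.mem_filter.1 hl
    exact hy l h1
  choose z hz1 hz2 hz3 using hex
  have hs : ∀ l, z (i l) l ∈ F (i l) := fun l => hz2 (i l) l (by simp)
  have hli' : ∀ k, LinearIndepOn κ (fun l => (F (k + 1)).mkQ (z (i l) l))
      ((Finset.univ.filter fun l => i l = k : Finset ι) : Set ι) := by
    intro k
    refine (hz3 k).congr fun l hl => ?_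
    have : i l = k := by simpa using hl
    simp only [this]
  refine ⟨fun l => z (i l) l, fun l hl => hz1 _ l (by simp [hl]), hs, fun l hl => ?_,
    linearIndependent_of_adapted hF hs hli'⟩
  have := (hli' (i l)).ne_zero (i := l) (by simp)
  exact this ((Submodule.Quotient.mk_eq_zero _).2 hl)

/-- Descending induction from the place where the filtration becomes zero; there can be no index
beyond it. -/
theorem card_filter_le_eq_finrank (hF : Antitone F) {N : ℕ} (hN : F N = ⊥)
    (hcard : ∀ k, (Finset.univ.filter fun l => i l = k).card + Module.finrank κ (F (k + 1)) =
      Module.finrank κ (F k)) (k : ℕ) :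
    (Finset.univ.filter fun l => k ≤ i l).card = Module.finrank κ (F k) := by
  have hbot : ∀ k, N ≤ k → F k = ⊥ := fun k hk => le_bot_iff.1 ((hF hk).trans hN.le)
  have hlt : ∀ l, i l < N := by
    intro l
    by_contra hcon
    have h1 := hcard (i l)
    rw [hbot (i l) (by omega), hbot (i l + 1) (by omega), finrank_bot, add_zero,
      Finset.card_eq_zero] at h1
    have : l ∈ Finset.univ.filter fun l' => i l' = i l := by simp
    rw [h1] at this
    simp at this
  have key : ∀ m k, N ≤ k + m →
      (Finset.univ.filter fun l => k ≤ i l).card = Module.finrank κ (F k) := by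
    intro m
    induction m with
    | zero =>
      intro k hk
      rw [hbot k hk, finrank_bot, Finset.card_eq_zero, Finset.filter_eq_empty_iff]
      intro l _
      have := hlt l
      omega
    | succ m ih =>
      intro k hk
      classical
      rw [← hcard k, ← ih (k + 1) (by omega), ← Finset.card_union_of_disjoint]
      · congr 1
        ext l
        simp only [Finset.mem_filter, Finset.mem_univ, true_and, Finset.mem_union]
        omega
      · rw [Finset.disjoint_filter]
        intro l _ h
        omega
  exact key N k (by omega)

/-- Conversely, a basis with prescribed orders is independent in the graded pieces. -/
theorem linearIndepOn_graded (hF : Antitone F) [FiniteDimensional κ (F 0)] {N : ℕ} (hN : F N = ⊥)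
    (hcard : ∀ k, (Finset.univ.filter fun l => i l = k).card + Module.finrank κ (F (k + 1)) =
      Module.finrank κ (F k)) {s : ι → M} (hli : LinearIndependent κ s) (hs : ∀ l, s l ∈ F (i l))
    (k : ℕ) : LinearIndepOn κ (fun l => (F (k + 1)).mkQ (s l)) {l | i l = k} := by
  have hfd : ∀ k, FiniteDimensional κ (F k) := fun k =>
    Submodule.finiteDimensional_of_le (hF (Nat.zero_le k))
  -- By the count of dimensions, the basis vectors of index above `k` span all of `F (k + 1)`, so
  -- those of index `k` remain independent modulo it.
  have hspan : Submodule.span κ (s '' {l | k + 1 ≤ i l}) = F (k + 1) := by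
    refine Submodule.eq_of_le_of_finrank_eq ?_ ?_
    · rw [Submodule.span_le]
      rintro _ ⟨l, hl, rfl⟩
      exact hF hl (hs l)
    · rw [← card_filter_le_eq_finrank hF hN hcard (k + 1)]
      have h1 : LinearIndependent κ fun l : {l // k + 1 ≤ i l} => s l :=
        hli.comp _ Subtype.val_injective
      have h2 := finrank_span_eq_card h1
      rw [Fintype.card_subtype] at h2
      rw [← h2, Set.image_eq_range]
      rfl
  have h0 : LinearIndependent κ fun l : {l | i l = k} => s l := hli.comp _ Subtype.val_injective
  refine h0.map (f := (F (k + 1)).mkQ) ?_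
  rw [Submodule.ker_mkQ, ← hspan, ← Set.image_eq_range]
  apply hli.disjoint_span_image
  rw [Set.disjoint_left]
  intro l hl hl'
  have h1 : i l = k := hl
  have h2 : k + 1 ≤ i l := hl'
  omega

end Filtration
end OssermanLLS

namespace OssermanLLS

/-! ### Multivanishing sequences through indices of the filtration -/

section OrderIndex

/-- The index function of an antitone sequence of subspaces. -/
theorem exists_index {κ M : Type*} [Field κ] [AddCommGroup M] [Module κ M]
    {F : ℕ → Submodule κ M} (hF : Antitone F) [FiniteDimensional κ (F 0)] {N : ℕ} (hN : F N = ⊥)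
    {r : ℕ} (hr : Module.finrank κ (F 0) = r + 1) :
    ∃ i : Fin (r + 1) → ℕ, Monotone i ∧
      ∀ k, (Finset.univ.filter fun l => i l = k).card + Module.finrank κ (F (k + 1)) =
        Module.finrank κ (F k) := by
  have hfd : ∀ k, FiniteDimensional κ (F k) := fun k =>
    Submodule.finiteDimensional_of_le (hF (Nat.zero_le k))
  have hanti : ∀ {k m}, k ≤ m → Module.finrank κ (F m) ≤ Module.finrank κ (F k) := fun h =>
    Submodule.finrank_mono (hF h)
  -- The position `l` has index at least `k` exactly if it is among the last `dim F k` of the `r +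
  -- 1` positions.
  let P : Fin (r + 1) → ℕ → Prop := fun l k => r + 1 ≤ Module.finrank κ (F k) + l
  have hdec : ∀ l, DecidablePred (P l) := fun l => Classical.decPred _
  let i : Fin (r + 1) → ℕ := fun l => Nat.findGreatest (P l) N
  have hP0 : ∀ l, P l 0 := fun l => by simp only [P]; omega
  have hi : ∀ l k, k ≤ i l ↔ P l k := by
    intro l k
    constructor
    · intro h
      have h1 : P l (i l) := Nat.findGreatest_spec (Nat.zero_le N) (hP0 l)
      have h2 := hanti h
      simp only [P] at h1 ⊢
      omega
    · intro h
      refine Nat.le_findGreatest ?_ h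
      by_contra hcon
      have h1 := hanti (not_le.1 hcon).le
      rw [hN, finrank_bot] at h1
      simp only [P] at h
      have := l.isLt
      omega
  have hcard : ∀ k, (Finset.univ.filter fun l => k ≤ i l).card = Module.finrank κ (F k) := by
    intro k
    have h1 := hanti (Nat.zero_le k)
    have h2 : (Finset.univ.filter fun l : Fin (r + 1) => ¬ k ≤ i l) =
        Finset.univ.filter fun l : Fin (r + 1) => l.val < r + 1 - Module.finrank κ (F k) := by
      ext l
      simp only [Finset.mem_filter, Finset.mem_univ, true_and, hi, P]
      omega
    have h3 := Finset.card_filter_add_card_filter_not (s := (Finset.univ : Finset (Fin (r + 1))))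
      (fun l => k ≤ i l)
    rw [h2, Fin.card_filter_val_lt, Finset.card_univ, Fintype.card_fin] at h3
    omega
  refine ⟨i, fun l l' hll => ?_, fun k => ?_⟩
  · rw [hi]
    have h1 := (hi l (i l)).1 le_rfl
    have h2 : l.val ≤ l'.val := hll
    simp only [P] at h1 ⊢
    omega
  · rw [← hcard k, ← hcard (k + 1), ← Finset.card_union_of_disjoint]
    · congr 1
      ext l
      simp only [Finset.mem_filter, Finset.mem_univ, true_and, Finset.mem_union]
      omega
    · rw [Finset.disjoint_filter]
      intro l _ h
      omega

variable {κ : Type u} [Field κ] {C : Curve κ}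

/-- An increasing sequence of divisors, starting at `0`, of unbounded degree. -/
structure IsExhausting (D : ℕ → Divisor C) : Prop where
  zero : D 0 = 0
  mono : Monotone D
  unbounded : ∀ m : ℤ, ∃ N, m < (D N).degree

theorem IsExhausting.degree_lt {D : ℕ → Divisor C} (hD : IsExhausting D) {i k : ℕ}
    (hi : IsCritical D i) (hk : i < k) : (D i).degree < (D k).degree := by
  have h1 := Divisor.degree_mono (hD.mono (Nat.succ_le_of_lt hk))
  refine lt_of_lt_of_le ?_ h1
  refine lt_of_le_of_ne (Divisor.degree_mono (hD.mono (Nat.le_succ i))) fun h => hi ?_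
  have h2 : (D (i + 1) - D i).degree = 0 := by
    rw [Divisor.degree_sub, ← Nat.succ_eq_add_one, h, sub_self]
  exact sub_eq_zero.1
    (Divisor.eq_zero_of_degree (sub_nonneg.2 (hD.mono (Nat.le_succ i))) h2)

theorem IsExhausting.le_of_degree_le {D : ℕ → Divisor C} (hD : IsExhausting D) {i k : ℕ}
    (hi : IsCritical D i) (h : (D k).degree ≤ (D i).degree) : k ≤ i := by
  by_contra hcon
  exact absurd (hD.degree_lt hi (not_le.1 hcon)) (not_lt.2 h)

theorem IsExhausting.degree_inj {D : ℕ → Divisor C} (hD : IsExhausting D) {i k : ℕ}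
    (hi : IsCritical D i) (hk : IsCritical D k) : (D i).degree = (D k).degree ↔ i = k :=
  ⟨fun h => le_antisymm (hD.le_of_degree_le hk h.le) (hD.le_of_degree_le hi h.ge),
    fun h => by rw [h]⟩

theorem vanishing_antitone (U : Submodule κ C.K) (A : Divisor C) {D : ℕ → Divisor C}
    (hD : Monotone D) : Antitone fun k => vanishing U A (D k) := fun _ _ h =>
  inf_le_inf_left _ (H0_mono (sub_le_sub_left (hD h) A))

theorem IsExhausting.vanishing_zero {D : ℕ → Divisor C} (hD : IsExhausting D)
    {U : Submodule κ C.K} {A : Divisor C} (hU : U ≤ H0 A) : vanishing U A (D 0) = U := by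
  rw [vanishing, hD.zero, sub_zero]
  exact inf_eq_left.2 hU

theorem IsExhausting.exists_vanishing_eq_bot [IsAlgClosed κ] {D : ℕ → Divisor C}
    (hD : IsExhausting D) (U : Submodule κ C.K) (A : Divisor C) :
    ∃ N, vanishing U A (D N) = ⊥ := by
  obtain ⟨N, hN⟩ := hD.unbounded A.degree
  refine ⟨N, (Submodule.eq_bot_iff _).2 fun f hf => ?_⟩
  by_contra hf0
  have := degree_nonneg_of_mem_H0 hf0 hf.2
  rw [Divisor.degree_sub] at this
  omega

/-- `i` lists the critical indices, repeated according to the dimensions of the graded pieces of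
the filtration of `U` by the order of vanishing along `D`. -/
structure IsOrderIndex {r : ℕ} (U : Submodule κ C.K) (A : Divisor C) (D : ℕ → Divisor C)
    (i : Fin (r + 1) → ℕ) : Prop where
  mono : Monotone i
  card : ∀ k, (Finset.univ.filter fun l => i l = k).card +
    Module.finrank κ (vanishing U A (D (k + 1))) = Module.finrank κ (vanishing U A (D k))

variable {r : ℕ} {U : Submodule κ C.K} {A : Divisor C} {D : ℕ → Divisor C}

theorem IsOrderIndex.isCritical {i : Fin (r + 1) → ℕ} (hi : IsOrderIndex U A D i)
    (l : Fin (r + 1)) : IsCritical D (i l) := by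
  intro h
  have h1 := hi.card (i l)
  rw [h] at h1
  have h2 : 0 < (Finset.univ.filter fun l' => i l' = i l).card := Finset.card_pos.2 ⟨l, by simp⟩
  omega

theorem IsOrderIndex.isMultivanishing {i : Fin (r + 1) → ℕ} (hi : IsOrderIndex U A D i)
    (hD : IsExhausting D) : IsMultivanishing U A D fun l => (D (i l)).degree := by
  refine ⟨fun l l' h => Divisor.degree_mono (hD.mono (hi.mono h)),
    fun l => ⟨i l, hi.isCritical l, rfl⟩, fun k hk => ?_⟩
  have h1 : (Finset.univ.filter fun l => (D (i l)).degree = (D k).degree) =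
      Finset.univ.filter fun l => i l = k := by
    ext l
    simp only [Finset.mem_filter, Finset.mem_univ, true_and]
    exact hD.degree_inj (hi.isCritical l) hk
  have h2 := hi.card k
  rw [h1]
  omega

theorem IsMultivanishing.exists_isOrderIndex {a : Fin (r + 1) → ℤ}
    (ha : IsMultivanishing U A D a) (hD : IsExhausting D) :
    ∃ i : Fin (r + 1) → ℕ, IsOrderIndex U A D i ∧ a = fun l => (D (i l)).degree := by
  obtain ⟨h1, h2, h3⟩ := ha
  choose i hi hai using h2
  refine ⟨i, ⟨fun l l' h => ?_, fun k => ?_⟩, funext hai⟩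
  · apply hD.le_of_degree_le (hi l')
    rw [← hai, ← hai]
    exact h1 h
  · by_cases hk : IsCritical D k
    · have h4 := h3 k hk
      have h5 : (Finset.univ.filter fun l => a l = (D k).degree) =
          Finset.univ.filter fun l => i l = k := by
        ext l
        simp only [Finset.mem_filter, Finset.mem_univ, true_and, hai]
        exact hD.degree_inj (hi l) hk
      rw [h5] at h4
      omega
    · have h4 : (Finset.univ.filter fun l => i l = k) = ∅ := by
        rw [Finset.filter_eq_empty_iff]
        rintro l - rfl
        exact hk (hi l)
      have h5 : D (k + 1) = D k := not_not.1 hk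
      rw [h4, h5, Finset.card_empty, zero_add]

/-- On critical indices the degree of `D` is injective, so the multivanishing sequence chosen in the
definition determines indices, which satisfy the dimension formula at noncritical places as well. -/
theorem exists_isOrderIndex [IsAlgClosed κ] (hD : IsExhausting D) (hU : U ≤ H0 A)
    (hr : Module.finrank κ U = r + 1) :
    ∃ i : Fin (r + 1) → ℕ, IsOrderIndex U A D i ∧
      multivanishing r U A D = fun l => (D (i l)).degree := by
  obtain ⟨N, hN⟩ := hD.exists_vanishing_eq_bot U A
  have h0 := hD.vanishing_zero hU
  have hfd : FiniteDimensional κ (vanishing U A (D 0)) := by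
    rw [h0]
    exact Module.finite_of_finrank_pos (by omega)
  obtain ⟨i, hi, hi'⟩ := exists_index (F := fun k => vanishing U A (D k))
    (vanishing_antitone U A hD.mono) hN (r := r) (by rw [h0, hr])
  have hex : ∃ a : Fin (r + 1) → ℤ, IsMultivanishing U A D a :=
    ⟨_, IsOrderIndex.isMultivanishing ⟨hi, hi'⟩ hD⟩
  have := hex.choose_spec.exists_isOrderIndex hD
  rw [multivanishing, dif_pos hex]
  exact this

theorem hasOrder_iff (hD : IsExhausting D) {i : ℕ} (hi : IsCritical D i) {s : C.K} :
    HasOrder A D s (D i).degree ↔ s ∈ H0 (A - D i) ∧ s ∉ H0 (A - D (i + 1)) := by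
  constructor
  · rintro ⟨m, ⟨h1, h2⟩, h3⟩
    have hm : s ∉ H0 (A - D (m + 1)) := fun h => by
      have := h2 h
      omega
    have hmc : IsCritical D m := fun h => hm (by rw [h]; exact h1)
    obtain rfl := (hD.degree_inj hi hmc).1 h3
    exact ⟨h1, hm⟩
  · rintro ⟨h1, h2⟩
    refine ⟨i, ⟨h1, fun k hk => ?_⟩, rfl⟩
    by_contra hcon
    exact h2 (H0_mono (sub_le_sub_left (hD.mono (Nat.succ_le_of_lt (not_le.1 hcon))) A) hk)

theorem vanishing_map {h : C.K} {A' : Divisor C} (hh : IsBundleIso h A A') (D : Divisor C) :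
    vanishing (U.map (LinearMap.mulLeft κ h)) A' D =
      (vanishing U A D).map (LinearMap.mulLeft κ h) := by
  ext f
  simp only [vanishing, Submodule.mem_inf, Submodule.mem_map, LinearMap.mulLeft_apply]
  constructor
  · rintro ⟨⟨g, hg, rfl⟩, h2⟩
    exact ⟨g, ⟨hg, (hh.sub D).mul_mem_iff.1 h2⟩, rfl⟩
  · rintro ⟨g, ⟨hg, h2⟩, rfl⟩
    exact ⟨⟨g, hg, rfl⟩, (hh.sub D).mul_mem_iff.2 h2⟩

theorem mulLeft_injective_of_ne_zero {h : C.K} (hh : h ≠ 0) :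
    Function.Injective (LinearMap.mulLeft κ h) := fun _ _ => mul_left_cancel₀ hh

theorem finrank_map_mulLeft {h : C.K} (hh : h ≠ 0) (W : Submodule κ C.K) :
    Module.finrank κ (W.map (LinearMap.mulLeft κ h)) = Module.finrank κ W :=
  (Submodule.equivMapOfInjective _ (mulLeft_injective_of_ne_zero hh) W).finrank_eq.symm

theorem multivanishing_map {h : C.K} {A' : Divisor C} (hh : IsBundleIso h A A') (r : ℕ)
    (D : ℕ → Divisor C) :
    multivanishing r (U.map (LinearMap.mulLeft κ h)) A' D = multivanishing r U A D := by
  have : (IsMultivanishing (r := r) (U.map (LinearMap.mulLeft κ h)) A' D) =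
      IsMultivanishing U A D := by
    funext a
    have hv : ∀ E : Divisor C, Module.finrank κ
        (vanishing (U.map (LinearMap.mulLeft κ h)) A' E) = Module.finrank κ (vanishing U A E) := by
      intro E
      rw [vanishing_map hh, finrank_map_mulLeft hh.1]
    unfold IsMultivanishing
    simp_rw [hv]
  -- Equal predicates yield the same choice, so uniqueness of the multivanishing sequence need not
  -- be invoked.
  have key : ∀ p q : (Fin (r + 1) → ℤ) → Prop, p = q →
      (open Classical in if h : ∃ a, p a then h.choose else 0) =
        (open Classical in if h : ∃ a, q a then h.choose else 0) := by
    rintro p _ rfl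
    rfl
  exact key _ _ this

end OrderIndex

namespace NodalCurve

variable {κ : Type u} [Field κ] {X : NodalCurve κ} {n : X.E → ℕ+}

theorem stepDiv_succ (w : X.Multidegree n) (v v' : X.V) (j : ℕ) :
    stepDiv w v v' (j + 1) = stepDiv w v v' j +
      ∑ e ∈ stepEdges w v v' j, X.pointDiv (X.branch e v) v :=
  Finset.sum_range_succ _ _

theorem pointDiv_nonneg (x : X.Pt) (v : X.V) : 0 ≤ X.pointDiv x v := by
  by_cases h : x.1 = v
  · subst h
    rw [pointDiv, Pi.single_eq_same]
    classical
    intro P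
    rw [Finsupp.single_apply]
    split_ifs <;> simp
  · rw [pointDiv_of_ne h]

/-- Every `n e` twists the chip of an edge `e` over `v v'` returns to `v` and adds a point to the
divisor, so the degrees are unbounded. -/
theorem isExhausting_stepDiv {v v' : X.V} (hadj : X.mergedGraph.Adj v v')
    (w : X.Multidegree n) : IsExhausting (stepDiv w v v') := by
  refine ⟨rfl, monotone_nat_of_le_succ fun j => ?_, fun m => ?_⟩
  · rw [stepDiv_succ]
    exact le_add_of_nonneg_right (Finset.sum_nonneg fun e _ => pointDiv_nonneg _ _)
  · obtain ⟨e, he⟩ := hadj.2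
    obtain ⟨k, hk, hke⟩ := exists_mem_stepEdges he w
    have hmem : ∀ q : ℕ, e ∈ stepEdges w v v' (k + q * n e) := by
      intro q
      simp only [stepEdges, Finset.mem_filter] at hke ⊢
      refine ⟨hke.1, ?_⟩
      rw [← hke.2]
      simp
    have hsum : ∀ q : ℕ, (q : ℤ) ≤ (stepDiv w v v' (k + q * n e)).degree := by
      intro q
      induction q with
      | zero =>
        rw [degree_stepDiv]
        exact_mod_cast Finset.sum_nonneg fun _ _ => by positivity
      | succ q ih =>
        have h1 : k + (q + 1) * n e = k + q * n e + ((n e : ℕ) - 1) + 1 := by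
          have := (n e).pos
          rw [add_mul]
          omega
        have h2 : (stepDiv w v v' (k + q * n e)).degree + 1 ≤
            (stepDiv w v v' (k + (q + 1) * n e)).degree := by
          rw [degree_stepDiv, degree_stepDiv]
          have h3 : Finset.range (k + q * n e + 1) ⊆ Finset.range (k + (q + 1) * n e) := by
            rw [h1]
            exact Finset.range_mono (by omega)
          refine le_trans ?_ (Finset.sum_le_sum_of_subset_of_nonneg h3 fun _ _ _ => by positivity)
          rw [Finset.sum_range_succ]
          have : 0 < (stepEdges w v v' (k + q * n e)).card := Finset.card_pos.2 ⟨e, hmem q⟩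
          omega
        push_cast
        linarith
    refine ⟨k + (m.toNat + 1) * n e, ?_⟩
    have := hsum (m.toNat + 1)
    push_cast at this
    have := Int.self_le_toNat m
    omega

theorem isCritical_stepDiv {v v' : X.V} {w : X.Multidegree n} {j : ℕ}
    (hadj : X.mergedGraph.Adj v v') :
    IsCritical (stepDiv w v v') j ↔ (stepEdges w v v' j).Nonempty := by
  have h : (stepDiv w v v' (j + 1)).degree =
      (stepDiv w v v' j).degree + (stepEdges w v v' j).card := by
    rw [degree_stepDiv, degree_stepDiv, Finset.sum_range_succ]
  constructor
  · intro hc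
    have := (isExhausting_stepDiv hadj w).degree_lt hc (Nat.lt_succ_self j)
    rw [Nat.succ_eq_add_one, h] at this
    rw [← Finset.card_pos]
    omega
  · intro hne hcon
    rw [hcon] at h
    have := Finset.card_pos.2 hne
    omega

end NodalCurve
end OssermanLLS

/-! ### Degree count over the rooted tree -/

namespace OssermanLLS

/-- At each point at most one of the divisors is nonzero. This allows orders of vanishing along
several edges at one component to be imposed together. -/
theorem mem_H0_sub_sum {κ : Type u} [Field κ] {C : Curve κ} {ι : Type*} (s : Finset ι)
    {A : Divisor C} {D : ι → Divisor C} (hD : ∀ i ∈ s, ∀ j ∈ s, i ≠ j → ∀ P, D i P = 0 ∨ D j P = 0)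
    {f : C.K} (hf : f ∈ H0 A) (h : ∀ i ∈ s, f ∈ H0 (A - D i)) : f ∈ H0 (A - ∑ i ∈ s, D i) := by
  intro P
  rw [Finsupp.sub_apply, Finsupp.finsetSum_apply]
  by_cases hex : ∃ i ∈ s, D i P ≠ 0
  · obtain ⟨i, hi, hne⟩ := hex
    rw [Finset.sum_eq_single_of_mem i hi fun j hj hji =>
      (hD j hj i hi hji P).resolve_right hne]
    exact h i hi P
  · push Not at hex
    rw [Finset.sum_eq_zero hex, sub_zero]
    exact hf P

namespace NodalCurve

/-- A rooting at `v` of a graph: parents `p` and heights `ℓ`. -/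
structure IsRooting {V : Type*} (G : SimpleGraph V) (v : V) (p : V → V) (ℓ : V → ℕ) : Prop where
  adj : ∀ t, t ≠ v → G.Adj (p t) t
  height : ∀ t, t ≠ v → ℓ t = ℓ (p t) + 1

theorem exists_isRooting {V : Type*} {G : SimpleGraph V} (hG : G.Connected) {v v' : V}
    (h : G.Adj v v') : ∃ p ℓ, IsRooting G v p ℓ ∧ p v' = v := by
  classical
  have hex : ∀ t, t ≠ v → ∃ q, G.Adj q t ∧ G.dist t v = G.dist q v + 1 := by
    intro t ht
    obtain ⟨W, hW⟩ := (hG t v).exists_walk_length_eq_dist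
    cases W with
    | nil => exact absurd rfl ht
    | @cons _ q _ hq W =>
      refine ⟨q, hq.symm, ?_⟩
      have h1 := SimpleGraph.dist_le W
      have h2 := hG.dist_triangle (u := t) (v := q) (w := v)
      rw [SimpleGraph.Walk.length_cons] at hW
      rw [SimpleGraph.dist_eq_one_iff_adj.2 hq] at h2
      omega
  choose! p hp using hex
  refine ⟨fun t => if t = v' then v else p t, fun t => G.dist t v, ⟨fun t ht => ?_, fun t ht => ?_⟩,
    if_pos rfl⟩
  · split_ifs with h1
    · rwa [h1]
    · exact (hp t ht).1
  · split_ifs with h1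
    · rw [h1, SimpleGraph.dist_self, SimpleGraph.dist_eq_one_iff_adj.2 h.symm]
    · exact (hp t ht).2

variable {κ : Type u} [Field κ] {X : NodalCurve κ} {n : X.E → ℕ+}

theorem stepDiv_apply_eq_zero (w : X.Multidegree n) {u t : X.V} {k : ℕ} {P : Point (X.comp u)}
    (h : ∀ e ∈ X.edges u t, X.branch e u ≠ ⟨u, P⟩) : stepDiv w u t k P = 0 := by
  classical
  rw [stepDiv, Finsupp.finsetSum_apply]
  refine Finset.sum_eq_zero fun m _ => ?_
  rw [Finsupp.finsetSum_apply]
  refine Finset.sum_eq_zero fun e he => ?_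
  have he' := (Finset.mem_filter.1 he).1
  have h1 := branch_fst he'
  have h2 := h e he'
  generalize X.branch e u = x at h1 h2
  obtain ⟨x, Q⟩ := x
  dsimp only at h1
  subst h1
  rw [pointDiv, Pi.single_eq_same, Finsupp.single_apply, if_neg]
  rintro rfl
  exact h2 rfl

theorem branch_injective {u : X.V} {e e' : X.E} (h : X.branch e u = X.branch e' u) : e = e' := by
  have key : ∀ c c', X.node e c = X.node e' c' → e = e' := by
    intro c c' h
    exact congrArg Prod.fst (@X.injective (e, c) (e', c') h)
  unfold branch at h
  split_ifs at h <;> exact key _ _ h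

/-- A node lies on only two components, so branches on `Z_u` belonging to different merged edges are
different points. -/
theorem stepDiv_disjoint (w w' : X.Multidegree n) {u t t' : X.V} (htt : t ≠ t') (k k' : ℕ)
    (P : Point (X.comp u)) : stepDiv w u t k P = 0 ∨ stepDiv w' u t' k' P = 0 := by
  by_contra! hcon
  obtain ⟨h1, h2⟩ := hcon
  have h3 := mt (stepDiv_apply_eq_zero w (t := t) (k := k)) h1
  have h4 := mt (stepDiv_apply_eq_zero w' (t := t') (k := k')) h2
  push Not at h3 h4
  obtain ⟨e, he, hep⟩ := h3
  obtain ⟨e', he', hep'⟩ := h4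
  obtain rfl := branch_injective (hep.trans hep'.symm)
  have := X.loopless e
  rw [mem_edges] at he he'
  simp only [tail, head] at he he'
  grind

variable {w : X.V → X.Multidegree n} {b : X.V → X.V → ℕ}

/-- The multidegree reached from `w p` by `k` partial twists has the same total degree and differs
from `w p` only at `p`, `u` and the chips over this edge. Its own chips there are nonnegative in
number and may be dropped. -/
theorem le_deg_add_chips (hX : X.IsPseudocompact) (ht : IsTight w b) {p u : X.V}
    (hadj : X.mergedGraph.Adj p u) {k : ℕ} (hk : k ≤ b p u) :
    (w u).deg u - (stepDiv (w u) u p (b p u - k)).degree - (stepDiv (w p) p u k).degree ≤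
      (w p).deg u + ∑ e ∈ X.edges p u, if (w p).chip e ≠ 0 then 1 else 0 := by
  set w' := (Multidegree.partialTwist p u)^[k] (w p) with hw'
  have h1 : w'.deg p = (w p).deg p - (stepDiv (w p) p u k).degree :=
    partialTwist_iterate_deg_self hX hadj (w p) k
  have h2 : w'.deg u = (w u).deg u - (stepDiv (w u) u p (b p u - k)).degree := by
    rw [hw', ← ht.iterate_eq hadj hk]
    exact partialTwist_iterate_deg_self hX hadj.symm (w u) _
  have h3 : w'.total = (w p).total := total_partialTwist_iterate hX hadj (w p) k
  have h4 : ∀ x, x ≠ p → x ≠ u → w'.deg x = (w p).deg x := fun x hx hx' =>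
    partialTwist_iterate_deg (w p) k hx hx'
  have h5 : ∀ e, e ∉ X.edges p u → w'.chip e = (w p).chip e := fun e he => by
    rw [hw', partialTwist_iterate_chip, if_neg he]
  have htot : ∀ x : X.Multidegree n, x.total = (∑ e ∈ X.edges p u, if x.chip e ≠ 0 then 1 else 0) +
      (∑ e ∈ (X.edges p u)ᶜ, if x.chip e ≠ 0 then 1 else 0) + (x.deg p + x.deg u +
      ∑ y ∈ ({p, u} : Finset X.V)ᶜ, x.deg y) := by
    intro x
    rw [Finset.sum_add_sum_compl, ← Finset.sum_pair hadj.1, Finset.sum_add_sum_compl,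
      Multidegree.total, Finset.card_filter]
    push_cast
    rfl
  rw [htot, htot] at h3
  have h6 : (∑ y ∈ ({p, u} : Finset X.V)ᶜ, w'.deg y) =
      ∑ y ∈ ({p, u} : Finset X.V)ᶜ, (w p).deg y := by
    refine Finset.sum_congr rfl fun y hy => ?_
    simp only [Finset.mem_compl, Finset.mem_insert, Finset.mem_singleton, not_or] at hy
    exact h4 y hy.1 hy.2
  have h7 : (∑ e ∈ (X.edges p u)ᶜ, if w'.chip e ≠ 0 then (1 : ℤ) else 0) =
      ∑ e ∈ (X.edges p u)ᶜ, if (w p).chip e ≠ 0 then 1 else 0 :=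
    Finset.sum_congr rfl fun e he => by rw [h5 e (Finset.mem_compl.1 he)]
  have h8 : 0 ≤ ∑ e ∈ X.edges p u, if w'.chip e ≠ 0 then (1 : ℤ) else 0 :=
    Finset.sum_nonneg fun e _ => by split_ifs <;> simp
  rw [h1, h2, h6, h7] at h3
  linarith

section Rooting

variable {v : X.V} {p : X.V → X.V} {ℓ : X.V → ℕ}

theorem IsRooting.ne_of_height (hp : IsRooting X.mergedGraph v p ℓ) {t u : X.V} (ht : t ≠ v)
    (h : ℓ t < ℓ u) : u ≠ t ∧ u ≠ p t := by
  have := hp.height t ht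
  constructor <;> rintro rfl <;> omega

/-- Only the edges on the path from `v` to `t` are twisted, and none of these touches a vertex
higher than `t`. -/
theorem IsRooting.deg_eq (hp : IsRooting X.mergedGraph v p ℓ) (ht : IsTight w b) {t u : X.V}
    (h : ℓ t < ℓ u) : (w t).deg u = (w v).deg u ∧
      ∀ e, (X.tail e = u ∨ X.head e = u) → (w t).chip e = (w v).chip e := by
  induction hm : ℓ t using Nat.strong_induction_on generalizing t with
  | _ m ih =>
    by_cases htv : t = v
    · subst htv
      exact ⟨rfl, fun _ _ => rfl⟩
    obtain ⟨h1, h2⟩ := hp.ne_of_height htv h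
    have h3 := hp.height t htv
    obtain ⟨h4, h5⟩ := ih (ℓ (p t)) (by omega) (t := p t) (by omega) rfl
    rw [ht.eq_iterate' (hp.adj t htv)]
    refine ⟨by rw [partialTwist_iterate_deg _ _ h2 h1, h4], fun e he => ?_⟩
    rw [partialTwist_iterate_chip, if_neg, h5 e he]
    rw [mem_edges]
    rintro (⟨h6, h7⟩ | ⟨h6, h7⟩) <;> rcases he with h8 | h8 <;> simp_all

/-- Each vertex other than the root accounts for the edges to its parent; these sets of edges are
disjoint, so no chip is counted twice. -/
theorem IsRooting.sum_le_total (hp : IsRooting X.mergedGraph v p ℓ) (x : X.Multidegree n) :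
    x.deg v + ∑ u ∈ Finset.univ.erase v,
      (x.deg u + ∑ e ∈ X.edges (p u) u, if x.chip e ≠ 0 then 1 else 0) ≤ x.total := by
  have hdisj : ∀ u ∈ Finset.univ.erase v, ∀ u' ∈ Finset.univ.erase v, u ≠ u' →
      Disjoint (X.edges (p u) u) (X.edges (p u') u') := by
    intro u hu u' hu' hne
    rw [Finset.disjoint_left]
    intro e he he'
    have h1 := hp.height u (Finset.ne_of_mem_erase hu)
    have h2 := hp.height u' (Finset.ne_of_mem_erase hu')
    rw [mem_edges] at he he'
    grind
  rw [Finset.sum_add_distrib, ← Finset.sum_biUnion hdisj, ← add_assoc,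
    Finset.add_sum_erase _ _ (Finset.mem_univ v), Multidegree.total, Finset.card_filter, add_comm]
  push_cast
  gcongr
  exact Finset.subset_univ _

/-- The section `f u` vanishes along a divisor for the edge to the parent and along one for each
edge to a child, so the degree left on `Z_u` is nonnegative. All these inequalities are summed, and
`le_deg_add_chips` replaces the degrees in `w u` by those in `w v`. If the order `K t` on the parent
side exactly complements the order `b - k t` on the side of `t`, the edge contributes nothing;
otherwise the excess is bounded by the total degree. -/
theorem IsRooting.sum_degree_le_total [IsAlgClosed κ] (hp : IsRooting X.mergedGraph v p ℓ)
    (hX : X.IsPseudocompact)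
    (ht : IsTight w b) {A : X.Div} (hA : ∀ u, (A u).degree = (w u).deg u) {k K : X.V → ℕ}
    (hk : ∀ t, t ≠ v → k t ≤ b (p t) t) {f : ∀ u, (X.comp u).K} (hf0 : ∀ u, f u ≠ 0)
    (hf : ∀ u, f u ∈ H0 (A u))
    (hfp : ∀ u, u ≠ v → f u ∈ H0 (A u - stepDiv (w u) u (p u) (b (p u) u - k u)))
    (hfc : ∀ t, t ≠ v → f (p t) ∈ H0 (A (p t) - stepDiv (w (p t)) (p t) t (K t))) :
    ∑ t ∈ Finset.univ.erase v, ((stepDiv (w (p t)) (p t) t (K t)).degree -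
      (stepDiv (w (p t)) (p t) t (k t)).degree) ≤ (w v).total := by
  have hchild : ∀ u, f u ∈ H0 (A u - ∑ t ∈ (Finset.univ.erase v).filter fun t => p t = u,
      stepDiv (w u) u t (K t)) := by
    intro u
    refine mem_H0_sub_sum _ (fun t _ t' _ htt P => stepDiv_disjoint _ _ htt _ _ P) (hf u) ?_
    intro t ht
    obtain ⟨h1, rfl⟩ := Finset.mem_filter.1 ht
    exact hfc t (Finset.ne_of_mem_erase h1)
  have hnonneg : ∀ u, u ≠ v → 0 ≤ (w u).deg u - (stepDiv (w u) u (p u) (b (p u) u - k u)).degree -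
      ∑ t ∈ (Finset.univ.erase v).filter fun t => p t = u, (stepDiv (w u) u t (K t)).degree := by
    intro u hu
    -- `Bool` serves as a two-element index set, combining the divisor for the parent with the sum
    -- over the children.
    have h1 : f u ∈ H0 (A u - ∑ i : Bool, if i then stepDiv (w u) u (p u) (b (p u) u - k u) else
        ∑ t ∈ (Finset.univ.erase v).filter fun t => p t = u, stepDiv (w u) u t (K t)) := by
      have hdis : ∀ P, stepDiv (w u) u (p u) (b (p u) u - k u) P = 0 ∨
          (∑ t ∈ (Finset.univ.erase v).filter fun t => p t = u, stepDiv (w u) u t (K t)) P = 0 := by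
        intro P
        by_cases h0 : stepDiv (w u) u (p u) (b (p u) u - k u) P = 0
        · exact Or.inl h0
        · right
          rw [Finsupp.finsetSum_apply]
          refine Finset.sum_eq_zero fun t ht => ?_
          obtain ⟨h1, h2⟩ := Finset.mem_filter.1 ht
          refine (stepDiv_disjoint (w u) (w u) (t := p u) (t' := t) ?_ _ _ P).resolve_left h0
          rintro rfl
          have h3 := hp.height u hu
          have h4 := hp.height (p u) (Finset.ne_of_mem_erase h1)
          rw [h2] at h4
          omega
      refine mem_H0_sub_sum _ ?_ (hf u) ?_
      · rintro (_ | _) - (_ | _) - hne P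
        · exact absurd rfl hne
        · exact (hdis P).symm
        · exact hdis P
        · exact absurd rfl hne
      · rintro (_ | _) -
        · exact hchild u
        · exact hfp u hu
    have h2 := degree_nonneg_of_mem_H0 (hf0 u) h1
    rw [Fintype.sum_bool, Divisor.degree_sub, Divisor.degree_add, hA] at h2
    simp only [if_true, Bool.false_eq_true, if_false, Divisor.degree_sum] at h2
    linarith
  have hroot := degree_nonneg_of_mem_H0 (hf0 v) (hchild v)
  rw [Divisor.degree_sub, Divisor.degree_sum, hA] at hroot
  refine le_trans ?_ (hp.sum_le_total (w v))
  have hle : ∀ u, u ≠ v → (w u).deg u - (stepDiv (w u) u (p u) (b (p u) u - k u)).degree -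
      (stepDiv (w (p u)) (p u) u (k u)).degree ≤
      (w v).deg u + ∑ e ∈ X.edges (p u) u, if (w v).chip e ≠ 0 then 1 else 0 := by
    intro u hu
    have h1 := le_deg_add_chips hX ht (hp.adj u hu) (hk u hu)
    obtain ⟨h2, h3⟩ := hp.deg_eq ht (t := p u) (u := u) (by rw [hp.height u hu]; omega)
    rw [h2] at h1
    refine h1.trans_eq ?_
    congr 1
    refine Finset.sum_congr rfl fun e he => ?_
    rw [h3 e]
    rw [mem_edges] at he
    tauto
  have hsum := Finset.sum_le_sum fun u (hu : u ∈ Finset.univ.erase v) =>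
    hle u (Finset.ne_of_mem_erase hu)
  have hsum2 := Finset.sum_nonneg fun u (hu : u ∈ Finset.univ.erase v) =>
    hnonneg u (Finset.ne_of_mem_erase hu)
  have hfib : ∑ u, ∑ t ∈ (Finset.univ.erase v).filter fun t => p t = u,
      (stepDiv (w u) u t (K t)).degree =
        ∑ t ∈ Finset.univ.erase v, (stepDiv (w (p t)) (p t) t (K t)).degree := by
    rw [← Finset.sum_fiberwise (Finset.univ.erase v) p]
    refine Finset.sum_congr rfl fun u _ => Finset.sum_congr rfl fun t ht => ?_
    rw [(Finset.mem_filter.1 ht).2]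
  rw [← Finset.add_sum_erase _ _ (Finset.mem_univ v)] at hfib
  simp only [Finset.sum_sub_distrib] at hsum hsum2 ⊢
  linarith

end Rooting

end NodalCurve
end OssermanLLS

/-! ### A single torus element from prescribed restrictions; the numerical hypothesis -/

namespace OssermanLLS

/-- Torus elements `ρ j`, prescribed up to scalars on the sets `I j`, come from a single one. -/
theorem exists_torus_of_forest {E G : Type*} [DecidableEq E] [CommGroup G] {s : Finset E}
    (hs : s.card ≤ 3) (hne : s.Nonempty) {J : Set ℕ} {I : ℕ → Finset E} (hI : ∀ j, I j ⊆ s)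
    (hpair : ∀ j ∈ J, ∀ j' ∈ J, j < j' → ∀ e ∈ I j, e ∈ I j' → ∀ e' ∈ I j, e' ∈ I j' → e = e')
    (htriangle : ∀ i ∈ J, ∀ j ∈ J, ∀ k ∈ J, i < j → j < k → ∀ e ∈ I i, e ∈ I j →
      ∀ e' ∈ I j, e' ∈ I k → ∀ e'' ∈ I i, e'' ∈ I k → e ≠ e' → e ≠ e'' → e' ≠ e'' → False)
    (ρ : ℕ → E → G) : ∃ μ : E → G, ∀ j ∈ J, ∃ c : G, ∀ e ∈ I j, μ e = c * ρ j e := by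
  classical
  -- Some element lies in all sets with at least two elements. Otherwise `s` has three elements and
  -- its three pairs lie in three different sets: a triangle, excluded in each ordering of the
  -- indices.
  obtain ⟨c, hc⟩ : ∃ c, ∀ j ∈ J, 1 < (I j).card → c ∈ I j := by
    by_contra! hcon
    obtain ⟨x, hx⟩ := hne
    obtain ⟨j₀, hj₀, hcard₀, -⟩ := hcon x
    obtain ⟨p, hp, q, hq, hpq⟩ := Finset.one_lt_card.1 hcard₀
    obtain ⟨j₁, hj₁, hcard₁, hp₁⟩ := hcon p
    obtain ⟨j₂, hj₂, hcard₂, hq₂⟩ := hcon q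
    obtain ⟨t, ht₁, htq⟩ := Finset.exists_mem_ne hcard₁ q
    have htp : t ≠ p := by
      rintro rfl
      exact hp₁ ht₁
    have hs3 : s = {p, q, t} := by
      symm
      refine Finset.eq_of_subset_of_card_le ?_ ?_
      · intro x hx
        simp only [Finset.mem_insert, Finset.mem_singleton] at hx
        rcases hx with rfl | rfl | rfl
        · exact hI _ hp
        · exact hI _ hq
        · exact hI _ ht₁
      · rw [Finset.card_eq_three.2 ⟨p, q, t, hpq, htp.symm, htq.symm, rfl⟩]
        exact hs
    have key : ∀ j, 1 < (I j).card → ∀ x y z, s = {x, y, z} → x ∉ I j → y ∈ I j ∧ z ∈ I j := by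
      intro j hj x y z hxyz hx
      have hsub : ∀ e ∈ I j, e = y ∨ e = z := by
        intro e he
        have h1 := hI j he
        rw [hxyz] at h1
        simp only [Finset.mem_insert, Finset.mem_singleton] at h1
        rcases h1 with rfl | h1
        · exact absurd he hx
        · exact h1
      obtain ⟨e, he, hey⟩ := Finset.exists_mem_ne hj y
      obtain ⟨e', he', hez⟩ := Finset.exists_mem_ne hj z
      have h1 := (hsub e he).resolve_left hey
      have h2 := (hsub e' he').resolve_right hez
      exact ⟨h2 ▸ he', h1 ▸ he⟩
    obtain ⟨hq₁, -⟩ := key j₁ hcard₁ p q t hs3 hp₁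
    obtain ⟨hp₂, ht₂⟩ := key j₂ hcard₂ q p t (by rw [hs3, Finset.insert_comm]) hq₂
    rcases lt_trichotomy j₀ j₁ with h01 | rfl | h01
    · rcases lt_trichotomy j₁ j₂ with h12 | rfl | h12
      · exact htriangle _ hj₀ _ hj₁ _ hj₂ h01 h12 q hq hq₁ t ht₁ ht₂ p hp hp₂ htq.symm hpq.symm htp
      · exact hq₂ hq₁
      · rcases lt_trichotomy j₀ j₂ with h02 | rfl | h02
        · exact htriangle _ hj₀ _ hj₂ _ hj₁ h02 h12 p hp hp₂ t ht₂ ht₁ q hq hq₁ htp.symm hpq htq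
        · exact hq₂ hq
        · exact htriangle _ hj₂ _ hj₀ _ hj₁ h02 h01 p hp₂ hp q hq hq₁ t ht₂ ht₁ hpq htp.symm htq.symm
    · exact hp₁ hp
    · rcases lt_trichotomy j₁ j₂ with h12 | rfl | h12
      · rcases lt_trichotomy j₀ j₂ with h02 | rfl | h02
        · exact htriangle _ hj₁ _ hj₀ _ hj₂ h01 h02 q hq₁ hq p hp hp₂ t ht₁ ht₂ hpq.symm htq.symm
            htp.symm
        · exact hq₂ hq
        · exact htriangle _ hj₁ _ hj₂ _ hj₀ h12 h02 t ht₁ ht₂ p hp₂ hp q hq₁ hq htp htq hpq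
      · exact hq₂ hq₁
      · exact htriangle _ hj₂ _ hj₁ _ hj₀ h12 h01 t ht₂ ht₁ q hq₁ hq p hp₂ hp htq htp hpq.symm
  -- The solution is normalized to be `1` at `c`. For `e ≠ c`, at most one set contains both `c` and
  -- `e`, so the chosen index does not matter.
  let μ : E → G := fun e => if h : ∃ j ∈ J, c ∈ I j ∧ e ∈ I j then
    ρ h.choose e / ρ h.choose c else 1
  refine ⟨μ, fun j hj => ?_⟩
  by_cases hcj : c ∈ I j
  · refine ⟨(ρ j c)⁻¹, fun e he => ?_⟩
    have hex : ∃ j ∈ J, c ∈ I j ∧ e ∈ I j := ⟨j, hj, hcj, he⟩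
    have h1 := hex.choose_spec
    simp only [μ, dif_pos hex]
    generalize hex.choose = j' at h1
    obtain ⟨hj', hcj', he'⟩ := h1
    by_cases hec : e = c
    · rw [hec, div_self', inv_mul_cancel]
    · rcases lt_trichotomy j j' with h | rfl | h
      · exact absurd (hpair j hj j' hj' h e he he' c hcj hcj') hec
      · rw [div_eq_mul_inv, mul_comm]
      · exact absurd (hpair j' hj' j hj h e he' he c hcj' hcj) hec
  · have h1 : (I j).card ≤ 1 := not_lt.1 fun h => hcj (hc j hj h)
    rw [Finset.card_le_one] at h1
    by_cases hem : (I j).Nonempty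
    · obtain ⟨e, he⟩ := hem
      refine ⟨μ e / ρ j e, fun e' he' => ?_⟩
      rw [h1 e' he' e he, div_mul_cancel]
    · rw [Finset.not_nonempty_iff_eq_empty] at hem
      exact ⟨1, fun e he => by simp [hem] at he⟩

namespace NodalCurve

variable {κ : Type u} [Field κ] {X : NodalCurve κ} {n : X.E → ℕ+}

theorem twistSeq_eq (w : X.V → X.Multidegree n) (v v' : X.V) :
    twistSeq w v v' = stepDiv (w v) v v' := funext (twistSeq_eq_stepDiv w v v')

theorem dvd_sub_of_mem_stepEdges {w : X.Multidegree n} {v v' : X.V} {e : X.E} {j j' : ℕ}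
    (h : e ∈ stepEdges w v v' j) (h' : e ∈ stepEdges w v v' j') : (n e : ℤ) ∣ j' - j := by
  have h1 := (Finset.mem_filter.1 h).2
  have h2 := (Finset.mem_filter.1 h').2
  have h3 : ((j' : ZMod (n e)) - j) * (X.sgn e v : ZMod (n e)) = 0 := by
    linear_combination h2 - h1
  have h4 : ((X.sgn e v : ZMod (n e))) * (X.sgn e v : ZMod (n e)) = 1 := by
    exact_mod_cast congrArg (Int.cast : ℤ → ZMod (n e)) (sgn_mul_self e v)
  have h5 : (((j' - j : ℤ)) : ZMod (n e)) = 0 := by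
    push_cast
    linear_combination (X.sgn e v : ZMod (n e)) * h3 - ((j' : ZMod (n e)) - j) * h4
  exact (ZMod.intCast_zmod_eq_zero_iff_dvd _ _).1 h5

/-- The degree of the twisting divisors grows at least with average slope. -/
theorem sum_div_le_degree_sub (w : X.Multidegree n) (v v' : X.V) {j j' : ℕ} (h : j ≤ j') :
    ∑ e ∈ X.edges v v', ((j' : ℤ) - j) / (n e : ℤ) ≤
      (stepDiv w v v' j').degree - (stepDiv w v v' j).degree := by
  -- Among `n e` consecutive indices, one lies in the residue class at which the edge `e`
  -- contributes.
  have hper : ∀ e ∈ X.edges v v', ∀ q : ℕ, ∀ j,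
      (q : ℤ) ≤ ∑ k ∈ Finset.Ico j (j + q * n e), if e ∈ stepEdges w v v' k then 1 else 0 := by
    intro e he q
    obtain ⟨k₀, -, hk₀⟩ := exists_mem_stepEdges he w
    induction q with
    | zero => intro j; simp
    | succ q ih =>
      intro j
      have h1 : j + (q + 1) * n e = (j + n e) + q * n e := by ring
      rw [h1, ← Finset.sum_Ico_consecutive _ (show j ≤ j + n e by omega)
        (show j + n e ≤ j + n e + q * n e by omega)]
      have h2 := ih (j + n e)
      have h3 : (1 : ℤ) ≤ ∑ k ∈ Finset.Ico j (j + n e), if e ∈ stepEdges w v v' k then 1 else 0 := by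
        obtain ⟨k, hk, hkk⟩ : ∃ k ∈ Finset.Ico j (j + n e), (k : ZMod (n e)) = k₀ := by
          refine ⟨j + ((k₀ : ZMod (n e)) - (j : ZMod (n e))).val, ?_, ?_⟩
          · rw [Finset.mem_Ico]
            have := ZMod.val_lt ((k₀ : ZMod (n e)) - (j : ZMod (n e)))
            omega
          · push_cast
            rw [ZMod.natCast_zmod_val]
            ring
        refine le_trans ?_ (Finset.single_le_sum
          (f := fun k => if e ∈ stepEdges w v v' k then (1 : ℤ) else 0)
          (fun _ _ => by split_ifs <;> simp) hk)
        rw [if_pos]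
        have := Finset.mem_filter.1 hk₀
        exact Finset.mem_filter.2 ⟨he, by rw [hkk]; exact this.2⟩
      push_cast
      linarith
  have hlen : ∀ e ∈ X.edges v v', ((j' : ℤ) - j) / (n e : ℤ) ≤
      ∑ k ∈ Finset.Ico j j', if e ∈ stepEdges w v v' k then 1 else 0 := by
    intro e he
    have h1 := hper e he ((j' - j) / n e) j
    have h2 : (((j' - j) / (n e : ℕ) : ℕ) : ℤ) = ((j' : ℤ) - j) / (n e : ℤ) := by
      rw [Int.natCast_div, Nat.cast_sub h]
    rw [h2] at h1
    refine h1.trans (Finset.sum_le_sum_of_subset_of_nonneg ?_ fun _ _ _ => by split_ifs <;> simp)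
    refine Finset.Ico_subset_Ico_right ?_
    have := Nat.div_mul_le_self (j' - j) (n e)
    omega
  refine (Finset.sum_le_sum hlen).trans_eq ?_
  rw [degree_stepDiv, degree_stepDiv, ← Finset.sum_Ico_eq_sub _ h, Finset.sum_comm]
  refine Finset.sum_congr rfl fun k _ => ?_
  rw [← Finset.sum_filter, Finset.sum_const, nsmul_one]
  congr 2
  ext e
  simp only [stepEdges, Finset.mem_filter]
  tauto

variable {w : X.V → X.Multidegree n} {b : X.V → X.V → ℕ} {r : ℕ} {A : X.Div}
  {U : ∀ v, Submodule κ (X.comp v).K}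

theorem exists_isOrderIndex_vanSeq [IsAlgClosed κ] {v v' : X.V} (hadj : X.mergedGraph.Adj v v')
    (w : X.V → X.Multidegree n) (hU : U v ≤ H0 (A v)) (hr : Module.finrank κ (U v) = r + 1) :
    ∃ i : Fin (r + 1) → ℕ, IsOrderIndex (U v) (A v) (stepDiv (w v) v v') i ∧
      vanSeq w r A U v v' = fun l => (stepDiv (w v) v v' (i l)).degree := by
  rw [vanSeq, twistSeq_eq]
  exact exists_isOrderIndex (isExhausting_stepDiv hadj _) hU hr

end NodalCurve

theorem IsOrderIndex.exists_ne_zero {κ : Type u} [Field κ] {C : Curve κ} {r : ℕ}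
    {U : Submodule κ C.K} {A : Divisor C} {D : ℕ → Divisor C} {i : Fin (r + 1) → ℕ}
    (hi : IsOrderIndex U A D i) (l : Fin (r + 1)) :
    ∃ f ∈ U, f ≠ 0 ∧ f ∈ H0 (A - D (i l)) := by
  have h1 : 0 < (Finset.univ.filter fun l' => i l' = i l).card := Finset.card_pos.2 ⟨l, by simp⟩
  have h2 := hi.card (i l)
  have h3 : vanishing U A (D (i l)) ≠ ⊥ := by
    intro h
    rw [h, finrank_bot] at h2
    omega
  obtain ⟨f, hf, hf0⟩ := Submodule.exists_mem_ne_zero_of_ne_bot h3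
  exact ⟨f, hf.1, hf0, hf.2⟩

/-- All indices are at least `i 0`, so the corresponding step of the filtration has full dimension.
-/
theorem IsOrderIndex.le_vanishing_zero {κ : Type u} [Field κ] [IsAlgClosed κ] {C : Curve κ} {r : ℕ}
    {U : Submodule κ C.K} {A : Divisor C} {D : ℕ → Divisor C} {i : Fin (r + 1) → ℕ}
    (hi : IsOrderIndex U A D i) (hD : IsExhausting D)
    (hr : Module.finrank κ U = r + 1) : U ≤ H0 (A - D (i 0)) := by
  obtain ⟨N, hN⟩ := hD.exists_vanishing_eq_bot U A
  have h1 := card_filter_le_eq_finrank (vanishing_antitone U A hD.mono) hN hi.card (i 0)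
  have h2 : (Finset.univ.filter fun l => i 0 ≤ i l) = Finset.univ :=
    Finset.filter_true_of_mem fun l _ => hi.mono (Fin.zero_le l)
  rw [h2, Finset.card_univ, Fintype.card_fin] at h1
  have hfd : FiniteDimensional κ U := Module.finite_of_finrank_pos (by omega)
  have h3 : vanishing U A (D (i 0)) = U :=
    Submodule.eq_of_le_of_finrank_eq inf_le_left (by rw [← h1, hr])
  intro f hf
  rw [← h3] at hf
  exact hf.2

namespace NodalCurve

variable {κ : Type u} [Field κ] [IsAlgClosed κ] {X : NodalCurve κ} {n : X.E → ℕ+}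
  {w : X.V → X.Multidegree n} {b : X.V → X.V → ℕ} {r : ℕ} {A : X.Div}
  {U : ∀ v, Submodule κ (X.comp v).K}

/-- Take for `k` the smallest index of `U p`: every section on `Z_p` vanishes along its divisor, and
the vanishing condition provides a section on `Z_t` of complementary order at the last position. If
that index exceeds `b`, then `k = b` and nothing is required on `Z_t`. As all of `U p` vanishes, the
splittings for different edges at `p` can be used together with any section on `Z_p`. -/
theorem IsPreLimit.exists_split (hpre : IsPreLimit w b r A U) {p t : X.V}
    (hadj : X.mergedGraph.Adj p t) : ∃ k ≤ b p t, U p ≤ H0 (A p - stepDiv (w p) p t k) ∧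
      ∃ f ∈ U t, f ≠ 0 ∧ f ∈ H0 (A t - stepDiv (w t) t p (b p t - k)) := by
  obtain ⟨h1, h2⟩ := hpre
  obtain ⟨i, hi, hi'⟩ := exists_isOrderIndex_vanSeq hadj w (h1 p).2.1 (h1 p).2.2
  obtain ⟨m, hm, hm'⟩ := exists_isOrderIndex_vanSeq hadj.symm w (h1 t).2.1 (h1 t).2.2
  have hDp := isExhausting_stepDiv hadj (w p)
  have hDt := isExhausting_stepDiv hadj.symm (w t)
  have hle := hi.le_vanishing_zero hDp (h1 p).2.2
  by_cases h0 : i 0 ≤ b p t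
  · refine ⟨i 0, h0, hle, ?_⟩
    have h3 := h2 p t hadj 0 (i 0) h0
      (by rw [twistSeq_eq]; exact hi.isCritical 0) (by rw [hi', twistSeq_eq])
    rw [hm', twistSeq_eq] at h3
    obtain ⟨f, hf, hf0, hf'⟩ := hm.exists_ne_zero (Fin.rev 0)
    exact ⟨f, hf, hf0, H0_mono (sub_le_sub_left
      (hDt.mono (hDt.le_of_degree_le (hm.isCritical _) h3)) _) hf'⟩
  · refine ⟨b p t, le_rfl, hle.trans (H0_mono (sub_le_sub_left (hDp.mono (by omega)) _)), ?_⟩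
    have hne : U t ≠ ⊥ := by
      intro h
      have := (h1 t).2.2
      rw [h, finrank_bot] at this
      omega
    obtain ⟨f, hf, hf0⟩ := Submodule.exists_mem_ne_zero_of_ne_bot hne
    refine ⟨f, hf, hf0, ?_⟩
    rw [Nat.sub_self, hDt.zero, sub_zero]
    exact (h1 t).2.1 hf

theorem IsPreLimit.exists_extremal (hpre : IsPreLimit w b r A U) {v v' : X.V}
    (hadj : X.mergedGraph.Adj v v') {j : ℕ} (hg : 0 < extremalCount w b r A U v v' j) :
    (∃ f ∈ U v, f ≠ 0 ∧ f ∈ H0 (A v - stepDiv (w v) v v' j)) ∧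
      ∃ f ∈ U v', f ≠ 0 ∧ f ∈ H0 (A v' - stepDiv (w v') v' v (b v v' - j)) := by
  obtain ⟨h1, h2⟩ := hpre
  obtain ⟨i, hi, hi'⟩ := exists_isOrderIndex_vanSeq hadj w (h1 v).2.1 (h1 v).2.2
  obtain ⟨m, hm, hm'⟩ := exists_isOrderIndex_vanSeq hadj.symm w (h1 v').2.1 (h1 v').2.2
  have hDp := isExhausting_stepDiv hadj (w v)
  have hDt := isExhausting_stepDiv hadj.symm (w v')
  obtain ⟨l, hl⟩ := Finset.card_pos.1 hg
  obtain ⟨-, h3, h4⟩ := Finset.mem_filter.1 hl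
  rw [hi', twistSeq_eq] at h3
  rw [hm', twistSeq_eq] at h4
  obtain ⟨f, hf, hf0, hf'⟩ := hi.exists_ne_zero l
  obtain ⟨f', hff, hff0, hff'⟩ := hm.exists_ne_zero (Fin.rev l)
  exact ⟨⟨f, hf, hf0, H0_mono (sub_le_sub_left (hDp.mono
    (hDp.le_of_degree_le (hi.isCritical _) h3.ge)) _) hf'⟩,
    ⟨f', hff, hff0, H0_mono (sub_le_sub_left (hDt.mono
    (hDt.le_of_degree_le (hm.isCritical _) h4.ge)) _) hff'⟩⟩

/-- Root the tree at `v`, with `v'` below it. An extremal section of index `j'` is taken on `Z_v`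
and one of index `j` on `Z_{v'}`, so at this edge the orders exceed complementarity by `deg D_{j'} -
deg D_j`. At the other edges `exists_split` gives complementary orders, so in the degree count
nothing else survives. -/
theorem IsPreLimit.degree_sub_le_total (hpre : IsPreLimit w b r A U) (hX : X.IsPseudocompact)
    (ht : IsTight w b) {v v' : X.V} (hadj : X.mergedGraph.Adj v v') {j j' : ℕ}
    (hj : j ≤ b v v') (hg : 0 < extremalCount w b r A U v v' j) (hg' : 0 < extremalCount w b r A U v v' j') :
    (stepDiv (w v) v v' j').degree - (stepDiv (w v) v v' j).degree ≤ (w v).total := by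
  obtain ⟨p, ℓ, hp, hpv⟩ := exists_isRooting hX.connected hadj
  obtain ⟨s, hs, hs0, hs'⟩ := (hpre.exists_extremal hadj hg').1
  obtain ⟨s₁, hs₁, hs₁0, hs₁'⟩ := (hpre.exists_extremal hadj hg).2
  have hex : ∀ t, t ≠ v → ∃ k ≤ b (p t) t, U (p t) ≤ H0 (A (p t) - stepDiv (w (p t)) (p t) t k) ∧
      ∃ f ∈ U t, f ≠ 0 ∧ f ∈ H0 (A t - stepDiv (w t) t (p t) (b (p t) t - k)) :=
    fun t ht => hpre.exists_split (hp.adj t ht)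
  choose! k hk hk1 f hf hf0 hf1 using hex
  let f₁ : ∀ u, (X.comp u).K := Function.update (Function.update f v' s₁) v s
  have e1 : f₁ v = s := Function.update_self ..
  have e2 : f₁ v' = s₁ := by
    simp only [f₁]
    rw [Function.update_of_ne hadj.1.symm, Function.update_self]
  have e3 : ∀ u, u ≠ v → u ≠ v' → f₁ u = f u := by
    intro u hu hu'
    simp only [f₁]
    rw [Function.update_of_ne hu, Function.update_of_ne hu']
  -- The orders on the two sides of the edge `v v'` are chosen independently: `j` for the section on
  -- `Z_{v'}` and `j'` for the one on `Z_v`.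
  let k₁ := Function.update k v' j
  let K₁ := Function.update k v' j'
  have e4 : k₁ v' = j := Function.update_self ..
  have e5 : K₁ v' = j' := Function.update_self ..
  have e6 : ∀ u, u ≠ v' → k₁ u = k u := fun u hu => Function.update_of_ne hu ..
  have e7 : ∀ u, u ≠ v' → K₁ u = k u := fun u hu => Function.update_of_ne hu ..
  have hmem : ∀ u, f₁ u ∈ U u := by
    intro u
    by_cases hu : u = v
    · subst hu
      rwa [e1]
    by_cases hu' : u = v'
    · subst hu'
      rwa [e2]
    rw [e3 u hu hu']
    exact hf u hu
  have hmain := hp.sum_degree_le_total (f := f₁) (k := k₁) (K := K₁) hX ht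
    (fun u => (hpre.1 u).1) ?_ ?_ (fun u => (hpre.1 u).2.1 (hmem u)) ?_ ?_
  · rw [Finset.sum_eq_single_of_mem v' (Finset.mem_erase.2 ⟨hadj.1.symm, Finset.mem_univ _⟩)] at hmain
    · rwa [hpv, e4, e5] at hmain
    · intro t _ htv
      rw [e6 t htv, e7 t htv, sub_self]
  · intro t ht
    by_cases h : t = v'
    · subst h
      rw [e4, hpv]
      exact hj
    · rw [e6 t h]
      exact hk t ht
  · intro u
    by_cases hu : u = v
    · subst hu
      rwa [e1]
    by_cases hu' : u = v'
    · subst hu'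
      rwa [e2]
    rw [e3 u hu hu']
    exact hf0 u hu
  · intro u hu
    by_cases hu' : u = v'
    · subst hu'
      rw [e2, e4, hpv]
      exact hs₁'
    rw [e3 u hu hu', e6 u hu']
    exact hf1 u hu
  · intro t ht
    by_cases h : t = v'
    · subst h
      rw [e5, hpv, e1]
      exact hs'
    · rw [e7 t h]
      exact hk1 t ht (hmem _)

/-- The edges where extremal sections of different orders meet form a forest, so torus elements
prescribed up to scalars at the extremal orders come from a single one. -/
theorem IsPreLimit.exists_common_torus (hpre : IsPreLimit w b r A U) (hX : X.IsPseudocompact)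
    (ht : IsTight w b) {v v' : X.V} (hadj : X.mergedGraph.Adj v v')
    (hthree : (X.edges v v').card ≤ 3) {d : ℤ}
    (hgeneral : ∀ x : X.E → ℤ, ∑ i ∈ X.edges v v', x i * (n i : ℤ) = 0 →
      ∀ j ∈ X.edges v v', (∀ i ∈ X.edges v v', 0 < x i ↔ i = j) →
        d < ∑ i ∈ X.edges v v', x j * (n j : ℤ) / (n i : ℤ))
    (hd : (w v).total ≤ d) (ρ : ℕ → X.E → κˣ) :
    ∃ μ : X.E → κˣ, ∀ j ≤ b v v', 0 < extremalCount w b r A U v v' j →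
      ∃ c : κˣ, ∀ e ∈ twistEdges w v v' j, μ e = c * ρ j e := by
  classical
  let J : Set ℕ := {j | j ≤ b v v' ∧ 0 < extremalCount w b r A U v v' j}
  have hsub : ∀ j, twistEdges w v v' j ⊆ X.edges v v' := fun j => Finset.filter_subset _ _
  have hrel : ∀ i ∈ J, ∀ k ∈ J, i < k → ∀ (x : X.E → ℤ), ∑ e ∈ X.edges v v', x e * (n e : ℤ) = 0 →
      ∀ e ∈ X.edges v v', (∀ e' ∈ X.edges v v', 0 < x e' ↔ e' = e) → x e * (n e : ℤ) = k - i →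
        False := by
    intro i hi k hk hik x hx e he hpos hxe
    have h1 := hgeneral x hx e he hpos
    rw [hxe] at h1
    have h2 := sum_div_le_degree_sub (w v) v v' hik.le
    have h3 := hpre.degree_sub_le_total hX ht hadj hi.1 hi.2 hk.2
    omega
  have hdvd : ∀ i k e, e ∈ twistEdges w v v' i → e ∈ twistEdges w v v' k →
      ∃ c : ℤ, (k : ℤ) - i = c * n e := by
    intro i k e hi hk
    rw [twistEdges_eq_stepEdges] at hi hk
    obtain ⟨c, hc⟩ := dvd_sub_of_mem_stepEdges hi hk
    exact ⟨c, by rw [hc, mul_comm]⟩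
  have hsign : ∀ (c : ℤ) (e : X.E), 0 < c * n e ↔ 0 < c := fun c e =>
    mul_pos_iff_of_pos_right (by exact_mod_cast (n e).pos)
  suffices hmain : ∃ μ : X.E → κˣ, ∀ j ∈ J, ∃ c : κˣ, ∀ e ∈ twistEdges w v v' j,
      μ e = c * ρ j e by
    obtain ⟨μ, hμ⟩ := hmain
    exact ⟨μ, fun j hj hg => hμ j ⟨hj, hg⟩⟩
  refine exists_torus_of_forest hthree hadj.2 hsub ?_ ?_ ρ
  · intro i hi k hk hik e he he' e' he₁ he₁'
    by_contra hne
    obtain ⟨c, hc⟩ := hdvd i k e he he'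
    obtain ⟨c', hc'⟩ := hdvd i k e' he₁ he₁'
    have h1 := (hsign c e).1 (by rw [← hc]; omega)
    have h2 := (hsign c' e').1 (by rw [← hc']; omega)
    -- Two common edges give `c * n e = k - i = c' * n e'`, a relation with one positive
    -- coefficient.
    refine hrel i hi k hk hik (fun y => if y = e then c else if y = e' then -c' else 0) ?_ e
      (hsub _ he) ?_ (by simp [hc])
    · rw [Finset.sum_eq_add_of_mem e e' (hsub _ he) (hsub _ he₁) hne]
      · simp only [if_true, if_neg (Ne.symm hne)]
        linarith
      · rintro y - ⟨hy, hy'⟩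
        simp [hy, hy']
    · intro y _
      by_cases hy : y = e
      · simp [hy, h1]
      · simp only [hy, if_false, iff_false]
        split_ifs <;> omega
  · intro i hi j hj k hk hij hjk e he₁ he₂ e' he₁' he₂' e'' he₁'' he₂'' hne hne' hne''
    obtain ⟨c, hc⟩ := hdvd i j e he₁ he₂
    obtain ⟨c', hc'⟩ := hdvd j k e' he₁' he₂'
    obtain ⟨c'', hc''⟩ := hdvd i k e'' he₁'' he₂''
    have h1 := (hsign c e).1 (by rw [← hc]; omega)
    have h2 := (hsign c' e').1 (by rw [← hc']; omega)
    have h3 := (hsign c'' e'').1 (by rw [← hc'']; omega)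
    -- A triangle gives the relation `k - i = (j - i) + (k - j)`, each difference being a multiple
    -- of `n` at a different edge.
    let x : X.E → ℤ := fun y => if y = e'' then c'' else if y = e then -c else if y = e' then -c'
      else 0
    have x1 : x e'' = c'' := by simp [x]
    have x2 : x e = -c := by simp [x, hne']
    have x3 : x e' = -c' := by simp [x, hne'', hne.symm]
    refine hrel i hi k hk (hij.trans hjk) x ?_ e'' (hsub _ he₁'') ?_ (by rw [x1, hc''])
    · have hsum : ∑ y ∈ X.edges v v', x y * (n y : ℤ) =
          ∑ y ∈ ({e'', e, e'} : Finset X.E), x y * (n y : ℤ) := by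
        symm
        refine Finset.sum_subset ?_ ?_
        · intro y hy
          simp only [Finset.mem_insert, Finset.mem_singleton] at hy
          rcases hy with rfl | rfl | rfl
          · exact hsub _ he₁''
          · exact hsub _ he₁
          · exact hsub _ he₁'
        · intro y _ hy
          simp only [Finset.mem_insert, Finset.mem_singleton, not_or] at hy
          simp [x, hy.1, hy.2.1, hy.2.2]
      rw [hsum, Finset.sum_insert (by simp [hne'.symm, hne''.symm]), Finset.sum_pair hne, x1, x2, x3]
      linarith
    · intro y _
      by_cases hy : y = e''
      · simp [hy, x1, h3]
      · simp only [x, hy, if_false, iff_false]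
        split_ifs <;> omega

end NodalCurve
end OssermanLLS

namespace OssermanLLS

/-! ### Subspaces up to the torus action -/

section Torus

open NodalCurve

variable {κ : Type u} [Field κ] {I : Type}

/-- The action of a torus element on `κ^I`. -/
def scale (ρ : I → κˣ) : (I → κ) ≃ₗ[κ] (I → κ) :=
  LinearEquiv.piCongrRight fun e => LinearEquiv.smulOfUnit (ρ e)

theorem scale_apply (ρ : I → κˣ) (x : I → κ) (e : I) : scale ρ x e = ρ e * x e := rfl

theorem scale_mem_torusOrbit {ρ : I → κˣ} {x : I → κ} {T : Set I} :
    scale ρ x ∈ (torusOrbit T : Set (I → κ)) ↔ x ∈ (torusOrbit T : Set (I → κ)) := by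
  simp only [torusOrbit, Set.mem_ofPred_eq, scale_apply, ne_eq, mul_eq_zero, Units.ne_zero, false_or]

theorem finrank_span_torusOrbit_scale (ρ : I → κˣ) (W : Submodule κ (I → κ)) (T : Set I) :
    Module.finrank κ (Submodule.span κ (torusOrbit T ∩ {x | x ∈ W.map (scale ρ).toLinearMap})) =
      Module.finrank κ (Submodule.span κ (torusOrbit T ∩ {x | x ∈ W})) := by
  have h : torusOrbit T ∩ {x | x ∈ W.map (scale ρ).toLinearMap} =
      (scale ρ).toLinearMap '' (torusOrbit T ∩ {x | x ∈ W}) := by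
    ext y
    constructor
    · rintro ⟨h1, x, hx, rfl⟩
      exact ⟨x, ⟨scale_mem_torusOrbit.1 h1, hx⟩, rfl⟩
    · rintro ⟨x, ⟨h1, hx⟩, rfl⟩
      exact ⟨scale_mem_torusOrbit.2 h1, x, hx, rfl⟩
  rw [h, Submodule.span_image]
  exact LinearEquiv.finrank_map_eq _ _

/-- The span of the intersection with an orbit detects its emptiness, except for the orbit `{0}`;
hence `T` has to be nonempty. -/
theorem torusOrbit_inter_nonempty [Fintype I] {W W' : Submodule κ (I → κ)} {T : Set I}
    (hT : T.Nonempty)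
    (h : Module.finrank κ (Submodule.span κ (torusOrbit T ∩ {x | x ∈ W})) =
      Module.finrank κ (Submodule.span κ (torusOrbit T ∩ {x | x ∈ W'})))
    (hW : (torusOrbit T ∩ {x | x ∈ W}).Nonempty) : (torusOrbit T ∩ {x | x ∈ W'}).Nonempty := by
  by_contra hcon
  rw [Set.not_nonempty_iff_eq_empty] at hcon
  rw [hcon, Submodule.span_empty, finrank_bot, Submodule.finrank_eq_zero,
    Submodule.span_eq_bot] at h
  obtain ⟨x, hx⟩ := hW
  obtain ⟨e, he⟩ := hT
  exact (hx.1 e).2 he (by rw [h x hx]; rfl)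

/-- Two subspaces of equal dimension of a space of dimension at most three which meet the same
torus orbits differ by a torus element. -/
theorem exists_scale_map_eq [Fintype I] (hI : Fintype.card I ≤ 3) {W W' : Submodule κ (I → κ)}
    (hdim : Module.finrank κ W = Module.finrank κ W')
    (h : ∀ T : Set I, Module.finrank κ (Submodule.span κ (torusOrbit T ∩ {x | x ∈ W})) =
      Module.finrank κ (Submodule.span κ (torusOrbit T ∩ {x | x ∈ W'}))) :
    ∃ ρ : I → κˣ, W.map (scale ρ).toLinearMap = W' := by
  classical
  have hfin : ∀ ρ : I → κˣ, Module.finrank κ (W.map (scale ρ).toLinearMap) =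
      Module.finrank κ W' := fun ρ => by rw [LinearEquiv.finrank_map_eq, hdim]
  have hsuff : ∀ ρ : I → κˣ, (∀ x ∈ W, scale ρ x ∈ W') → W.map (scale ρ).toLinearMap = W' := by
    intro ρ hρ
    refine Submodule.eq_of_le_of_finrank_eq ?_ (hfin ρ)
    rintro _ ⟨x, hx, rfl⟩
    exact hρ x hx
  have htop : Module.finrank κ (I → κ) = Fintype.card I := Module.finrank_fintype_fun_eq_card κ
  have hle := Submodule.finrank_le W
  rw [htop] at hle
  have hex : ∀ z : I → κ, ∃ ρ : I → κˣ, ∀ e, z e ≠ 0 → (ρ e : κ) = z e := fun z =>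
    ⟨fun e => if he : z e = 0 then 1 else Units.mk0 (z e) he, fun e he => by simp [he]⟩
  rcases Nat.eq_zero_or_pos (Module.finrank κ W) with h0 | h0
  · refine ⟨1, hsuff 1 fun x hx => ?_⟩
    rw [Submodule.finrank_eq_zero.1 h0] at hx
    rw [(Submodule.mem_bot κ).1 hx, map_zero]
    exact W'.zero_mem
  -- A line: `W'` contains a vector with the same support as a generator of `W`, and the quotient of
  -- the coordinates on the support gives `ρ`.
  rcases eq_or_ne (Module.finrank κ W) 1 with h1 | h1
  · obtain ⟨⟨x, hxW⟩, hx0, hspan⟩ := finrank_eq_one_iff'.1 h1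
    have hx0' : x ≠ 0 := fun h => hx0 (Subtype.ext h)
    have hT : (Function.support x).Nonempty := Function.support_nonempty_iff.2 hx0'
    obtain ⟨y, hy, hyW⟩ := torusOrbit_inter_nonempty hT (h (Function.support x))
      ⟨x, fun e => Iff.rfl, hxW⟩
    obtain ⟨ρ, hρ⟩ := hex fun e => y e / x e
    refine ⟨ρ, hsuff ρ fun z hz => ?_⟩
    obtain ⟨c, hc⟩ := hspan ⟨z, hz⟩
    have hc' : c • x = z := congrArg Subtype.val hc
    have hxy : scale ρ x = y := by
      funext e
      rw [scale_apply]
      by_cases he : x e = 0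
      · rw [he, mul_zero]
        by_contra hcon
        exact (hy e).1 (Ne.symm hcon) he
      · rw [hρ e (div_ne_zero ((hy e).2 he) he), div_mul_cancel₀ _ he]
    rw [← hc', map_smul, hxy]
    exact W'.smul_mem c hyW
  rcases eq_or_ne (Module.finrank κ W) (Fintype.card I) with h2 | h2
  · refine ⟨1, hsuff 1 fun x _ => ?_⟩
    have : W' = ⊤ := Submodule.eq_top_of_finrank_eq (by rw [← hdim, h2, htop])
    rw [this]
    trivial
  -- In a space of dimension at most three only hyperplanes remain.
  have h3 : Module.finrank κ W + 1 = Fintype.card I := by omega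
  have hyper : ∀ W : Submodule κ (I → κ), Module.finrank κ W + 1 = Fintype.card I →
      ∃ f : (I → κ) →ₗ[κ] κ, ∀ x, x ∈ W ↔ f x = 0 := by
    intro W hW
    have hlt : W < ⊤ := by
      refine lt_top_iff_ne_top.2 fun hcon => ?_
      rw [hcon, finrank_top, htop] at hW
      omega
    obtain ⟨f, hf0, hf⟩ := Submodule.exists_le_ker_of_lt_top W hlt
    have h4 := f.finrank_range_add_finrank_ker
    rw [LinearMap.range_eq_top.2 (LinearMap.surjective hf0), finrank_top, Module.finrank_self,
      htop] at h4
    have h5 : W = LinearMap.ker f := Submodule.eq_of_le_of_finrank_eq hf (by omega)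
    exact ⟨f, fun x => by rw [h5, LinearMap.mem_ker]⟩
  obtain ⟨f, hf⟩ := hyper W h3
  obtain ⟨f', hf'⟩ := hyper W' (hdim ▸ h3)
  have hsingle : ∀ W₁ W₂ : Submodule κ (I → κ),
      (∀ T : Set I, Module.finrank κ (Submodule.span κ (torusOrbit T ∩ {x | x ∈ W₁})) =
      Module.finrank κ (Submodule.span κ (torusOrbit T ∩ {x | x ∈ W₂}))) →
      ∀ e : I, Pi.single e (1 : κ) ∈ W₁ → Pi.single e (1 : κ) ∈ W₂ := by
    intro W₁ W₂ h12 e he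
    obtain ⟨y, hy, hyW⟩ := torusOrbit_inter_nonempty (T := {e}) ⟨e, rfl⟩ (h12 {e})
      ⟨Pi.single e 1, fun e' => by
        by_cases he' : e' = e
        · subst he'
          simp
        · simp [he'], he⟩
    have h5 : y = y e • Pi.single e (1 : κ) := by
      funext e'
      by_cases he' : e' = e
      · subst he'
        simp
      · have : y e' = 0 := by
          by_contra hcon
          exact he' ((hy e').1 hcon)
        simp [he', this]
    have h6 : y e ≠ 0 := (hy e).2 rfl
    have h7 := W₂.smul_mem (y e)⁻¹ hyW
    rwa [h5, smul_smul, Pi.smul_apply, Pi.single_eq_same, smul_eq_mul, mul_one,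
      inv_mul_cancel₀ h6, one_smul] at h7
  -- One-element supports show that both hyperplanes contain the same unit vectors, so their
  -- equations have the same support and differ by a torus element.
  have hzero : ∀ e, f (Pi.single e 1) = 0 ↔ f' (Pi.single e 1) = 0 := fun e => by
    rw [← hf, ← hf']
    exact ⟨hsingle W W' h e, hsingle W' W (fun T => (h T).symm) e⟩
  obtain ⟨ρ, hρ⟩ := hex fun e => f (Pi.single e 1) / f' (Pi.single e 1)
  refine ⟨ρ, hsuff ρ fun x hx => ?_⟩
  rw [hf, LinearMap.pi_apply_eq_sum_univ] at hx
  rw [hf', LinearMap.pi_apply_eq_sum_univ]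
  refine Eq.trans ?_ hx
  refine Finset.sum_congr rfl fun e _ => ?_
  have hsin : (fun j => if e = j then (1 : κ) else 0) = Pi.single e 1 := by
    funext j
    rw [Pi.single_apply]
    simp only [eq_comm]
  simp only [hsin]
  rw [scale_apply, smul_eq_mul, smul_eq_mul]
  by_cases he : f' (Pi.single e 1) = 0
  · rw [he, (hzero e).2 he, mul_zero, mul_zero]
  · rw [hρ e (div_ne_zero (mt (hzero e).1 he) he)]
    field_simp

end Torus

/-! ### Leading terms of sections -/

section Lead

variable {κ : Type u} [Field κ] {C : Curve κ} {ι : Type*}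

/-- The coordinates of the values of a section of `𝒪(B)` at the points `P e`. -/
noncomputable def lead (B : Divisor C) (P : ι → Point C) (f : C.K) : ι → κ :=
  fun e => (P e).coeff (B (P e)) f

theorem lead_add {B : Divisor C} (P : ι → Point C) {f g : C.K} (hf : f ∈ H0 B) (hg : g ∈ H0 B) :
    lead B P (f + g) = lead B P f + lead B P g :=
  funext fun e => (P e).coeff_add (hf (P e)) (hg (P e))

theorem lead_smul {B : Divisor C} (P : ι → Point C) (c : κ) {f : C.K} (hf : f ∈ H0 B) :
    lead B P (c • f) = c • lead B P f :=
  funext fun e => (P e).coeff_smul c (hf (P e))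

theorem lead_sum {ι' : Type*} {B : Divisor C} (P : ι → Point C) (G : Finset ι') (c : ι' → κ)
    {y : ι' → C.K} (hy : ∀ l ∈ G, y l ∈ H0 B) :
    lead B P (∑ l ∈ G, c l • y l) = ∑ l ∈ G, c l • lead B P (y l) := by
  classical
  induction G using Finset.induction_on with
  | empty =>
    have := lead_smul (B := B) P 0 (f := 0) (Submodule.zero_mem _)
    rw [zero_smul, zero_smul] at this
    rw [Finset.sum_empty, Finset.sum_empty, this]
  | insert l G hl ih =>
    have h1 := hy l (Finset.mem_insert_self _ _)
    have h2 : ∀ l ∈ G, y l ∈ H0 B := fun l hl => hy l (Finset.mem_insert_of_mem hl)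
    rw [Finset.sum_insert hl, Finset.sum_insert hl, lead_add P (Submodule.smul_mem _ _ h1)
      (Submodule.sum_mem _ fun l hl => Submodule.smul_mem _ _ (h2 l hl)), lead_smul P _ h1, ih h2]

theorem lead_eq_zero_iff [Fintype ι] {B : Divisor C} {P : ι → Point C}
    (hP : Function.Injective P) {f : C.K} (hf : f ∈ H0 B) :
    lead B P f = 0 ↔ f ∈ H0 (B - ∑ e, Finsupp.single (P e) 1) := by
  classical
  have h1 : lead B P f = 0 ↔ ∀ e, f ∈ H0 (B - Finsupp.single (P e) 1) := by
    rw [funext_iff]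
    exact forall_congr' fun e => coeff_eq_zero_iff_mem hf
  rw [h1]
  constructor
  · intro h
    refine mem_H0_sub_sum _ (fun i _ j _ hij Q => ?_) hf fun e _ => h e
    by_contra! hcon
    simp only [Finsupp.single_apply, ne_eq, ite_eq_right_iff, one_ne_zero, imp_false, not_not]
      at hcon
    exact hij (hP (hcon.1.trans hcon.2.symm))
  · intro h e
    refine H0_mono (sub_le_sub_left ?_ B) h
    refine Finset.single_le_sum (f := fun e => (Finsupp.single (P e) 1 : Divisor C))
      (fun e _ Q => ?_) (Finset.mem_univ e)
    rw [Finsupp.single_apply]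
    split_ifs <;> simp

/-- On the sections in `U(-D)`, the kernel of taking values at the points `P e` is `U(-D')`. So
independence in a graded piece can be tested on leading terms. -/
theorem linearIndepOn_lead_iff {ι' : Type*} [Fintype ι] {U : Submodule κ C.K} {A D D' : Divisor C}
    {P : ι → Point C} (hP : Function.Injective P) (hD : D' = D + ∑ e, Finsupp.single (P e) 1)
    {G : Finset ι'} {y : ι' → C.K} (hy : ∀ l ∈ G, y l ∈ vanishing U A D) :
    LinearIndepOn κ (fun l => (vanishing U A D').mkQ (y l)) (G : Set ι') ↔
      LinearIndepOn κ (fun l => lead (A - D) P (y l)) (G : Set ι') := by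
  rw [linearIndepOn_finset_iff, linearIndepOn_finset_iff]
  refine forall_congr' fun c => ?_
  have h1 : ∑ l ∈ G, c l • y l ∈ vanishing U A D :=
    Submodule.sum_mem _ fun l hl => Submodule.smul_mem _ _ (hy l hl)
  have h2 : ∑ l ∈ G, c l • (vanishing U A D').mkQ (y l) = 0 ↔
      ∑ l ∈ G, c l • lead (A - D) P (y l) = 0 := by
    rw [← lead_sum P G c fun l hl => (hy l hl).2, lead_eq_zero_iff hP h1.2]
    have h3 : ∑ l ∈ G, c l • (vanishing U A D').mkQ (y l) =
        (vanishing U A D').mkQ (∑ l ∈ G, c l • y l) := by simp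
    rw [h3, Submodule.mkQ_apply, Submodule.Quotient.mk_eq_zero, vanishing, Submodule.mem_inf, hD,
      sub_add_eq_sub_sub]
    exact and_iff_right h1.1
  rw [h2]

end Lead
end OssermanLLS

namespace OssermanLLS
namespace NodalCurve

/-! ### Changing the glueing of a line bundle -/

section Rescale

variable {κ : Type u} [Field κ] {X : NodalCurve κ} {n : X.E → ℕ+}

/-- Rescaling the glueing isomorphisms of a line bundle at the first node of each chain. -/
def LineBundle.rescale (g : X.E → κˣ) (L : (X.withChains n).LineBundle) :
    (X.withChains n).LineBundle where
  D := L.D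
  glue p := if p.2.val = 0 then g p.1 * L.glue p else L.glue p

/-- The factor by which `rescale g` changes the identification of fibres along the chain of `e`
starting at `v`. -/
def orient (g : X.E → κˣ) (e : X.E) (v : X.V) : κˣ := if X.tail e = v then g e else (g e)⁻¹

theorem LineBundle.rescale_one (L : (X.withChains n).LineBundle) : L.rescale 1 = L := by
  rw [LineBundle.rescale]
  cases L
  congr
  funext p
  dsimp only
  split_ifs <;> simp

theorem LineBundle.inDegree_rescale (g : X.E → κˣ) (L : (X.withChains n).LineBundle)
    (O : (X.withChains n).EnrichedStructure) (w₀ w : X.Multidegree n) :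
    (L.rescale g).inDegree O w₀ w = (L.inDegree O w₀ w).rescale g := by
  unfold LineBundle.inDegree LineBundle.rescale LineBundle.twistBy
  congr
  funext p
  dsimp only
  split_ifs
  · rw [mul_assoc]
  · rfl

theorem chainNode_false_succ (e : X.E) {p : ℕ} (hp : p + 1 < n e) :
    X.chainNode n ⟨e, ⟨p + 1, hp⟩⟩ false = ⟨Sum.inr ⟨e, ⟨p, by omega⟩⟩, pointInfty κ⟩ := by
  unfold chainNode
  exact dif_neg (Nat.succ_ne_zero p)

theorem chainNode_true_of_lt (e : X.E) {p : ℕ} (hp : p + 1 < n e) :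
    X.chainNode n ⟨e, ⟨p, by omega⟩⟩ true = ⟨Sum.inr ⟨e, ⟨p, by omega⟩⟩, pointZero κ⟩ := by
  unfold chainNode
  exact dif_neg hp.ne

theorem edges_cases {v v' : X.V} (hne : v ≠ v') {e : X.E} (he : e ∈ X.edges v v') :
    (X.tail e = v ∧ X.branch e v = X.node e false ∧ X.branch e v' = X.node e true) ∨
      (X.tail e ≠ v ∧ X.branch e v = X.node e true ∧ X.branch e v' = X.node e false) := by
  rw [mem_edges] at he
  rcases he with ⟨h1, h2⟩ | ⟨h1, h2⟩
  · exact Or.inl ⟨h1, by rw [branch, if_pos h1], by rw [branch, if_neg (h1.trans_ne hne)]⟩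
  · exact Or.inr ⟨h1.trans_ne hne.symm, by rw [branch, if_neg (h1.trans_ne hne.symm)],
      by rw [branch, if_pos h1]⟩

theorem exists_branch_eq {v v' : X.V} {e : X.E} (he : e ∈ X.edges v v') :
    ∃ P, X.branch e v = ⟨v, P⟩ := by
  have h := branch_fst he
  generalize X.branch e v = x at h
  obtain ⟨x, P⟩ := x
  dsimp only at h
  subst h
  exact ⟨P, rfl⟩

end Rescale

/-! ### Transport of fibres along the inserted chains -/

section Transport

variable {κ : Type u} [Field κ] [IsAlgClosed κ] {X : NodalCurve κ} {n : X.E → ℕ+}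

/-- The scalar by which a line bundle of degree zero along the chain of `e` identifies the fibre
at the tail with the fibre at the point `∞` of the component at distance `p`. -/
noncomputable def chainTransport (M : (X.withChains n).LineBundle) (e : X.E) : ℕ → κˣ
  | 0 => 1
  | p + 1 => chainTransport M e p * (if h : p < n e then M.glue ⟨e, ⟨p, h⟩⟩ else 1) *
      (if h : p < (n e : ℕ) - 1 then
        coeffRatio (C := projectiveLine κ) (M.D (Sum.inr ⟨e, ⟨p, h⟩⟩)) (pointZero κ) (pointInfty κ)
      else 1)

/-- The scalar identifying the fibres at the two ends of the chain of `e`, starting at `v`. -/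
noncomputable def sideTransport (M : (X.withChains n).LineBundle) (e : X.E) (v : X.V) : κˣ :=
  orient (fun e => chainTransport M e (n e)) e v

/-- Only the glueing at the first node of the chain is changed, so the factor `g e` enters exactly
once, at the first step. -/
theorem chainTransport_rescale (g : X.E → κˣ) (M : (X.withChains n).LineBundle) (e : X.E) (p : ℕ) :
    chainTransport (M.rescale g) e (p + 1) = g e * chainTransport M e (p + 1) := by
  induction p with
  | zero =>
    have := (n e).pos
    simp only [chainTransport, LineBundle.rescale, dif_pos this, if_true, one_mul, mul_assoc]
  | succ p ih =>
    rw [chainTransport, ih, chainTransport.eq_2 M e (p + 1)]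
    simp only [LineBundle.rescale, Nat.succ_ne_zero, if_false, mul_assoc]

theorem sideTransport_rescale (g : X.E → κˣ) (M : (X.withChains n).LineBundle) (e : X.E) (v : X.V) :
    sideTransport (M.rescale g) e v = orient g e v * sideTransport M e v := by
  have h : chainTransport (M.rescale g) e (n e) = g e * chainTransport M e (n e) := by
    have h1 : (n e : ℕ) = (n e : ℕ) - 1 + 1 := by
      have := (n e).pos
      omega
    rw [h1]
    exact chainTransport_rescale g M e _
  unfold sideTransport orient
  split_ifs
  · exact h
  · dsimp only
    rw [h, mul_inv]

variable {M : (X.withChains n).LineBundle} {e : X.E}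

/-- Along the chain, a node contributes its glueing scalar and a line of degree zero contributes the
ratio of the values at `∞` and `0`. -/
theorem valueAt_false (t : ∀ u, ((X.withChains n).comp u).K)
    (hdeg : ∀ k, (M.D (Sum.inr ⟨e, k⟩)).degree = 0)
    (ht : ∀ k, t (Sum.inr ⟨e, k⟩) ∈ H0 (M.D (Sum.inr ⟨e, k⟩)))
    (hm : ∀ (p : ℕ) (hp : p + 1 < n e), M.MatchesAt ⟨e, ⟨p, by omega⟩⟩ t) {p : ℕ} (hp : p < n e) :
    (X.withChains n).valueAt M.D t (X.chainNode n ⟨e, ⟨p, hp⟩⟩ false) =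
      chainTransport M e p * (X.withChains n).valueAt M.D t
        ⟨Sum.inl (X.node e false).1, (X.node e false).2⟩ := by
  induction p with
  | zero => rw [chainNode_false_zero, chainTransport, Units.val_one, one_mul]
  | succ p ih =>
    have h1 := hm p hp
    rw [LineBundle.MatchesAt] at h1
    have h2 := ih (by omega)
    have h3 : (X.withChains n).valueAt M.D t (X.chainNode n ⟨e, ⟨p + 1, hp⟩⟩ false) =
        coeffRatio (C := projectiveLine κ) (M.D (Sum.inr ⟨e, ⟨p, by omega⟩⟩)) (pointZero κ)
          (pointInfty κ) *
        (X.withChains n).valueAt M.D t (X.chainNode n ⟨e, ⟨p, by omega⟩⟩ true) := by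
      rw [chainNode_false_succ, chainNode_true_of_lt e hp]
      exact coeff_eq_coeffRatio_mul (C := projectiveLine κ) (hdeg _) (pointZero κ) (pointInfty κ)
        (ht _)
    rw [h3, ← h1]
    change _ * (_ * (X.withChains n).valueAt M.D t (X.chainNode n ⟨e, ⟨p, _⟩⟩ false)) = _
    rw [h2, chainTransport, dif_pos (show p < n e by omega), dif_pos (show p < (n e : ℕ) - 1 by omega)]
    push_cast
    ring

theorem valueAt_head (t : ∀ u, ((X.withChains n).comp u).K)
    (hdeg : ∀ k, (M.D (Sum.inr ⟨e, k⟩)).degree = 0)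
    (ht : ∀ k, t (Sum.inr ⟨e, k⟩) ∈ H0 (M.D (Sum.inr ⟨e, k⟩)))
    (hm : ∀ p, M.MatchesAt ⟨e, p⟩ t) :
    (X.withChains n).valueAt M.D t ⟨Sum.inl (X.node e true).1, (X.node e true).2⟩ =
      chainTransport M e (n e) * (X.withChains n).valueAt M.D t
        ⟨Sum.inl (X.node e false).1, (X.node e false).2⟩ := by
  have hpos := (n e).pos
  obtain ⟨m, hmm⟩ : ∃ m, (n e : ℕ) = m + 1 := ⟨(n e : ℕ) - 1, by omega⟩
  have h1 := hm ⟨m, by omega⟩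
  have h2 := valueAt_false t hdeg ht (fun p hp => hm _) (p := m) (by omega)
  rw [LineBundle.MatchesAt] at h1
  change _ * (X.withChains n).valueAt M.D t (X.chainNode n ⟨e, ⟨m, _⟩⟩ false) =
    (X.withChains n).valueAt M.D t (X.chainNode n ⟨e, ⟨m, _⟩⟩ true) at h1
  rw [chainNode_true_last e _ (by dsimp only; omega), h2] at h1
  rw [← h1]
  have h3 : chainTransport M e (n e) = chainTransport M e m * M.glue ⟨e, ⟨m, by omega⟩⟩ := by
    have h4 : chainTransport M e (n e) = chainTransport M e (m + 1) := by rw [← hmm]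
    rw [h4, chainTransport, dif_pos (show m < n e by omega),
      dif_neg (show ¬ m < (n e : ℕ) - 1 by omega), mul_one]
  rw [h3]
  push_cast
  ring

/-- Sections along the chain of `e` with prescribed value at the tail. -/
theorem exists_chain_sections (hM : ∀ k, LinEquiv (M.D (Sum.inr ⟨e, k⟩)) 0) (x : κ) :
    ∃ t : ∀ k : Fin ((n e : ℕ) - 1), ((X.withChains n).comp (Sum.inr ⟨e, k⟩)).K,
      (∀ k, t k ∈ H0 (M.D (Sum.inr ⟨e, k⟩))) ∧
      ∀ k, (pointZero κ).coeff (M.D (Sum.inr ⟨e, k⟩) (pointZero κ)) (t k) =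
        chainTransport M e k * M.glue ⟨e, ⟨k, by have := k.isLt; omega⟩⟩ * x := by
  choose t h1 h2 using fun k : Fin ((n e : ℕ) - 1) =>
    exists_coeff_eq (C := projectiveLine κ) (hM k) (pointZero κ)
      (chainTransport M e k * M.glue ⟨e, ⟨k, by have := k.isLt; omega⟩⟩ * x)
  exact ⟨t, h1, h2⟩

/-- The value at `0` on each line is prescribed so that the preceding node matches, and degree zero
determines the value at `∞`. Only the last node imposes a condition on the two ends. -/
theorem matchesAt_of_chain_sections (t : ∀ u, ((X.withChains n).comp u).K)
    (hdeg : ∀ k, (M.D (Sum.inr ⟨e, k⟩)).degree = 0)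
    (ht : ∀ k, t (Sum.inr ⟨e, k⟩) ∈ H0 (M.D (Sum.inr ⟨e, k⟩)))
    (hx : ∀ k : Fin ((n e : ℕ) - 1),
      (pointZero κ).coeff (M.D (Sum.inr ⟨e, k⟩) (pointZero κ)) (t (Sum.inr ⟨e, k⟩)) =
        chainTransport M e k * M.glue ⟨e, ⟨k, by have := k.isLt; omega⟩⟩ *
        (X.withChains n).valueAt M.D t ⟨Sum.inl (X.node e false).1, (X.node e false).2⟩)
    (hhead : (X.withChains n).valueAt M.D t ⟨Sum.inl (X.node e true).1, (X.node e true).2⟩ =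
      chainTransport M e (n e) * (X.withChains n).valueAt M.D t
        ⟨Sum.inl (X.node e false).1, (X.node e false).2⟩) (k : Fin (n e)) :
    M.MatchesAt ⟨e, k⟩ t := by
  set x := (X.withChains n).valueAt M.D t ⟨Sum.inl (X.node e false).1, (X.node e false).2⟩ with hxdef
  have hfalse : ∀ (p : ℕ) (hp : p < n e),
      (X.withChains n).valueAt M.D t (X.chainNode n ⟨e, ⟨p, hp⟩⟩ false) =
        chainTransport M e p * x := by
    intro p hp
    cases p with
    | zero => rw [chainNode_false_zero, chainTransport, Units.val_one, one_mul]
    | succ p =>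
      rw [chainNode_false_succ]
      refine (coeff_eq_coeffRatio_mul (C := projectiveLine κ) (hdeg ⟨p, by omega⟩) (pointZero κ)
        (pointInfty κ) (ht _)).trans ((congrArg (_ * ·) (hx ⟨p, by omega⟩)).trans ?_)
      dsimp only
      rw [chainTransport, dif_pos (show p < n e by omega),
        dif_pos (show p < (n e : ℕ) - 1 by omega)]
      push_cast
      ring
  obtain ⟨p, hp⟩ := k
  rw [LineBundle.MatchesAt]
  change _ * (X.withChains n).valueAt M.D t (X.chainNode n ⟨e, ⟨p, hp⟩⟩ false) =
    (X.withChains n).valueAt M.D t (X.chainNode n ⟨e, ⟨p, hp⟩⟩ true)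
  rw [hfalse]
  rcases (Nat.succ_le_of_lt hp).lt_or_eq with h | h
  · rw [chainNode_true_of_lt e h]
    refine Eq.trans ?_ (hx ⟨p, by omega⟩).symm
    ring
  · rw [chainNode_true_last e _ h, hhead]
    have h4 : chainTransport M e (n e) = chainTransport M e (p + 1) := by rw [← h]
    rw [h4, chainTransport, dif_pos hp, dif_neg (show ¬ p < (n e : ℕ) - 1 by omega)]
    push_cast
    ring

/-- Sections correspond along chains on which the line bundle is trivial if and only if their
values at the nodes differ by the transport along the chains; necessity needs only degree zero. -/
theorem corresponds_iff {v v' : X.V} (hne : v ≠ v') {I : Finset X.E} (hI : I ⊆ X.edges v v')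
    (hdeg : ∀ e ∈ I, ∀ k, (M.D (Sum.inr ⟨e, k⟩)).degree = 0) {s : (X.comp v).K}
    {s' : (X.comp v').K} :
    (M.Corresponds I v v' s s' → ∀ e ∈ I, ∀ P P', X.branch e v = ⟨v, P⟩ → X.branch e v' = ⟨v', P'⟩ →
      P'.coeff (M.D (Sum.inl v') P') s' =
        sideTransport M e v * P.coeff (M.D (Sum.inl v) P) s) ∧
    ((∀ e ∈ I, ∀ k, LinEquiv (M.D (Sum.inr ⟨e, k⟩)) 0) →
      (∀ e ∈ I, ∀ P P', X.branch e v = ⟨v, P⟩ → X.branch e v' = ⟨v', P'⟩ →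
      P'.coeff (M.D (Sum.inl v') P') s' =
        sideTransport M e v * P.coeff (M.D (Sum.inl v) P) s) → M.Corresponds I v v' s s') := by
  -- the transport relation at the ends of the chain
  have hends : ∀ t : ∀ u, ((X.withChains n).comp u).K, (t (Sum.inl v) : (X.comp v).K) = s →
      (t (Sum.inl v') : (X.comp v').K) = s' → ∀ e ∈ I,
      ((X.withChains n).valueAt M.D t ⟨Sum.inl (X.node e true).1, (X.node e true).2⟩ =
      chainTransport M e (n e) * (X.withChains n).valueAt M.D t
        ⟨Sum.inl (X.node e false).1, (X.node e false).2⟩ ↔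
      ∀ P P', X.branch e v = ⟨v, P⟩ → X.branch e v' = ⟨v', P'⟩ →
      P'.coeff (M.D (Sum.inl v') P') s' =
        sideTransport M e v * P.coeff (M.D (Sum.inl v) P) s) := by
    rintro t rfl rfl e he
    obtain ⟨P, hP⟩ := exists_branch_eq (hI he)
    obtain ⟨P', hP'⟩ := exists_branch_eq (edges_comm v v' ▸ hI he)
    have hall : (∀ Q Q', X.branch e v = ⟨v, Q⟩ → X.branch e v' = ⟨v', Q'⟩ →
        Q'.coeff (M.D (Sum.inl v') Q') (t (Sum.inl v')) =
          sideTransport M e v * Q.coeff (M.D (Sum.inl v) Q) (t (Sum.inl v))) ↔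
        P'.coeff (M.D (Sum.inl v') P') (t (Sum.inl v')) =
          sideTransport M e v * P.coeff (M.D (Sum.inl v) P) (t (Sum.inl v)) := by
      refine ⟨fun h => h P P' hP hP', fun h Q Q' hQ hQ' => ?_⟩
      obtain rfl : P = Q := by simpa using hP.symm.trans hQ
      obtain rfl : P' = Q' := by simpa using hP'.symm.trans hQ'
      exact h
    rw [hall]
    unfold sideTransport orient
    -- If `v` is the head of `e`, the transport from `v` is the inverse of that from the tail.
    rcases edges_cases hne (hI he) with ⟨h1, h2, h3⟩ | ⟨h1, h2, h3⟩
    · rw [if_pos h1, ← h2, ← h3, hP, hP']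
      exact Iff.rfl
    · rw [if_neg h1, ← h2, ← h3, hP, hP']
      exact ⟨fun h => (Units.eq_inv_mul_iff_mul_eq _).2 h.symm,
        fun h => ((Units.eq_inv_mul_iff_mul_eq _).1 h).symm⟩
  constructor
  · rintro ⟨t, h1, h2, h3⟩ e he
    exact (hends t h1 h2 e he).1 (valueAt_head t (hdeg e he) (h3 e he).1 (h3 e he).2)
  · intro hM h
    let t₀ : ∀ u, (X.comp u).K := Function.update (Function.update 0 v' s') v s
    have hs : t₀ v = s := Function.update_self ..
    have hs' : t₀ v' = s' := by
      simp only [t₀]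
      rw [Function.update_of_ne hne.symm, Function.update_self]
    let x : X.E → κ := fun e => (X.node e false).2.coeff
      (M.D (Sum.inl (X.node e false).1) (X.node e false).2) (t₀ (X.node e false).1)
    have hex : ∀ e, ∃ τ : ∀ k : Fin ((n e : ℕ) - 1), ((X.withChains n).comp (Sum.inr ⟨e, k⟩)).K,
        e ∈ I → (∀ k, τ k ∈ H0 (M.D (Sum.inr ⟨e, k⟩))) ∧
        ∀ k, (pointZero κ).coeff (M.D (Sum.inr ⟨e, k⟩) (pointZero κ)) (τ k) =
          chainTransport M e k * M.glue ⟨e, ⟨k, by have := k.isLt; omega⟩⟩ * x e := by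
      intro e
      by_cases he : e ∈ I
      · obtain ⟨τ, hτ⟩ := exists_chain_sections (hM e he) (x e)
        exact ⟨τ, fun _ => hτ⟩
      · exact ⟨fun _ => 0, fun h => absurd h he⟩
    choose τ hτ using hex
    let t : ∀ u, ((X.withChains n).comp u).K
      | Sum.inl u => t₀ u
      | Sum.inr p => τ p.1 p.2
    refine ⟨t, hs, hs', fun e he => ⟨(hτ e he).1, ?_⟩⟩
    exact matchesAt_of_chain_sections t (hdeg e he) (hτ e he).1 (hτ e he).2
      ((hends t hs hs' e he).2 (h e he))

/-- The correspondence of sections along chains in terms of bundles isomorphic to the restrictions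
of the line bundle, and its dependence on the glueing. -/
theorem exists_corresponds_rescale_iff (M : (X.withChains n).LineBundle) {v v' : X.V} (hne : v ≠ v')
    {I : Finset X.E} (hI : I ⊆ X.edges v v')
    (hdeg : ∀ e ∈ I, ∀ k, (M.D (Sum.inr ⟨e, k⟩)).degree = 0) {B : Divisor (X.comp v)}
    {B' : Divisor (X.comp v')} {α : (X.comp v).K} {β : (X.comp v').K}
    (hα : IsBundleIso α B (M.D (Sum.inl v))) (hβ : IsBundleIso β B' (M.D (Sum.inl v'))) :
    ∃ ρ : X.E → κˣ, ∀ (g : X.E → κˣ), ∀ f ∈ H0 B, ∀ f' ∈ H0 B',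
      ((M.rescale g).Corresponds I v v' (α * f) (β * f') →
        ∀ e ∈ I, ∀ P P', X.branch e v = ⟨v, P⟩ → X.branch e v' = ⟨v', P'⟩ →
          P'.coeff (B' P') f' = orient g e v * ρ e * P.coeff (B P) f) ∧
      ((∀ e ∈ I, ∀ k, LinEquiv (M.D (Sum.inr ⟨e, k⟩)) 0) →
        (∀ e ∈ I, ∀ P P', X.branch e v = ⟨v, P⟩ → X.branch e v' = ⟨v', P'⟩ →
          P'.coeff (B' P') f' = orient g e v * ρ e * P.coeff (B P) f) →
        (M.rescale g).Corresponds I v v' (α * f) (β * f')) := by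
  have hex : ∀ e, ∃ ρ : κˣ, e ∈ I → ∀ P P', X.branch e v = ⟨v, P⟩ → X.branch e v' = ⟨v', P'⟩ →
      P'.coeff (M.D (Sum.inl v') P' - B' P') β * ρ =
        sideTransport M e v * P.coeff (M.D (Sum.inl v) P - B P) α := by
    intro e
    by_cases he : e ∈ I
    · obtain ⟨P, hP⟩ := exists_branch_eq (hI he)
      obtain ⟨P', hP'⟩ := exists_branch_eq (edges_comm v v' ▸ hI he)
      obtain ⟨a, ha⟩ : ∃ a : κˣ, (a : κ) = P'.coeff (M.D (Sum.inl v') P' - B' P') β :=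
        ⟨Units.mk0 _ (hβ.coeff_ne_zero P'), rfl⟩
      obtain ⟨c, hc⟩ : ∃ c : κˣ, (c : κ) = P.coeff (M.D (Sum.inl v) P - B P) α :=
        ⟨Units.mk0 _ (hα.coeff_ne_zero P), rfl⟩
      -- The transport is corrected by the values of the isomorphisms `α` and `β` at the two
      -- branches.
      refine ⟨a⁻¹ * sideTransport M e v * c, fun _ Q Q' hQ hQ' => ?_⟩
      obtain rfl : P = Q := by simpa using hP.symm.trans hQ
      obtain rfl : P' = Q' := by simpa using hP'.symm.trans hQ'
      rw [← ha, ← hc, mul_assoc, Units.val_mul, Units.val_mul, Units.mul_inv_cancel_left]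
    · exact ⟨1, fun h => absurd h he⟩
  choose ρ hρ using hex
  refine ⟨ρ, fun g f hf f' hf' => ?_⟩
  obtain ⟨hc₁, hc₂⟩ := corresponds_iff (M := M.rescale g) hne hI hdeg (s := α * f) (s' := β * f')
  suffices hsuff : (∀ e ∈ I, ∀ P P', X.branch e v = ⟨v, P⟩ → X.branch e v' = ⟨v', P'⟩ →
      P'.coeff ((M.rescale g).D (Sum.inl v') P') (β * f') =
        sideTransport (M.rescale g) e v * P.coeff ((M.rescale g).D (Sum.inl v) P) (α * f)) ↔
      ∀ e ∈ I, ∀ P P', X.branch e v = ⟨v, P⟩ → X.branch e v' = ⟨v', P'⟩ →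
          P'.coeff (B' P') f' = orient g e v * ρ e * P.coeff (B P) f from
    ⟨fun h => hsuff.1 (hc₁ h), fun hM h => hc₂ hM (hsuff.2 h)⟩
  refine forall₂_congr fun e he => forall₂_congr fun P P' => forall₂_congr fun hP hP' => ?_
  have h1 : P.coeff (M.D (Sum.inl v) P) (α * f) = _ := hα.coeff_mul P (hf P)
  have h2 : P'.coeff (M.D (Sum.inl v') P') (β * f') = _ := hβ.coeff_mul P' (hf' P')
  have h3 := hρ e he P P' hP hP'
  have h4 := hβ.coeff_ne_zero P'
  change P'.coeff (M.D (Sum.inl v') P') (β * f') =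
    sideTransport (M.rescale g) e v * P.coeff (M.D (Sum.inl v) P) (α * f) ↔ _
  rw [h1, h2, sideTransport_rescale, ← mul_right_inj' h4 (c := _ * _ * _)]
  have h5 : ((orient g e v * sideTransport M e v : κˣ) : κ) *
      (P.coeff (M.D (Sum.inl v) P - B P) α * P.coeff (B P) f) =
      P'.coeff (M.D (Sum.inl v') P' - B' P') β * (orient g e v * ρ e * P.coeff (B P) f) := by
    push_cast
    linear_combination - (orient g e v : κ) * P.coeff (B P) f * h3
  exact ⟨fun h => h.trans h5, fun h => h.trans h5.symm⟩

end Transport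
end NodalCurve
end OssermanLLS

namespace OssermanLLS
namespace NodalCurve

/-! ### The bundles induced in intermediate multidegrees -/

section Degrees

variable {κ : Type u} [Field κ] {X : NodalCurve κ} {n : X.E → ℕ+}

/-- The bundles induced in different multidegrees differ by the twisting divisors. -/
theorem linEquiv_inDegree (hX : X.IsPseudocompact) {v v' : X.V} (hadj : X.mergedGraph.Adj v v')
    {w₀ w₁ : X.Multidegree n} (hw : ∃ F, IsFiring w₀ w₁ F) (O : (X.withChains n).EnrichedStructure)
    (L : (X.withChains n).LineBundle) (j : ℕ) {B : Divisor (X.comp v)}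
    (hB : B = (L.inDegree O w₀ w₁).D (Sum.inl v)) :
    LinEquiv (B - stepDiv w₁ v v' j)
      ((L.inDegree O w₀ ((Multidegree.partialTwist v v')^[j] w₁)).D (Sum.inl v)) := by
  subst hB
  obtain ⟨F, hF, hF'⟩ := exists_firing_iterate hX hadj w₁ j
  have h1 := firing_spec hw
  have h2 := firing_spec ⟨_, h1.trans hF⟩
  -- The chosen firing function for the twisted multidegree may differ from the composite one, but
  -- only by constants, which do not affect the divisor.
  have h3 := (h1.trans hF).sum_boundary_eq h2
  set F₁ := firing w₀ w₁
  set F₂ := firing w₀ ((Multidegree.partialTwist v v')^[j] w₁)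
  have h4 : ((∑ u, F₂ u • (X.withChains n).boundary u) (Sum.inl v) : Divisor (X.comp v)) =
      (∑ u, F₁ u • (X.withChains n).boundary u) (Sum.inl v) +
        (∑ u, F u • (X.withChains n).boundary u) (Sum.inl v) := by
    rw [← h3]
    simp only [Pi.add_apply, add_smul, Finset.sum_add_distrib]
  rw [hF'] at h4
  have h5 : LinEquiv _ (_ + - stepDiv w₁ v v' j : Divisor (X.comp v)) :=
    (O.linEquiv_sum F₁ (Sum.inl v)).add (LinEquiv.refl (- stepDiv w₁ v v' j : Divisor (X.comp v)))
  have h6 := (O.linEquiv_sum F₂ (Sum.inl v)).symm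
  have h7 := (LinEquiv.refl (L.D (Sum.inl v))).add ((h5.trans (h4 ▸ LinEquiv.refl _)).trans h6)
  have h8 : ∀ a c d : Divisor (X.comp v), LinEquiv (a + c - d) (a + (c + -d)) := fun a c d => by
    rw [add_sub_assoc, sub_eq_add_neg]
    exact LinEquiv.refl _
  exact (h8 (L.D (Sum.inl v)) _ _).trans h7

theorem degree_inDegree [IsAlgClosed κ] {w₀ w₁ : X.Multidegree n} (hw : ∃ F, IsFiring w₀ w₁ F)
    (O : (X.withChains n).EnrichedStructure) {L : (X.withChains n).LineBundle}
    (hL : L.HasMultidegree w₀) (u : (X.withChains n).V) :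
    ((L.inDegree O w₀ w₁).D u).degree = w₁.toDiv u := by
  rw [(firing_spec hw).toDiv_eq u, ← hL u, ← (O.linEquiv_sum (firing w₀ w₁) u).degree_eq]
  exact Divisor.degree_add _ _

/-- The chip of `e` has just reached the vertex `v`, so the chain contains none. -/
theorem toDiv_iterate_eq_zero {w : X.Multidegree n} {v v' : X.V} {j : ℕ} {e : X.E}
    (he : e ∈ stepEdges w v v' j) (k : Fin ((n e : ℕ) - 1)) :
    ((Multidegree.partialTwist v v')^[j] w).toDiv (Sum.inr ⟨e, k⟩) = 0 := by
  obtain ⟨h1, h2⟩ := Finset.mem_filter.1 he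
  have h3 : ((Multidegree.partialTwist v v')^[j] w).chip e = 0 := by
    rw [partialTwist_iterate_chip, if_pos h1, h2]
  simp only [Multidegree.toDiv]
  rw [h3, ZMod.val_zero, if_neg (by omega)]

theorem pointDiv_chainNode_mem_closure (q : (X.withChains n).E) (c : Bool)
    (p : Σ e : X.E, Fin ((n e : ℕ) - 1)) :
    ((X.withChains n).pointDiv (X.chainNode n q c) (Sum.inr p) : Divisor (projectiveLine κ)) ∈
      AddSubgroup.closure {Finsupp.single (pointZero κ) 1, Finsupp.single (pointInfty κ) 1} := by
  have hinl : ∀ x : X.Pt,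
      ((X.withChains n).pointDiv ⟨Sum.inl x.1, x.2⟩ (Sum.inr p) : Divisor (projectiveLine κ)) = 0 :=
    fun x => pointDiv_of_ne (X := X.withChains n) (by simp)
  have hinr : ∀ (p' : Σ e : X.E, Fin ((n e : ℕ) - 1)) (P : Point (projectiveLine κ)),
      (Finsupp.single P 1 : Divisor (projectiveLine κ)) ∈ AddSubgroup.closure
        {(Finsupp.single (pointZero κ) 1 : Divisor (projectiveLine κ)),
          Finsupp.single (pointInfty κ) 1} →
      ((X.withChains n).pointDiv ⟨Sum.inr p', P⟩ (Sum.inr p) : Divisor (projectiveLine κ)) ∈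
        AddSubgroup.closure {Finsupp.single (pointZero κ) 1, Finsupp.single (pointInfty κ) 1} := by
    intro p' P hP
    by_cases h : p' = p
    · subst h
      have : ((X.withChains n).pointDiv ⟨Sum.inr p', P⟩ (Sum.inr p') :
          Divisor (projectiveLine κ)) = Finsupp.single P 1 := Pi.single_eq_same _ _
      rw [this]
      exact hP
    · have : ((X.withChains n).pointDiv ⟨Sum.inr p', P⟩ (Sum.inr p) :
          Divisor (projectiveLine κ)) = 0 :=
        pointDiv_of_ne (X := X.withChains n) (by simpa using h)
      rw [this]
      exact AddSubgroup.zero_mem _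
  cases c <;> simp only [chainNode] <;> split_ifs with h
  · exact (hinl _).symm ▸ AddSubgroup.zero_mem _
  · exact hinr _ _ (AddSubgroup.subset_closure (by simp))
  · exact (hinl _).symm ▸ AddSubgroup.zero_mem _
  · exact hinr _ _ (AddSubgroup.subset_closure (by simp))

/-- The nodes on an inserted line are its points `0` and `∞`, so firing changes its bundle by a
divisor supported there. For such divisors degree zero implies triviality. -/
theorem sum_boundary_mem_closure (F : (X.withChains n).V → ℤ)
    (p : Σ e : X.E, Fin ((n e : ℕ) - 1)) :
    ((∑ u, F u • (X.withChains n).boundary u) (Sum.inr p) : Divisor (projectiveLine κ)) ∈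
      AddSubgroup.closure {Finsupp.single (pointZero κ) 1, Finsupp.single (pointInfty κ) 1} := by
  rw [sum_zsmul_boundary, Finset.sum_apply]
  refine AddSubgroup.sum_mem _ fun q _ => ?_
  exact AddSubgroup.zsmul_mem _ (AddSubgroup.sub_mem _ (pointDiv_chainNode_mem_closure q true p)
    (pointDiv_chainNode_mem_closure q false p)) _

theorem linEquiv_zero_of_degree [IsAlgClosed κ] {w₀ w₁ : X.Multidegree n}
    (O : (X.withChains n).EnrichedStructure) {L : (X.withChains n).LineBundle}
    {p : Σ e : X.E, Fin ((n e : ℕ) - 1)} {m : ℤ}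
    (hL : L.D (Sum.inr p) = m • (Finsupp.single (pointZero κ) 1 : Divisor (projectiveLine κ)))
    (hdeg : ((L.inDegree O w₀ w₁).D (Sum.inr p)).degree = 0) :
    LinEquiv ((L.inDegree O w₀ w₁).D (Sum.inr p)) 0 := by
  have h1 := (LinEquiv.refl (L.D (Sum.inr p))).add (O.linEquiv_sum (firing w₀ w₁) (Sum.inr p))
  refine LinEquiv.trans h1 (linEquiv_zero_of_mem_closure (κ := κ) ?_ (h1.degree_eq.symm.trans hdeg))
  rw [hL]
  exact AddSubgroup.add_mem _ (AddSubgroup.zsmul_mem _ (AddSubgroup.subset_closure (by simp)) _)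
    (sum_boundary_mem_closure _ p)

/-- The points where the twisting divisor jumps. -/
theorem exists_jump_points {v v' : X.V} {w : X.Multidegree n} {j : ℕ} {I : Finset X.E}
    (hI : I = stepEdges w v v' j) : ∃ P : I → Point (X.comp v), Function.Injective P ∧
      (∀ e : I, X.branch e v = ⟨v, P e⟩) ∧
      stepDiv w v v' (j + 1) = stepDiv w v v' j + ∑ e, Finsupp.single (P e) 1 := by
  subst hI
  have hex : ∀ e : stepEdges w v v' j, ∃ P, X.branch e v = ⟨v, P⟩ := fun e =>
    exists_branch_eq (Finset.mem_filter.1 e.2).1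
  choose P hP using hex
  refine ⟨P, fun e e' h => ?_, hP, ?_⟩
  · have := (hP e).trans ((by rw [h] : (⟨v, P e⟩ : X.Pt) = ⟨v, P e'⟩).trans (hP e').symm)
    exact Subtype.ext (branch_injective this)
  · rw [stepDiv_succ, ← Finset.sum_coe_sort]
    congr 1
    refine Finset.sum_congr rfl fun e _ => ?_
    rw [hP e, pointDiv, Pi.single_eq_same]

end Degrees

end NodalCurve

/-- The space of values at the points `P e` of the sections in `U(-D)`. -/
noncomputable def leadSpace {κ : Type u} [Field κ] {C : Curve κ} {ι : Type*} (U : Submodule κ C.K)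
    (A D : Divisor C) (P : ι → Point C) : Submodule κ (ι → κ) where
  carrier := {x | ∃ s ∈ vanishing U A D, lead (A - D) P s = x}
  zero_mem' := ⟨0, Submodule.zero_mem _, by
    have := lead_smul (B := A - D) P 0 (f := 0) (Submodule.zero_mem _)
    rwa [zero_smul, zero_smul] at this⟩
  add_mem' := by
    rintro _ _ ⟨s, hs, rfl⟩ ⟨t, ht, rfl⟩
    exact ⟨s + t, Submodule.add_mem _ hs ht, lead_add P hs.2 ht.2⟩
  smul_mem' := by
    rintro c _ ⟨s, hs, rfl⟩
    exact ⟨c • s, Submodule.smul_mem _ c hs, lead_smul P c hs.2⟩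

namespace NodalCurve

variable {κ : Type u} [Field κ] {X : NodalCurve κ} {n : X.E → ℕ+}
  {w : X.V → X.Multidegree n} {b : X.V → X.V → ℕ} {r : ℕ} {A : X.Div}
  {U : ∀ v, Submodule κ (X.comp v).K}

theorem leadingTerms_eq {v : X.V} (v' : X.V) (k : ℕ) {I : Finset X.E} {P : I → Point (X.comp v)}
    (hP : ∀ e : I, X.branch e v = ⟨v, P e⟩) :
    leadingTerms A (twistDiv w v v' k) U v I =
      leadSpace (U v) (A v) (stepDiv (w v) v v' k) P := by
  have hD : twistDiv w v v' k v = stepDiv (w v) v v' k := twistSeq_eq_stepDiv w v v' k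
  have hval : ∀ (s : (X.comp v).K) (e : I),
      X.valueAt (A - twistDiv w v v' k) (Pi.single v s) (X.branch e v) =
        lead (A v - stepDiv (w v) v v' k) P s e := by
    intro s e
    rw [hP e, valueAt, lead, Pi.sub_apply, hD, Pi.single_eq_same]
  ext x
  constructor
  · rintro ⟨s, hs, h⟩
    rw [hD] at hs
    exact ⟨s, hs, funext fun e => ((h e).trans (hval s e)).symm⟩
  · rintro ⟨s, hs, rfl⟩
    exact ⟨s, by rwa [hD], fun e => (hval s e).symm⟩

/-- Equality of degrees is equality of indices, the degree being injective on critical indices.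
Criticality of `b - j` on the other side holds because the same nodes are involved. -/
theorem extremal_iff (ht : IsTight w b) {v v' : X.V} (hadj : X.mergedGraph.Adj v v')
    {i i' : Fin (r + 1) → ℕ} (hi : IsOrderIndex (U v) (A v) (stepDiv (w v) v v') i)
    (hvan : vanSeq w r A U v v' = fun l => (stepDiv (w v) v v' (i l)).degree)
    (hi' : IsOrderIndex (U v') (A v') (stepDiv (w v') v' v) i')
    (hvan' : vanSeq w r A U v' v = fun l => (stepDiv (w v') v' v (i' l)).degree) {j : ℕ}
    (hj : j ≤ b v v') (hjc : IsCritical (twistSeq w v v') j) (l : Fin (r + 1)) :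
    (vanSeq w r A U v v' l = (twistSeq w v v' j).degree ↔ i l = j) ∧
      (vanSeq w r A U v' v (Fin.rev l) = (twistSeq w v' v (b v v' - j)).degree ↔
        i' (Fin.rev l) = b v v' - j) := by
  have hjc' : IsCritical (stepDiv (w v') v' v) (b v v' - j) := by
    rw [isCritical_stepDiv hadj.symm, ← twistEdges_eq_stepEdges, ht.twistEdges_eq hadj hj,
      twistEdges_eq_stepEdges, ← isCritical_stepDiv hadj, ← twistSeq_eq]
    exact hjc
  rw [hvan, hvan', twistSeq_eq, twistSeq_eq]
  rw [twistSeq_eq] at hjc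
  exact ⟨(isExhausting_stepDiv hadj _).degree_inj (hi.isCritical l) hjc,
    (isExhausting_stepDiv hadj.symm _).degree_inj (hi'.isCritical _) hjc'⟩

theorem extremalCount_eq (ht : IsTight w b) {v v' : X.V} (hadj : X.mergedGraph.Adj v v')
    {i i' : Fin (r + 1) → ℕ} (hi : IsOrderIndex (U v) (A v) (stepDiv (w v) v v') i)
    (hvan : vanSeq w r A U v v' = fun l => (stepDiv (w v) v v' (i l)).degree)
    (hi' : IsOrderIndex (U v') (A v') (stepDiv (w v') v' v) i')
    (hvan' : vanSeq w r A U v' v = fun l => (stepDiv (w v') v' v (i' l)).degree) {j : ℕ}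
    (hj : j ≤ b v v') (hjc : IsCritical (twistSeq w v v') j) :
    extremalCount w b r A U v v' j =
      (Finset.univ.filter fun l => i l = j ∧ i' (Fin.rev l) = b v v' - j).card := by
  rw [extremalCount]
  congr 1
  refine Finset.filter_congr fun l _ => ?_
  obtain ⟨h1, h2⟩ := extremal_iff ht hadj hi hvan hi' hvan' hj hjc l
  rw [h1, h2]

end NodalCurve
end OssermanLLS

/-! ### Limit linear series satisfy the weak glueing condition -/

namespace OssermanLLS
namespace NodalCurve

variable {κ : Type u} [Field κ] [IsAlgClosed κ] {X : NodalCurve κ} {n : X.E → ℕ+}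
  {w : X.V → X.Multidegree n} {b : X.V → X.V → ℕ} {r : ℕ} {A : X.Div}
  {U : ∀ v, Submodule κ (X.comp v).K}

/-- The weak glueing condition for one pair of vertices and one index, from matching bases. -/
theorem exists_weakGlueing (ht : IsTight w b) {v v' : X.V} (hadj : X.mergedGraph.Adj v v')
    (hU : U v ≤ H0 (A v)) (hr : Module.finrank κ (U v) = r + 1)
    {i i' : Fin (r + 1) → ℕ} (hi : IsOrderIndex (U v) (A v) (stepDiv (w v) v v') i)
    (hvan : vanSeq w r A U v v' = fun l => (stepDiv (w v) v v' (i l)).degree)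
    (hi' : IsOrderIndex (U v') (A v') (stepDiv (w v') v' v) i')
    (hvan' : vanSeq w r A U v' v = fun l => (stepDiv (w v') v' v (i' l)).degree) {j : ℕ}
    (hj : j ≤ b v v') (hjc : IsCritical (twistSeq w v v') j)
    {y : Fin (r + 1) → (X.comp v).K} (hy : LinearIndependent κ y)
    (hyi : ∀ l, y l ∈ vanishing (U v) (A v) (stepDiv (w v) v v' (i l)))
    {y' : Fin (r + 1) → (X.comp v').K}
    (hyi' : ∀ l, y' l ∈ vanishing (U v') (A v') (stepDiv (w v') v' v (i' l))) (ρ : X.E → κˣ)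
    (hρ : ∀ l, i l = j → i' (Fin.rev l) = b v v' - j → ∀ e ∈ twistEdges w v v' j, ∀ P P',
      X.branch e v = ⟨v, P⟩ → X.branch e v' = ⟨v', P'⟩ →
        P'.coeff ((A v' - stepDiv (w v') v' v (b v v' - j)) P') (y' (Fin.rev l)) =
          ρ e * P.coeff ((A v - stepDiv (w v) v v' j) P) (y l)) :
    ∃ W W' : Submodule κ (twistEdges w v v' j → κ),
      (W : Set _) ⊆ leadingTerms A (twistDiv w v v' j) U v (twistEdges w v v' j) ∧
      (W' : Set _) ⊆
        leadingTerms A (twistDiv w v' v (b v v' - j)) U v' (twistEdges w v v' j) ∧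
      Module.finrank κ W = extremalCount w b r A U v v' j ∧
      Module.finrank κ W' = extremalCount w b r A U v v' j ∧
      ∀ T : Set (twistEdges w v v' j),
        Module.finrank κ (Submodule.span κ (torusOrbit T ∩ {x | x ∈ W})) =
          Module.finrank κ (Submodule.span κ (torusOrbit T ∩ {x | x ∈ W'})) := by
  have hD := isExhausting_stepDiv hadj (w v)
  obtain ⟨P, hPinj, hP, hPD⟩ := exists_jump_points (twistEdges_eq_stepEdges w v v' j)
  obtain ⟨P', hPinj', hP', hPD'⟩ := exists_jump_points
    (show twistEdges w v v' j = stepEdges (w v') v' v (b v v' - j) by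
      rw [← twistEdges_eq_stepEdges, ht.twistEdges_eq hadj hj])
  let S : Finset (Fin (r + 1)) := Finset.univ.filter fun l => i l = j ∧ i' (Fin.rev l) = b v v' - j
  have hS : ∀ l, l ∈ S ↔ i l = j ∧ i' (Fin.rev l) = b v v' - j := fun l => by simp [S]
  have hcount : extremalCount w b r A U v v' j = S.card :=
    extremalCount_eq ht hadj hi hvan hi' hvan' hj hjc
  let x : Fin (r + 1) → twistEdges w v v' j → κ :=
    fun l => lead (A v - stepDiv (w v) v v' j) P (y l)
  have hmem : ∀ l ∈ S, y l ∈ vanishing (U v) (A v) (stepDiv (w v) v v' j) := fun l hl =>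
    ((hS l).1 hl).1 ▸ hyi l
  have hxS : LinearIndepOn κ x (S : Set (Fin (r + 1))) := by
    rw [← linearIndepOn_lead_iff hPinj hPD hmem]
    obtain ⟨N, hN⟩ := hD.exists_vanishing_eq_bot (U v) (A v)
    have hfd : FiniteDimensional κ (vanishing (U v) (A v) (stepDiv (w v) v v' 0)) := by
      rw [hD.vanishing_zero hU]
      exact Module.finite_of_finrank_pos (by omega)
    exact (linearIndepOn_graded (vanishing_antitone (U v) (A v) hD.mono) hN hi.card hy hyi j).mono
      fun l hl => ((hS l).1 hl).1
  have hfin : Module.finrank κ (Submodule.span κ (x '' S)) = S.card := by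
    have := finrank_span_eq_card hxS
    rw [Set.image_eq_range, this]
    exact Fintype.card_coe S
  let τ : twistEdges w v v' j → κˣ := fun e => ρ e
  -- `W` is spanned by the leading terms of the extremal sections on `Z_v`. Its translate by the
  -- torus element `τ` is spanned by those on `Z_{v'}`, so both meet the orbits in equal dimensions.
  refine ⟨Submodule.span κ (x '' S), (Submodule.span κ (x '' S)).map (scale τ).toLinearMap,
    ?_, ?_, by rw [hfin, hcount], by rw [LinearEquiv.finrank_map_eq, hfin, hcount],
    fun T => (finrank_span_torusOrbit_scale _ _ _).symm⟩
  · rw [leadingTerms_eq v' j hP]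
    refine SetLike.coe_subset_coe.2 (Submodule.span_le.2 ?_)
    rintro _ ⟨l, hl, rfl⟩
    exact ⟨y l, hmem l hl, rfl⟩
  · rw [leadingTerms_eq v (b v v' - j) hP', ← Submodule.span_image]
    refine SetLike.coe_subset_coe.2 (Submodule.span_le.2 ?_)
    rintro _ ⟨_, ⟨l, hl, rfl⟩, rfl⟩
    obtain ⟨h1, h2⟩ := (hS l).1 hl
    refine ⟨y' (Fin.rev l), h2 ▸ hyi' (Fin.rev l), funext fun e => ?_⟩
    exact hρ l h1 h2 e e.2 (P e) (P' e) (hP e) (hP' e)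

/-- A limit linear series satisfies the weak glueing condition. -/
theorem weakGlueing_of_liftsToLimit (hX : X.IsPseudocompact) {w₀ : X.Multidegree n}
    (hw : ∀ v, Multidegree.Reachable w₀ (w v)) (ht : IsTight w b)
    {O : (X.withChains n).EnrichedStructure} (hpre : IsPreLimit w b r A U)
    (hlift : LiftsToLimit O w₀ w b r A U) : WeakGlueing w b r A U := by
  intro v v' hadj j hj hjc
  obtain ⟨L, hL, h, hh, -, hU, hlim⟩ := hlift
  obtain ⟨-, s, s', hs, hs', hglue⟩ := hlim v v' hadj
  obtain ⟨i, hi, hvan⟩ := exists_isOrderIndex_vanSeq hadj w (hpre.1 v).2.1 (hpre.1 v).2.2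
  obtain ⟨i', hi', hvan'⟩ := exists_isOrderIndex_vanSeq hadj.symm w (hpre.1 v').2.1 (hpre.1 v').2.2
  have hvanL : ∀ u u', vanSeq w r (L.onComponents O w₀ w)
      (fun v => (U v).map (LinearMap.mulLeft κ (h v))) u u' = vanSeq w r A U u u' :=
    fun u u' => multivanishing_map (hh u) r _
  have hex : ∀ (u : X.V) (f : (U u).map (LinearMap.mulLeft κ (h u))),
      ∃ y ∈ U u, h u * y = f := fun u f => f.2
  choose y hy hhy using fun l => hex v (s l)
  choose y' hy' hhy' using fun l => hex v' (s' l)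
  have hli : LinearIndependent κ y := by
    refine LinearIndependent.of_comp (LinearMap.mulLeft κ (h v)) ?_
    have h1 : LinearIndependent κ fun l => (s l : (X.comp v).K) :=
      s.linearIndependent.map' (Submodule.subtype _) (Submodule.ker_subtype _)
    have h2 : (fun l => (s l : (X.comp v).K)) = LinearMap.mulLeft κ (h v) ∘ y :=
      funext fun l => (hhy l).symm
    rwa [h2] at h1
  have hyi : ∀ l, y l ∈ vanishing (U v) (A v) (stepDiv (w v) v v' (i l)) := by
    intro l
    have h1 := hs l
    rw [hvanL, hvan, twistSeq_eq, hasOrder_iff (isExhausting_stepDiv hadj _) (hi.isCritical l),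
      ← hhy l] at h1
    exact ⟨hy l, ((hh v).sub _).mul_mem_iff.1 h1.1⟩
  have hyi' : ∀ l, y' l ∈ vanishing (U v') (A v') (stepDiv (w v') v' v (i' l)) := by
    intro l
    have h1 := hs' l
    rw [hvanL, hvan', twistSeq_eq,
      hasOrder_iff (isExhausting_stepDiv hadj.symm _) (hi'.isCritical l), ← hhy' l] at h1
    exact ⟨hy' l, ((hh v').sub _).mul_mem_iff.1 h1.1⟩
  obtain ⟨α, β, hα, hβ, hcorr⟩ := hglue j hj hjc
  rw [twistSeq_eq] at hα hβ
  have hα' := ((hh v).sub (stepDiv (w v) v v' j)).trans hα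
  have hβ' := ((hh v').sub (stepDiv (w v') v' v (b v v' - j))).trans hβ
  obtain ⟨F, hF⟩ := reachable_firing (hw v)
  obtain ⟨F', hF', -⟩ := exists_firing_iterate hX hadj (w v) j
  have hdeg : ∀ e ∈ twistEdges w v v' j, ∀ k,
      ((L.inDegree O w₀ ((Multidegree.partialTwist v v')^[j] (w v))).D (Sum.inr ⟨e, k⟩)).degree = 0 := by
    intro e he k
    rw [degree_inDegree ⟨_, hF.trans hF'⟩ O hL]
    exact toDiv_iterate_eq_zero (by rwa [← twistEdges_eq_stepEdges]) k
  obtain ⟨ρ, hρ⟩ := exists_corresponds_rescale_iff _ hadj.1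
    (I := twistEdges w v v' j) (Finset.filter_subset _ _) hdeg hα' hβ'
  refine exists_weakGlueing ht hadj (hpre.1 v).2.1 (hpre.1 v).2.2 hi hvan hi' hvan' hj hjc hli hyi
    hyi' ρ ?_
  intro l hl hl' e he P P' hP hP'
  obtain ⟨h1, h2⟩ := extremal_iff ht hadj hi hvan hi' hvan' hj hjc l
  have h3 := hcorr l (by rw [hvanL]; exact h1.2 hl) (by rw [hvanL]; exact h2.2 hl')
  -- The trivial rescaling returns the given line bundle itself.
  have h4 := (hρ 1 (y l) (hl ▸ (hyi l).2) (y' (Fin.rev l)) (hl' ▸ (hyi' (Fin.rev l)).2)).1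
  rw [LineBundle.rescale_one, mul_assoc, hhy, mul_assoc, hhy'] at h4
  have h5 := h4 h3 e he P P' hP hP'
  have h6 : orient (1 : X.E → κˣ) e v = 1 := by
    unfold orient
    split_ifs <;> simp
  rwa [h6, Units.val_one, one_mul] at h5

end NodalCurve
end OssermanLLS

/-! ### Construction of a lift along one edge of the merged graph -/

namespace OssermanLLS

/-- Sections of two bundles on two curves with proportional values at given points. -/
theorem exists_matching_sections {κ : Type u} [Field κ] {C C' : Curve κ} {ι : Type*} {I : Type}
    [Fintype I] {S : Finset ι} {U : Submodule κ C.K} {A D D₁ : Divisor C} {P : I → Point C}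
    (hP : Function.Injective P) (hD : D₁ = D + ∑ e, Finsupp.single (P e) 1)
    {U' : Submodule κ C'.K} {A' D' D₁' : Divisor C'} {P' : I → Point C'}
    (hP' : Function.Injective P') (hD' : D₁' = D' + ∑ e, Finsupp.single (P' e) 1)
    {W : Submodule κ (I → κ)} (hW : W ≤ leadSpace U A D P) (hS : Module.finrank κ W = S.card)
    {θ : I → κˣ} (hW' : W.map (scale θ).toLinearMap ≤ leadSpace U' A' D' P') :
    ∃ (y : ι → C.K) (y' : ι → C'.K), (∀ l ∈ S, y l ∈ vanishing U A D) ∧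
      (∀ l ∈ S, y' l ∈ vanishing U' A' D') ∧
      LinearIndepOn κ (fun l => (vanishing U A D₁).mkQ (y l)) (S : Set ι) ∧
      LinearIndepOn κ (fun l => (vanishing U' A' D₁').mkQ (y' l)) (S : Set ι) ∧
      ∀ l ∈ S, lead (A' - D') P' (y' l) = scale θ (lead (A - D) P (y l)) := by
  classical
  let bas : Module.Basis S κ W := (Module.finBasisOfFinrankEq κ W hS).reindex S.equivFin.symm
  have hy : ∀ l, ∃ y, ∀ hl : l ∈ S, y ∈ vanishing U A D ∧ lead (A - D) P y = bas ⟨l, hl⟩ := by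
    intro l
    by_cases hl : l ∈ S
    · obtain ⟨y, h1, h2⟩ := hW (bas ⟨l, hl⟩).2
      exact ⟨y, fun _ => ⟨h1, h2⟩⟩
    · exact ⟨0, fun h => absurd h hl⟩
  have hy' : ∀ l, ∃ y, ∀ hl : l ∈ S, y ∈ vanishing U' A' D' ∧
      lead (A' - D') P' y = scale θ (bas ⟨l, hl⟩) := by
    intro l
    by_cases hl : l ∈ S
    · obtain ⟨y, h1, h2⟩ := hW' ⟨_, (bas ⟨l, hl⟩).2, rfl⟩
      exact ⟨y, fun _ => ⟨h1, h2⟩⟩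
    · exact ⟨0, fun h => absurd h hl⟩
  choose y hy using hy
  choose y' hy' using hy'
  have hbas : LinearIndependent κ fun l : S => (bas l : I → κ) :=
    bas.linearIndependent.map' W.subtype (Submodule.ker_subtype _)
  refine ⟨y, y', fun l hl => (hy l hl).1, fun l hl => (hy' l hl).1, ?_, ?_, fun l hl => ?_⟩
  · rw [linearIndepOn_lead_iff hP hD fun l hl => (hy l hl).1]
    have h1 : (fun l : (S : Set ι) => lead (A - D) P (y l)) = fun l : S => (bas l : I → κ) :=
      funext fun l => (hy l l.2).2
    rw [LinearIndepOn, h1]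
    exact hbas
  · rw [linearIndepOn_lead_iff hP' hD' fun l hl => (hy' l hl).1]
    have h1 : (fun l : (S : Set ι) => lead (A' - D') P' (y' l)) =
        fun l : S => (scale θ).toLinearMap (bas l : I → κ) := funext fun l => (hy' l l.2).2
    rw [LinearIndepOn, h1]
    exact hbas.map' _ (LinearEquiv.ker _)
  · rw [(hy l hl).2, (hy' l hl).2]

theorem exists_basis_of_linearIndependent {κ M : Type*} [Field κ] [AddCommGroup M] [Module κ M] {V : Submodule κ M}
    {r : ℕ} (hr : Module.finrank κ V = r + 1) {s : Fin (r + 1) → M} (hs : ∀ l, s l ∈ V)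
    (hli : LinearIndependent κ s) : ∃ B : Module.Basis (Fin (r + 1)) κ V, ∀ l, (B l : M) = s l := by
  have h1 : LinearIndependent κ fun l => (⟨s l, hs l⟩ : V) :=
    LinearIndependent.of_comp V.subtype hli
  refine ⟨basisOfLinearIndependentOfCardEqFinrank h1 (by rw [hr, Fintype.card_fin]), fun l => ?_⟩
  rw [coe_basisOfLinearIndependentOfCardEqFinrank]

namespace NodalCurve

variable {κ : Type u} [Field κ] [IsAlgClosed κ] {X : NodalCurve κ} {n : X.E → ℕ+}
  {w : X.V → X.Multidegree n} {b : X.V → X.V → ℕ} {r : ℕ} {A : X.Div}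
  {U : ∀ v, Submodule κ (X.comp v).K}

/-- Extremal sections for one index which correspond to each other, if the glueing is chosen
appropriately. -/
theorem exists_corresponding_sections (hX : X.IsPseudocompact) {w₀ : X.Multidegree n}
    (hw : ∀ v, Multidegree.Reachable w₀ (w v)) (ht : IsTight w b)
    {O : (X.withChains n).EnrichedStructure} {L : (X.withChains n).LineBundle}
    (hL : L.HasMultidegree w₀) (hLA : ∀ v, A v = L.onComponents O w₀ w v)
    (hline : ∀ p, ∃ m : ℤ,
      L.D (Sum.inr p) = m • (Finsupp.single (pointZero κ) 1 : Divisor (projectiveLine κ)))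
    (hweak : WeakGlueing w b r A U) {v v' : X.V} (hadj : X.mergedGraph.Adj v v')
    (hthree : (X.edges v v').card ≤ 3)
    {S : Finset (Fin (r + 1))} {j : ℕ} (hS : S.card = extremalCount w b r A U v v' j)
    (hj : j ≤ b v v') (hjc : IsCritical (twistSeq w v v') j) :
    ∃ (α : (X.comp v).K) (β : (X.comp v').K) (τ : X.E → κˣ),
      IsBundleIso α (A v - stepDiv (w v) v v' j)
        ((L.inDegree O w₀ ((Multidegree.partialTwist v v')^[j] (w v))).D (Sum.inl v)) ∧
      IsBundleIso β (A v' - stepDiv (w v') v' v (b v v' - j))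
        ((L.inDegree O w₀ ((Multidegree.partialTwist v v')^[j] (w v))).D (Sum.inl v')) ∧
      ∀ c : κˣ, ∃ (y : Fin (r + 1) → (X.comp v).K) (y' : Fin (r + 1) → (X.comp v').K),
        (∀ l ∈ S, y l ∈ vanishing (U v) (A v) (stepDiv (w v) v v' j)) ∧
        (∀ l ∈ S, y' l ∈ vanishing (U v') (A v') (stepDiv (w v') v' v (b v v' - j))) ∧
        LinearIndepOn κ (fun l => (vanishing (U v) (A v) (stepDiv (w v) v v' (j + 1))).mkQ (y l))
          (S : Set (Fin (r + 1))) ∧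
        LinearIndepOn κ (fun l =>
          (vanishing (U v') (A v') (stepDiv (w v') v' v (b v v' - j + 1))).mkQ (y' l))
          (S : Set (Fin (r + 1))) ∧
        ∀ g : X.E → κˣ, (∀ e ∈ twistEdges w v v' j, orient g e v = c * τ e) → ∀ l ∈ S,
          ((L.inDegree O w₀ ((Multidegree.partialTwist v v')^[j] (w v))).rescale g).Corresponds
            (twistEdges w v v' j) v v' (α * y l) (β * y' l) := by
  classical
  obtain ⟨F, hF⟩ := reachable_firing (hw v)
  obtain ⟨F', hF', -⟩ := exists_firing_iterate hX hadj (w v) j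
  have hdeg : ∀ e ∈ twistEdges w v v' j, ∀ k,
      ((L.inDegree O w₀ ((Multidegree.partialTwist v v')^[j] (w v))).D (Sum.inr ⟨e, k⟩)).degree = 0 := by
    intro e he k
    rw [degree_inDegree ⟨_, hF.trans hF'⟩ O hL]
    exact toDiv_iterate_eq_zero (by rwa [← twistEdges_eq_stepEdges]) k
  have hzero : ∀ e ∈ twistEdges w v v' j, ∀ k, LinEquiv
      ((L.inDegree O w₀ ((Multidegree.partialTwist v v')^[j] (w v))).D (Sum.inr ⟨e, k⟩)) 0 := by
    intro e he k
    obtain ⟨m, hm⟩ := hline ⟨e, k⟩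
    exact linEquiv_zero_of_degree O hm (hdeg e he k)
  obtain ⟨α, hα⟩ := linEquiv_inDegree hX hadj (reachable_firing (hw v)) O L j (hLA v)
  obtain ⟨β, hβ⟩ := linEquiv_inDegree hX hadj.symm (reachable_firing (hw v')) O L (b v v' - j) (hLA v')
  rw [ht.iterate_eq hadj hj] at hβ
  obtain ⟨ρ, hρ⟩ := exists_corresponds_rescale_iff _ hadj.1
    (I := twistEdges w v v' j) (Finset.filter_subset _ _) hdeg hα hβ
  obtain ⟨P, hPinj, hP, hPD⟩ := exists_jump_points (twistEdges_eq_stepEdges w v v' j)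
  obtain ⟨P', hPinj', hP', hPD'⟩ := exists_jump_points
    (show twistEdges w v v' j = stepEdges (w v') v' v (b v v' - j) by
      rw [← twistEdges_eq_stepEdges, ht.twistEdges_eq hadj hj])
  obtain ⟨W, W', hW, hW', hfin, hfin', hT⟩ := hweak v v' hadj j hj hjc
  rw [leadingTerms_eq v' j hP, SetLike.coe_subset_coe] at hW
  rw [leadingTerms_eq v (b v v' - j) hP', SetLike.coe_subset_coe] at hW'
  obtain ⟨θ, hθ⟩ := exists_scale_map_eq (by
    rw [Fintype.card_coe]
    exact (Finset.card_le_card (Finset.filter_subset _ _)).trans hthree) (hfin.trans hfin'.symm) hT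
  -- The rescaling by `τ` replaces the actual transport `ρ` by the torus element `θ` with `θ W =
  -- W'`.
  let τ : X.E → κˣ := fun e => if he : e ∈ twistEdges w v v' j then θ ⟨e, he⟩ * (ρ e)⁻¹ else 1
  refine ⟨α, β, τ, hα, hβ, fun c => ?_⟩
  -- Since `W'` is stable under scalars, the glueing needs to be right only up to a scalar `c` for
  -- each index.
  have hmap : W.map (scale fun e => c * θ e).toLinearMap ≤
      leadSpace (U v') (A v') (stepDiv (w v') v' v (b v v' - j)) P' := by
    rintro _ ⟨x, hx, rfl⟩
    have h1 : (scale fun e => c * θ e).toLinearMap x = (c : κ) • scale θ x := by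
      funext e
      change ((c * θ e : κˣ) : κ) * x e = c * (θ e * x e)
      push_cast
      ring
    rw [h1]
    exact Submodule.smul_mem _ _ (hW' (hθ ▸ ⟨x, hx, rfl⟩))
  obtain ⟨y, y', h1, h2, h3, h4, h5⟩ :=
    exists_matching_sections hPinj hPD hPinj' hPD' hW (hfin.trans hS.symm) hmap
  refine ⟨y, y', h1, h2, h3, h4, fun g hg l hl => ?_⟩
  refine (hρ g (y l) (h1 l hl).2 (y' l) (h2 l hl).2).2 hzero fun e he Q Q' hQ hQ' => ?_
  obtain rfl : P ⟨e, he⟩ = Q := by simpa using (hP ⟨e, he⟩).symm.trans hQ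
  obtain rfl : P' ⟨e, he⟩ = Q' := by simpa using (hP' ⟨e, he⟩).symm.trans hQ'
  have h6 := congrFun (h5 l hl) ⟨e, he⟩
  rw [scale_apply] at h6
  refine h6.trans ?_
  rw [hg e he]
  simp only [τ, dif_pos he]
  rw [← Units.val_mul, mul_assoc, inv_mul_cancel_right]
  rfl

/-- For an appropriate choice of the glueing at the nodes over one edge of the merged graph, the
second condition for limit linear series holds for that edge. -/
theorem exists_glueingCondition (hX : X.IsPseudocompact) {w₀ : X.Multidegree n}
    (hw : ∀ v, Multidegree.Reachable w₀ (w v)) (ht : IsTight w b)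
    {O : (X.withChains n).EnrichedStructure} {L : (X.withChains n).LineBundle}
    (hL : L.HasMultidegree w₀) (hLA : ∀ v, A v = L.onComponents O w₀ w v)
    (hline : ∀ p, ∃ m : ℤ,
      L.D (Sum.inr p) = m • (Finsupp.single (pointZero κ) 1 : Divisor (projectiveLine κ)))
    (hpre : IsPreLimit w b r A U)
    (hweak : WeakGlueing w b r A U) {v v' : X.V} (hadj : X.mergedGraph.Adj v v')
    (hthree : (X.edges v v').card ≤ 3) {d : ℤ}
    (hgeneral : ∀ x : X.E → ℤ, ∑ i ∈ X.edges v v', x i * (n i : ℤ) = 0 →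
      ∀ j ∈ X.edges v v', (∀ i ∈ X.edges v v', 0 < x i ↔ i = j) →
        d < ∑ i ∈ X.edges v v', x j * (n j : ℤ) / (n i : ℤ))
    (hd : (w v).total ≤ d) :
    ∃ μ : X.E → κˣ, ∀ g : X.E → κˣ, (∀ e ∈ X.edges v v', g e = μ e) →
      GlueingCondition O w₀ w b r (L.rescale g) U v v' := by
  classical
  obtain ⟨i, hi, hvan⟩ := exists_isOrderIndex_vanSeq hadj w (hpre.1 v).2.1 (hpre.1 v).2.2
  obtain ⟨i', hi', hvan'⟩ := exists_isOrderIndex_vanSeq hadj.symm w (hpre.1 v').2.1 (hpre.1 v').2.2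
  have hD := isExhausting_stepDiv hadj (w v)
  have hD' := isExhausting_stepDiv hadj.symm (w v')
  let S : ℕ → Finset (Fin (r + 1)) := fun j =>
    Finset.univ.filter fun l => i l = j ∧ i' (Fin.rev l) = b v v' - j
  have hS : ∀ j l, l ∈ S j ↔ i l = j ∧ i' (Fin.rev l) = b v v' - j := fun j l => by simp [S]
  have hcount : ∀ j ≤ b v v', IsCritical (twistSeq w v v') j →
      (S j).card = extremalCount w b r A U v v' j := fun j hj hjc =>
    (extremalCount_eq ht hadj hi hvan hi' hvan' hj hjc).symm
  have hdata := fun j hj hjc => exists_corresponding_sections hX hw ht hL hLA hline hweak hadj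
    hthree (hcount j hj hjc) hj hjc
  choose! α β τ hα hβ hdata using hdata
  -- One choice of glueing has to serve all indices with extremal sections at once.
  obtain ⟨μ, hμ⟩ := hpre.exists_common_torus hX ht hadj hthree hgeneral hd τ
  have hscal : ∀ j, ∃ c : κˣ, j ≤ b v v' → 0 < extremalCount w b r A U v v' j →
      ∀ e ∈ twistEdges w v v' j, μ e = c * τ j e := by
    intro j
    by_cases h : j ≤ b v v' ∧ 0 < extremalCount w b r A U v v' j
    · obtain ⟨c, hc⟩ := hμ j h.1 h.2
      exact ⟨c, fun _ _ => hc⟩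
    · exact ⟨1, fun h1 h2 => absurd ⟨h1, h2⟩ h⟩
  choose c hc using hscal
  have hsec := fun j hj hjc => hdata j hj hjc (c j)
  choose! y y' hy hy' hyli hyli' hcorr using hsec
  have hcrit : ∀ l, IsCritical (twistSeq w v v') (i l) := fun l => by
    rw [twistSeq_eq]
    exact hi.isCritical l
  -- Orienting twice is the identity, so this choice of glueing changes the transport starting at
  -- `v` by `μ`.
  refine ⟨fun e => orient μ e v, fun g hg => ?_⟩
  have hgμ : ∀ e ∈ X.edges v v', orient g e v = μ e := by
    intro e he
    have h := hg e he
    simp only [orient] at h ⊢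
    rw [h]
    split_ifs <;> simp
  have hA : (L.rescale g).onComponents O w₀ w = A := funext fun u => (hLA u).symm
  have hfd : ∀ u, FiniteDimensional κ (U u) := fun u => by
    have := (hpre.1 u).2.2
    exact Module.finite_of_finrank_pos (by omega)
  have hbasis : ∃ B : Module.Basis (Fin (r + 1)) κ (U v),
      (∀ l, HasOrder (A v) (twistSeq w v v') (B l) (vanSeq w r A U v v' l)) ∧
      ∀ j ≤ b v v', ∀ l ∈ S j, (B l : (X.comp v).K) = y j l := by
    have h0 : FiniteDimensional κ (vanishing (U v) (A v) (stepDiv (w v) v v' 0)) := by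
      rw [hD.vanishing_zero (hpre.1 v).2.1]
      exact hfd v
    have hmem : ∀ l ∈ Finset.univ.filter fun l => i l ≤ b v v' ∧ i' (Fin.rev l) = b v v' - i l,
        y (i l) l ∈ vanishing (U v) (A v) (stepDiv (w v) v v' (i l)) := by
      intro l hl
      obtain ⟨-, hl1, hl2⟩ := Finset.mem_filter.1 hl
      exact hy (i l) hl1 (hcrit l) l ((hS _ _).2 ⟨rfl, hl2⟩)
    have hind : ∀ k, LinearIndepOn κ
        (fun l => (vanishing (U v) (A v) (stepDiv (w v) v v' (k + 1))).mkQ (y (i l) l))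
        (((Finset.univ.filter fun l => i l ≤ b v v' ∧ i' (Fin.rev l) = b v v' - i l).filter
          fun l => i l = k : Finset (Fin (r + 1))) : Set (Fin (r + 1))) := by
      intro k
      by_cases hk : k ≤ b v v' ∧ IsCritical (twistSeq w v v') k
      · have hsub : ∀ l, l ∈ ((Finset.univ.filter fun l => i l ≤ b v v' ∧
            i' (Fin.rev l) = b v v' - i l).filter fun l => i l = k : Finset (Fin (r + 1))) →
              i l = k ∧ l ∈ S k := by
          intro l hl
          simp only [Finset.mem_filter, Finset.mem_univ, true_and] at hl
          obtain ⟨⟨-, h2⟩, rfl⟩ := hl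
          exact ⟨rfl, (hS _ _).2 ⟨rfl, h2⟩⟩
        refine ((hyli k hk.1 hk.2).mono fun l hl => (hsub l hl).2).congr fun l hl => ?_
        simp only [(hsub l hl).1]
      · convert linearIndepOn_empty κ _
        rw [Finset.coe_eq_empty, Finset.filter_eq_empty_iff]
        rintro l hl rfl
        exact hk ⟨(Finset.mem_filter.1 hl).2.1, hcrit l⟩
    obtain ⟨s, h1, h2, h3, h4⟩ := exists_adapted
      (vanishing_antitone (U v) (A v) hD.mono) hi.card _ _ hmem hind
    obtain ⟨B, hB⟩ := exists_basis_of_linearIndependent (hpre.1 v).2.2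
      (fun l => (h2 l).1) h4
    refine ⟨B, fun l => ?_, fun j hj l hl => ?_⟩
    · rw [hvan, twistSeq_eq, hB, hasOrder_iff hD (hi.isCritical l)]
      exact ⟨(h2 l).2, fun h => h3 l ⟨(h2 l).1, h⟩⟩
    · obtain ⟨rfl, h5⟩ := (hS _ _).1 hl
      rw [hB, h1 l (by simp [hj, h5])]
  -- On `Z_{v'}` the positions run backwards: the partner of position `l` is `Fin.rev l`.
  have hbasis' : ∃ B : Module.Basis (Fin (r + 1)) κ (U v'),
      (∀ l, HasOrder (A v') (twistSeq w v' v) (B l) (vanSeq w r A U v' v l)) ∧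
      ∀ j ≤ b v v', ∀ l ∈ S j, (B (Fin.rev l) : (X.comp v').K) = y' j l := by
    have h0 : FiniteDimensional κ (vanishing (U v') (A v') (stepDiv (w v') v' v 0)) := by
      rw [hD'.vanishing_zero (hpre.1 v').2.1]
      exact hfd v'
    have hmem : ∀ m ∈ Finset.univ.filter fun m => i (Fin.rev m) ≤ b v v' ∧
        i' m = b v v' - i (Fin.rev m), y' (i (Fin.rev m)) (Fin.rev m) ∈
          vanishing (U v') (A v') (stepDiv (w v') v' v (i' m)) := by
      intro m hm
      obtain ⟨-, hm1, hm2⟩ := Finset.mem_filter.1 hm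
      rw [hm2]
      exact hy' _ hm1 (hcrit _) _ ((hS _ _).2 ⟨rfl, by rw [Fin.rev_rev, hm2]⟩)
    have hind : ∀ k, LinearIndepOn κ (fun m =>
        (vanishing (U v') (A v') (stepDiv (w v') v' v (k + 1))).mkQ
          (y' (i (Fin.rev m)) (Fin.rev m)))
        (((Finset.univ.filter fun m => i (Fin.rev m) ≤ b v v' ∧
          i' m = b v v' - i (Fin.rev m)).filter
          fun m => i' m = k : Finset (Fin (r + 1))) : Set (Fin (r + 1))) := by
      intro k
      have hsub : ∀ m, m ∈ ((Finset.univ.filter fun m => i (Fin.rev m) ≤ b v v' ∧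
          i' m = b v v' - i (Fin.rev m)).filter fun m => i' m = k : Finset (Fin (r + 1))) →
            k ≤ b v v' ∧ i (Fin.rev m) = b v v' - k ∧ Fin.rev m ∈ S (b v v' - k) := by
        intro m hm
        simp only [Finset.mem_filter, Finset.mem_univ, true_and] at hm
        obtain ⟨⟨h1, h2⟩, h3⟩ := hm
        refine ⟨by omega, by omega, (hS _ _).2 ⟨by omega, ?_⟩⟩
        rw [Fin.rev_rev]
        omega
      -- The graded piece of index `k` on `Z_{v'}` faces the one of index `b - k` on `Z_v`, for
      -- which the corresponding sections were constructed.
      by_cases hk : k ≤ b v v' ∧ IsCritical (twistSeq w v v') (b v v' - k)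
      · have hli := hyli' (b v v' - k) (Nat.sub_le _ _) hk.2
        rw [Nat.sub_sub_self hk.1] at hli
        have hcomp := LinearIndependent.comp hli (fun m : {m // m ∈
          ((Finset.univ.filter fun m => i (Fin.rev m) ≤ b v v' ∧
          i' m = b v v' - i (Fin.rev m)).filter fun m => i' m = k : Finset (Fin (r + 1)))} =>
            ⟨Fin.rev m.1, (hsub m.1 m.2).2.2⟩) fun m m' h =>
              Subtype.ext (Fin.rev_injective (congrArg Subtype.val h))
        refine Eq.mp ?_ hcomp
        congr 1
        funext m
        simp only [Function.comp_apply, (hsub m.1 m.2).2.1]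
      · convert linearIndepOn_empty κ _
        rw [Finset.coe_eq_empty, Finset.eq_empty_iff_forall_notMem]
        intro m hm
        obtain ⟨h5, h6, -⟩ := hsub m hm
        exact hk ⟨h5, h6 ▸ hcrit _⟩
    obtain ⟨s, h1, h2, h3, h4⟩ := exists_adapted
      (vanishing_antitone (U v') (A v') hD'.mono) hi'.card _ _ hmem hind
    obtain ⟨B, hB⟩ := exists_basis_of_linearIndependent (hpre.1 v').2.2
      (fun l => (h2 l).1) h4
    refine ⟨B, fun l => ?_, fun j hj l hl => ?_⟩
    · rw [hvan', twistSeq_eq, hB, hasOrder_iff hD' (hi'.isCritical l)]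
      exact ⟨(h2 l).2, fun h => h3 l ⟨(h2 l).1, h⟩⟩
    · obtain ⟨rfl, h5⟩ := (hS _ _).1 hl
      rw [hB, h1 (Fin.rev l) (by simp [hj, h5]), Fin.rev_rev]
  obtain ⟨B, hB, hBy⟩ := hbasis
  obtain ⟨B', hB', hBy'⟩ := hbasis'
  rw [GlueingCondition, hA]
  refine ⟨B, B', hB, hB', fun j hj hjc => ⟨α j, β j, ?_, ?_, fun l hl hl' => ?_⟩⟩
  · rw [twistSeq_eq]
    exact hα j hj hjc
  · rw [twistSeq_eq]
    exact hβ j hj hjc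
  · obtain ⟨h1, h2⟩ := extremal_iff ht hadj hi hvan hi' hvan' hj hjc l
    have hlS : l ∈ S j := (hS _ _).2 ⟨h1.1 hl, h2.1 hl'⟩
    have hpos : 0 < extremalCount w b r A U v v' j := by
      rw [← hcount j hj hjc]
      exact Finset.card_pos.2 ⟨l, hlS⟩
    rw [LineBundle.inDegree_rescale, hBy j hj l hlS, hBy' j hj l hlS]
    refine hcorr j hj hjc g (fun e he => ?_) l hlS
    rw [hgμ e (Finset.mem_of_mem_filter e he)]
    exact hc j hj hpos e he

end NodalCurve
end OssermanLLS

/-! ### Assembling the lift over all edges -/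

namespace OssermanLLS
namespace NodalCurve

variable {κ : Type u} [Field κ] {X : NodalCurve κ} {n : X.E → ℕ+}
  {w : X.V → X.Multidegree n} {b : X.V → X.V → ℕ} {r : ℕ} {A : X.Div}
  {U : ∀ v, Submodule κ (X.comp v).K}

/-- Index `j` seen from `v'` is index `b - j` seen from `v`, with the same intermediate multidegree
and the same nodes; correspondence along the chains is symmetric. -/
theorem GlueingCondition.symm (hX : X.IsPseudocompact) {w₀ : X.Multidegree n} (ht : IsTight w b)
    {O : (X.withChains n).EnrichedStructure} {L : (X.withChains n).LineBundle} {v v' : X.V}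
    (hadj : X.mergedGraph.Adj v v') (h : GlueingCondition O w₀ w b r L U v v') :
    GlueingCondition O w₀ w b r L U v' v := by
  obtain ⟨s, s', hs, hs', hg⟩ := h
  refine ⟨s', s, hs', hs, fun j hj hjc => ?_⟩
  have hb := ht.symm hX hadj
  rw [← hb] at hj
  have hj' : b v v' - (b v v' - j) = j := Nat.sub_sub_self hj
  have hE := ht.twistEdges_eq hadj (Nat.sub_le (b v v') j)
  rw [hj'] at hE
  have hc : IsCritical (twistSeq w v v') (b v v' - j) := by
    rw [twistSeq_eq, isCritical_stepDiv hadj, ← twistEdges_eq_stepEdges, ← hE,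
      twistEdges_eq_stepEdges, ← isCritical_stepDiv hadj.symm, ← twistSeq_eq]
    exact hjc
  obtain ⟨α, β, hα, hβ, hcorr⟩ := hg (b v v' - j) (Nat.sub_le _ _) hc
  have hT := ht.iterate_eq hadj (Nat.sub_le (b v v') j)
  rw [hj'] at hβ hcorr hT
  rw [← hT] at hα hβ hcorr
  refine ⟨β, α, hβ, by rwa [← hb], fun l hl hl' => ?_⟩
  obtain ⟨t, h1, h2, h3⟩ := hcorr (Fin.rev l) (by rw [hb]; exact hl') (by rw [Fin.rev_rev]; exact hl)
  rw [Fin.rev_rev] at h2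
  exact ⟨t, h2, h1, by rw [hE]; exact h3⟩

/-- The divisor on `Z_v` by which the enriched structure changes the restriction of a line bundle. -/
noncomputable def firingDivisor (O : (X.withChains n).EnrichedStructure) (w₀ : X.Multidegree n)
    (w : X.V → X.Multidegree n) (v : X.V) : Divisor (X.comp v) :=
  (∑ u, firing w₀ (w v) u • (O.O u).D) (Sum.inl v)

/-- The line bundle with the prescribed restrictions to the components, up to the glueing. -/
noncomputable def liftBundle (O : (X.withChains n).EnrichedStructure) (w₀ : X.Multidegree n)
    (w : X.V → X.Multidegree n) (A : X.Div) : (X.withChains n).LineBundle where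
  D
    | Sum.inl v => A v - firingDivisor O w₀ w v
    -- The degree on an inserted line is placed at the point `0`, which keeps all bundles on the
    -- lines supported at `0` and `∞`.
    | Sum.inr p => w₀.toDiv (Sum.inr p) •
        (Finsupp.single (pointZero κ) 1 : Divisor (projectiveLine κ))
  glue := 1

theorem onComponents_liftBundle (O : (X.withChains n).EnrichedStructure) (w₀ : X.Multidegree n)
    (w : X.V → X.Multidegree n) (A : X.Div) (v : X.V) :
    A v = (liftBundle O w₀ w A).onComponents O w₀ w v :=
  (sub_add_cancel (A v) (firingDivisor O w₀ w v)).symm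

variable [IsAlgClosed κ]

theorem hasMultidegree_liftBundle {O : (X.withChains n).EnrichedStructure} {w₀ : X.Multidegree n}
    (hw : ∀ v, Multidegree.Reachable w₀ (w v)) (hA : ∀ v, (A v).degree = (w v).deg v) :
    (liftBundle O w₀ w A).HasMultidegree w₀ := by
  rintro (v | p)
  · have h1 := (firing_spec (reachable_firing (hw v))).toDiv_eq (Sum.inl v)
    rw [← (O.linEquiv_sum (firing w₀ (w v)) (Sum.inl v)).degree_eq] at h1
    have h2 : ((w v).toDiv (Sum.inl v) : ℤ) = (w v).deg v := rfl
    refine (Divisor.degree_sub (A v) (firingDivisor O w₀ w v)).trans ?_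
    rw [hA, ← h2, h1]
    exact add_sub_cancel_right _ _
  · have h1 : ∀ m : ℤ,
        Divisor.degree (m • (Finsupp.single (pointZero κ) 1 : Divisor (projectiveLine κ))) = m :=
      fun m => by rw [Divisor.degree_zsmul, Divisor.degree_single, mul_one]
    exact h1 _

/-- A pre-limit linear series satisfying the weak glueing condition lifts. -/
theorem liftsToLimit_of_weakGlueing (hX : X.IsPseudocompact)
    (hthree : ∀ v v' : X.V, (X.edges v v').card ≤ 3) {d : ℤ}
    (hgeneral : ∀ (v v' : X.V) (x : X.E → ℤ), ∑ i ∈ X.edges v v', x i * (n i : ℤ) = 0 →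
      ∀ j ∈ X.edges v v', (∀ i ∈ X.edges v v', 0 < x i ↔ i = j) →
        d < ∑ i ∈ X.edges v v', x j * (n j : ℤ) / (n i : ℤ))
    {w₀ : X.Multidegree n} (hd : w₀.total ≤ d) (hw : ∀ v, Multidegree.Reachable w₀ (w v))
    (ht : IsTight w b) {O : (X.withChains n).EnrichedStructure} (hpre : IsPreLimit w b r A U)
    (hweak : WeakGlueing w b r A U) : LiftsToLimit O w₀ w b r A U := by
  classical
  let L := liftBundle O w₀ w A
  have hL : L.HasMultidegree w₀ := hasMultidegree_liftBundle hw fun v => (hpre.1 v).1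
  have hLA : ∀ v, A v = L.onComponents O w₀ w v := onComponents_liftBundle O w₀ w A
  have htot : ∀ v, (w v).total ≤ d := by
    intro v
    obtain ⟨F, hF⟩ := reachable_firing (hw v)
    rw [hF.total_eq]
    exact hd
  have hex : ∀ v v' : X.V, ∃ μ : X.E → κˣ, X.mergedGraph.Adj v v' →
      ∀ g : X.E → κˣ, (∀ e ∈ X.edges v v', g e = μ e) →
        GlueingCondition O w₀ w b r (L.rescale g) U v v' := by
    intro v v'
    by_cases hadj : X.mergedGraph.Adj v v'
    · obtain ⟨μ, hμ⟩ := exists_glueingCondition hX hw ht hL hLA (fun p => ⟨_, rfl⟩) hpre hweak hadj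
        (hthree v v') (hgeneral v v') (htot v)
      exact ⟨μ, fun _ => hμ⟩
    · exact ⟨1, fun h => absurd h hadj⟩
  choose μ hμ using hex
  -- The construction for one edge depends on an order of its ends. A representative of the
  -- unordered pair fixes it, so the scalar at each node is defined once; the opposite order follows
  -- by symmetry.
  let q : Sym2 X.V → X.V × X.V := Quot.out
  have hq : ∀ v v', q s(v, v') = (v, v') ∨ q s(v, v') = (v', v) := by
    intro v v'
    have h1 : s((q s(v, v')).1, (q s(v, v')).2) = s(v, v') := Quot.out_eq s(v, v')
    rcases Sym2.eq_iff.1 h1 with ⟨h2, h3⟩ | ⟨h2, h3⟩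
    · exact Or.inl (Prod.ext h2 h3)
    · exact Or.inr (Prod.ext h2 h3)
  let g : X.E → κˣ := fun e => μ (q s(X.tail e, X.head e)).1 (q s(X.tail e, X.head e)).2 e
  have hg : ∀ v v', ∀ e ∈ X.edges v v', g e = μ (q s(v, v')).1 (q s(v, v')).2 e := by
    intro v v' e he
    have : s(X.tail e, X.head e) = s(v, v') := Sym2.eq_iff.2 (mem_edges.1 he)
    simp only [g, this]
  have hU : (fun v => (U v).map (LinearMap.mulLeft κ (1 : (X.comp v).K))) = U := by
    funext v
    rw [LinearMap.mulLeft_one, Submodule.map_id]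
  have hcomp : (L.rescale g).onComponents O w₀ w = A := funext fun v => (hLA v).symm
  -- The restrictions of the lift are the given bundles on the nose, so the identity serves as
  -- isomorphism.
  refine ⟨L.rescale g, hL, fun v => 1, fun v => ?_, ?_⟩
  · rw [hcomp]
    exact IsBundleIso.one _
  rw [hU]
  refine ⟨hL, fun v => ?_, fun v v' hadj => ⟨?_, ?_⟩⟩
  · rw [hcomp]
    exact (hpre.1 v).2
  · rw [hcomp]
    exact hpre.2 v v' hadj
  · rcases hq v v' with h | h
    · refine hμ v v' hadj g fun e he => ?_
      rw [hg v v' e he, h]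
    · refine (hμ v' v hadj.symm g fun e he => ?_).symm hX ht hadj.symm
      rw [edges_comm] at he
      rw [hg v v' e he, h]

end NodalCurve
end OssermanLLS

theorem mainTheorem11 {κ : Type u} [Field κ] [IsAlgClosed κ]
    (X : OssermanLLS.NodalCurve κ) (hX : X.IsPseudocompact) (n : X.E → ℕ+)
    (hthree : ∀ v v' : X.V, (X.edges v v').card ≤ 3)
    (d' : ℤ)
    (hgeneral : ∀ (v v' : X.V) (x : X.E → ℤ), ∑ i ∈ X.edges v v', x i * (n i : ℤ) = 0 →
      ∀ j ∈ X.edges v v', (∀ i ∈ X.edges v v', 0 < x i ↔ i = j) →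
        d' < ∑ i ∈ X.edges v v', x j * (n j : ℤ) / (n i : ℤ))
    (w₀ : X.Multidegree n) (hd : w₀.total ≤ d')
    (w : X.V → X.Multidegree n) (b : X.V → X.V → ℕ)
    (hw : ∀ v, OssermanLLS.NodalCurve.Multidegree.Reachable w₀ (w v))
    (htight : OssermanLLS.NodalCurve.IsTight w b)
    (O : (X.withChains n).EnrichedStructure)
    (r : ℕ) (A : X.Div) (U : ∀ v, Submodule κ (X.comp v).K)
    (hpre : OssermanLLS.NodalCurve.IsPreLimit w b r A U) :
    OssermanLLS.NodalCurve.LiftsToLimit O w₀ w b r A U ↔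
      OssermanLLS.NodalCurve.WeakGlueing w b r A U :=
  ⟨OssermanLLS.NodalCurve.weakGlueing_of_liftsToLimit hX hw htight hpre,
    OssermanLLS.NodalCurve.liftsToLimit_of_weakGlueing hX hthree hgeneral hd hw htight hpre⟩
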